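/- Graphs are simple and may be infinite. For a graph $G$, let $d_G(u,v)\in\mathbb{N}\cup\{\infty\}$ denote the distance of two vertices ($\infty$ if they lie in different components), and for sets of vertices let $d_G(A,B)$ denote the minimum of $d_G(a,b)$ over $a\in A$, $b\in B$ ($\infty$ if $A$ or $B$ is empty). An $A$–$B$ path is a path that meets $A$ exactly in its first vertex and $B$ exactly in its last vertex. A model of a graph $J$ in a graph $G$ consists of pairwise disjoint sets $U_x\subseteq V(G)$, $x\in V(J)$, each inducing a (nonempty) connected subgraph of $G$, and of internally disjoint paths $E_e$ in $G$, one for each edge $e=xy$ of $J$, such that $E_e$ is a $U_x$–$U_y$ path that is disjoint from every $U_z$ with $z\ne x,y$. For $K\in\mathbb{N}=\{0,1,2,\dots\}$, the model is $K$-fat if $d_G(Y,Z)\ge K$ for any two distinct members $Y,Z$ of the family of all the sets $U_x$ and all the (vertex sets of the) paths $E_e$, unless one of them is some $E_e$ and the other is some $U_x$ with $x$ an end of $e$. The graph $J$ is a minor (a $K$-fat minor) of $G$ if there is a model (a $K$-fat model) of $J$ in $G$. For real $M\ge 1$ and $A\ge 0$, the graph $G$ is $(M,A)$-quasi-isometric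 to a graph $H$ if there is a map $\varphi:V(G)\to V(H)$ such that $$M^{-1}d_G(u,v)-A\le d_H(\varphi(u),\varphi(v))\le M\,d_G(u,v)+A\qquad\text{for all }u,v\in V(G),$$ and for every $h\in V(H)$ there is $v\in V(G)$ with $d_H(h,\varphi(v))\le A$. **Theorem 1.2.** For every $t\in\mathbb{N}$ there exists a function $f:\mathbb{N}\to\mathbb{N}^2$ such that, for every $K\in\mathbb{N}$, every graph with no $K$-fat $K_{2,t}$ minor is $f(K)$-quasi-isometric to a graph with no $K_{2,t}$ minor. Moreover, if $t\ge 1$, then $f$ can be chosen such that in addition $$f(K)=(9t^{12}K+204t^{9}K,\;1)\qquad\text{for all }K\ge 1.$$ -/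

import Mathlib

open scoped NNReal ENNReal

universe u

namespace FatMinor

variable {α V W : Type*}

/-- The distance between two sets of vertices: the infimum of the distances between their
elements (`⊤` if no path joins them). -/
noncomputable def setDist (G : SimpleGraph V) (A B : Set V) : ℕ∞ :=
  ⨅ a ∈ A, ⨅ b ∈ B, G.edist a b

/-- `p` is an `A`–`B` path: a path which meets `A` exactly in its first vertex and `B` exactly in
its last vertex. -/
structure IsSetPath {G : SimpleGraph V} (A B : Set V) {u v : V} (p : G.Walk u v) : Prop where
  isPath : p.IsPath
  inter_left : {w | w ∈ p.support} ∩ A = {u}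
  inter_right : {w | w ∈ p.support} ∩ B = {v}

/-- A model of the graph `J` in the graph `G`: pairwise disjoint connected (in particular nonempty)
branch sets, one for each vertex of `J`, and internally disjoint branch paths, one for each edge
of `J`. The branch path of `xy` is a path from the branch set of `x` to that of `y`
that avoids all other branch sets. -/
structure Model (J : SimpleGraph α) (G : SimpleGraph V) where
  /-- The branch set of a vertex of `J`. -/
  branchSet : α → Set V
  connected_branchSet : ∀ x, (G.induce (branchSet x)).Connected
  disjoint_branchSet : ∀ x y, x ≠ y → Disjoint (branchSet x) (branchSet y)
  /-- The first vertex of the branch path of an edge of `J`. -/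
  first : J.edgeSet → V
  /-- The last vertex of the branch path of an edge of `J`. -/
  last : J.edgeSet → V
  /-- The branch path of an edge of `J`. -/
  branchPath : ∀ e, G.Walk (first e) (last e)
  isSetPath_branchPath : ∀ e : J.edgeSet, ∃ x y, (e : Sym2 α) = s(x, y) ∧
    IsSetPath (branchSet x) (branchSet y) (branchPath e)
  internally_disjoint : ∀ e f : J.edgeSet, e ≠ f → ∀ v ∈ (branchPath e).support,
    v ≠ first e → v ≠ last e → v ∉ (branchPath f).support
  avoids : ∀ (e : J.edgeSet) (z : α), z ∉ (e : Sym2 α) →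
    ∀ v ∈ (branchPath e).support, v ∉ branchSet z

/-- The vertex set of a branch path. -/
def Model.pathSet {J : SimpleGraph α} {G : SimpleGraph V} (m : Model J G) (e : J.edgeSet) :
    Set V :=
  {v | v ∈ (m.branchPath e).support}

/-- A model is `K`-fat if any two distinct members among its branch sets and branch paths are at
distance at least `K` in the host graph, except for a branch path and the branch sets
of the two ends of its edge. -/
structure Model.IsFat {J : SimpleGraph α} {G : SimpleGraph V} (m : Model J G) (K : ℕ) :
    Prop where
  set_set : ∀ x y, x ≠ y → (K : ℕ∞) ≤ setDist G (m.branchSet x) (m.branchSet y)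
  path_path : ∀ e f, e ≠ f → (K : ℕ∞) ≤ setDist G (m.pathSet e) (m.pathSet f)
  path_set : ∀ (e : J.edgeSet) (x : α), x ∉ (e : Sym2 α) →
    (K : ℕ∞) ≤ setDist G (m.pathSet e) (m.branchSet x)

/-- `J` is a minor of `G`. -/
def IsMinor (J : SimpleGraph α) (G : SimpleGraph V) : Prop :=
  Nonempty (Model J G)

/-- `J` is a `K`-fat minor of `G`. -/
def IsFatMinor (K : ℕ) (J : SimpleGraph α) (G : SimpleGraph V) : Prop :=
  ∃ m : Model J G, m.IsFat K

/-- `φ` is an `(M, A)`-quasi-isometry from `G` to `H`. Distances are extended: they are infinite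
between different components. The subtraction is truncated at `0`, which is harmless since
distances are nonnegative. -/
structure IsQuasiIsometry (G : SimpleGraph V) (H : SimpleGraph W) (M A : ℝ≥0) (φ : V → W) :
    Prop where
  one_le : 1 ≤ M
  lower : ∀ u v, ((M⁻¹ : ℝ≥0) : ℝ≥0∞) * (G.edist u v : ℝ≥0∞) - (A : ℝ≥0∞) ≤
    (H.edist (φ u) (φ v) : ℝ≥0∞)
  upper : ∀ u v, (H.edist (φ u) (φ v) : ℝ≥0∞) ≤
    (M : ℝ≥0∞) * (G.edist u v : ℝ≥0∞) + (A : ℝ≥0∞)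
  dense : ∀ h, ∃ v, (H.edist h (φ v) : ℝ≥0∞) ≤ (A : ℝ≥0∞)

/-- `G` is `(M, A)`-quasi-isometric to `H`. -/
def QuasiIsometric (G : SimpleGraph V) (H : SimpleGraph W) (M A : ℝ≥0) : Prop :=
  ∃ φ : V → W, IsQuasiIsometry G H M A φ

/-- The complete bipartite graph `K_{2,t}`. -/
abbrev K2 (t : ℕ) : SimpleGraph (Fin 2 ⊕ Fin t) :=
  completeBipartiteGraph (Fin 2) (Fin t)

end FatMinor

/-! Let t ≥ 2 and K ≥ 1; the remaining cases are direct. Fix a root in every component, let `lam` be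
the distance from it, and call a component of the subgraph at levels ≥ n a node. The basic source of
fat models is `isFatMinor_of_gates`: a connected set above level m with t pairwise distant vertices
at level m is one hub, the part of the graph below level m - 3K is the other, and pieces of shortest
descents towards the root are the arms. So if there is no fat model, then fewer than t balls cover
the bottom of a node (`exists_cover`), and few of the nodes a height w above it are wide, that is,
have a bottom of large diameter (`ncard_main_le`).

Slice the levels into windows of height w. Inside a window, the tracks leading to the wide nodes at
its top form boundedly many components. As a cutting level rises, the tracks above it can only split
and those below it can only merge, so by pigeonhole there is a good cut of height 3K across which
neither happens (`exists_goodCut`). Deleting the middle third of each good cut, the zone, leaves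
components at distance at least K. Descending paths through the zones link them, and two links that
come close join the same two components. Therefore a model of K_{2,t} in the graph obtained by
contracting these parts expands to a K-fat model in G (`Parts.isFatMinor`).

Narrow nodes get no zone below them; each starts a new block instead. The graph H is the quotient by
`proj`, whose classes are the parts inside the blocks. The edges of G that leave the node of a block
all become one edge of H (`Cuttable.proj_eq_of_crossing`), and K_{2,t} has no bridge, so a model of
it in H can be read off inside a single block (`Cuttable.isFatMinor`).

The classes have bounded diameter (`Ctx.within_of_proj_eq`): away from the bottom of its block a
class lives in two consecutive windows, excursions into narrow nodes can be shortcut, and what is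
left is covered by fewer than t balls. Contracting classes of bounded diameter is a quasi-isometry
(`quasiIsometric_quot`). -/

namespace FatMinor

/-! ### Bounded distance, joining walks and components. -/

section Walks

variable {V : Type*} (G : SimpleGraph V)

/-- The vertices `u` and `v` are at distance at most `n`. -/
def Within (n : ℕ) (u v : V) : Prop := ∃ p : G.Walk u v, p.length ≤ n

/-- There is a walk from `u` to `v` all of whose vertices lie in `S`. -/
def JoinedIn (S : Set V) (u v : V) : Prop := ∃ p : G.Walk u v, ∀ x ∈ p.support, x ∈ S

variable {G}

theorem Within.refl (n : ℕ) (u : V) : Within G n u u := ⟨.nil, by simp⟩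

theorem Within.symm {n : ℕ} {u v : V} (h : Within G n u v) : Within G n v u := by
  obtain ⟨p, hp⟩ := h
  exact ⟨p.reverse, by simpa using hp⟩

theorem Within.mono {m n : ℕ} {u v : V} (h : Within G m u v) (hmn : m ≤ n) : Within G n u v := by
  obtain ⟨p, hp⟩ := h
  exact ⟨p, hp.trans hmn⟩

theorem Within.trans {m n : ℕ} {u v x : V} (h : Within G m u v) (h' : Within G n v x) :
    Within G (m + n) u x := by
  obtain ⟨p, hp⟩ := h
  obtain ⟨q, hq⟩ := h'
  exact ⟨p.append q, by rw [SimpleGraph.Walk.length_append]; omega⟩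

theorem Within.of_adj {u v : V} (h : G.Adj u v) : Within G 1 u v := ⟨.cons h .nil, by simp⟩

theorem Within.reachable {n : ℕ} {u v : V} (h : Within G n u v) : G.Reachable u v := by
  obtain ⟨p, _⟩ := h
  exact ⟨p⟩

theorem Within.eq_of_zero {u v : V} (h : Within G 0 u v) : u = v := by
  obtain ⟨p, hp⟩ := h
  exact SimpleGraph.Walk.eq_of_length_eq_zero (Nat.le_zero.1 hp)

theorem within_iff_edist_le {n : ℕ} {u v : V} : Within G n u v ↔ G.edist u v ≤ n := by
  constructor
  · rintro ⟨p, hp⟩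
    exact (SimpleGraph.edist_le p).trans (by exact_mod_cast hp)
  · intro h
    obtain ⟨p, hp⟩ := G.exists_walk_of_edist_ne_top (u := u) (v := v)
      (ne_top_of_le_ne_top (by simp) h)
    exact ⟨p, by rw [← hp] at h; exact_mod_cast h⟩

/-- A walk of length at most `n` is a shorter walk followed by an edge. -/
theorem Within.succ_cases {n : ℕ} {u v : V} (h : Within G (n + 1) u v) :
    Within G n u v ∨ ∃ x, Within G n u x ∧ G.Adj x v := by
  obtain ⟨p, hp⟩ := h.symm
  cases p with
  | nil => exact Or.inl (Within.refl _ _)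
  | cons h q =>
    refine Or.inr ⟨_, Within.symm ⟨q, ?_⟩, h.symm⟩
    simp only [SimpleGraph.Walk.length_cons] at hp
    omega

theorem within_of_mem_support {n : ℕ} {u v x : V} (p : G.Walk u v) (hp : p.length ≤ n)
    (hx : x ∈ p.support) : Within G n u x ∧ Within G n x v := by
  classical
  exact ⟨⟨p.takeUntil x hx, (p.length_takeUntil_le_length hx).trans hp⟩,
    ⟨p.dropUntil x hx, (p.length_dropUntil_le_length hx).trans hp⟩⟩

namespace JoinedIn

variable {S T : Set V} {u v x : V}

theorem refl (h : u ∈ S) : JoinedIn G S u u := ⟨.nil, by simpa using h⟩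

theorem symm (h : JoinedIn G S u v) : JoinedIn G S v u := by
  obtain ⟨p, hp⟩ := h
  exact ⟨p.reverse, by simpa using hp⟩

theorem trans (h : JoinedIn G S u v) (h' : JoinedIn G S v x) : JoinedIn G S u x := by
  obtain ⟨p, hp⟩ := h
  obtain ⟨q, hq⟩ := h'
  refine ⟨p.append q, fun y hy => ?_⟩
  rw [SimpleGraph.Walk.mem_support_append_iff] at hy
  exact hy.elim (hp y) (hq y)

theorem mono (h : JoinedIn G S u v) (hST : S ⊆ T) : JoinedIn G T u v := by
  obtain ⟨p, hp⟩ := h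
  exact ⟨p, fun y hy => hST (hp y hy)⟩

theorem left_mem (h : JoinedIn G S u v) : u ∈ S := by
  obtain ⟨p, hp⟩ := h
  exact hp _ p.start_mem_support

theorem right_mem (h : JoinedIn G S u v) : v ∈ S := h.symm.left_mem

theorem of_adj (h : G.Adj u v) (hu : u ∈ S) (hv : v ∈ S) : JoinedIn G S u v :=
  ⟨.cons h .nil, by simp [hu, hv]⟩

theorem tail (h : JoinedIn G S u v) (hvx : G.Adj v x) (hx : x ∈ S) : JoinedIn G S u x :=
  h.trans (of_adj hvx h.right_mem hx)

theorem reachable (h : JoinedIn G S u v) : G.Reachable u v := by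
  obtain ⟨p, _⟩ := h
  exact ⟨p⟩

theorem head_induction {P : V → Prop} (h : JoinedIn G S u v) (hv : P v)
    (step : ∀ a b, a ∈ S → G.Adj a b → JoinedIn G S b v → P b → P a) : P u := by
  obtain ⟨p, hp⟩ := h
  induction p with
  | nil => exact hv
  | cons hab q ih =>
    have hq : ∀ x ∈ q.support, x ∈ S := fun x hx => hp x (by simp [hx])
    exact step _ _ (hp _ (by simp)) hab ⟨q, hq⟩ (ih hv step hq)

theorem induction {P : V → Prop} (h : JoinedIn G S u v) (hu : P u)
    (step : ∀ a b, JoinedIn G S u a → G.Adj a b → b ∈ S → P a → P b) : P v :=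
  h.symm.head_induction hu fun a b ha hab hb pb => step b a hb.symm hab.symm ha pb

theorem inter (h : JoinedIn G S u v) (hu : u ∈ T)
    (step : ∀ a b, a ∈ S → a ∈ T → G.Adj a b → b ∈ S → b ∈ T) : JoinedIn G (S ∩ T) u v :=
  h.induction (P := fun y => JoinedIn G (S ∩ T) u y) (refl ⟨h.left_mem, hu⟩)
    fun a b _ hab hb ha => ha.tail hab ⟨hb, step a b ha.right_mem.1 ha.right_mem.2 hab hb⟩

/-- A walk starting in `T` and leaving it does so along an edge. -/
theorem exists_exit (h : JoinedIn G S u v) (hu : u ∈ T) (hv : v ∉ T) :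
    ∃ a b, JoinedIn G (S ∩ T) u a ∧ G.Adj a b ∧ b ∈ S ∧ b ∉ T ∧ JoinedIn G S b v := by
  by_contra hcon
  push Not at hcon
  refine hv (h.symm.head_induction (P := fun y => y ∈ T ∧ JoinedIn G (S ∩ T) u y) ?_ ?_).1
  · exact ⟨hu, refl ⟨h.left_mem, hu⟩⟩
  · rintro a b ha hab hb ⟨hbT, hub⟩
    by_cases haT : a ∈ T
    · exact ⟨haT, hub.tail hab.symm ⟨ha, haT⟩⟩
    · exact absurd ((of_adj hab ha hb.left_mem).trans (hb.trans h)) fun _ =>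
        hcon b a hub hab.symm ha haT ((of_adj hab ha hb.left_mem).trans (hb.trans h))

end JoinedIn

theorem Within.joinedIn {n : ℕ} {u v : V} {S : Set V} (h : Within G n u v)
    (hS : ∀ x, Within G n u x → Within G n x v → x ∈ S) : JoinedIn G S u v := by
  obtain ⟨p, hp⟩ := h
  exact ⟨p, fun x hx => hS x (within_of_mem_support p hp hx).1 (within_of_mem_support p hp hx).2⟩

theorem joinedIn_of_mem_support {u v x : V} {S : Set V} (p : G.Walk u v)
    (hp : ∀ y ∈ p.support, y ∈ S) (hx : x ∈ p.support) : JoinedIn G S u x := by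
  classical
  exact ⟨p.takeUntil x hx, fun y hy => hp y (p.support_takeUntil_subset_support hx hy)⟩

theorem induce_connected_iff {S : Set V} :
    (G.induce S).Connected ↔ S.Nonempty ∧ ∀ u ∈ S, ∀ v ∈ S, JoinedIn G S u v := by
  constructor
  · intro h
    refine ⟨Set.nonempty_coe_sort.1 h.nonempty, fun u hu v hv => ?_⟩
    obtain ⟨p⟩ := h.preconnected ⟨u, hu⟩ ⟨v, hv⟩
    have key : ∀ {a b : S}, (G.induce S).Walk a b → JoinedIn G S a b := by
      intro a b q
      induction q with
      | nil => exact JoinedIn.refl (Subtype.prop _)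
      | cons hab _ ih =>
        exact (JoinedIn.of_adj (SimpleGraph.induce_adj.1 hab) (Subtype.prop _)
          (Subtype.prop _)).trans ih
    exact key p
  · rintro ⟨hne, h⟩
    have := hne.to_subtype
    refine ⟨fun u v => ?_⟩
    obtain ⟨p, hp⟩ := h u u.2 v v.2
    exact ⟨p.induce S hp⟩

/-- The component of `u` in the subgraph induced on `S`. -/
def comp (G : SimpleGraph V) (S : Set V) (u : V) : Set V := {v | JoinedIn G S u v}

theorem mem_comp_self {S : Set V} {u : V} (h : u ∈ S) : u ∈ comp G S u := JoinedIn.refl h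

theorem comp_eq_of_joinedIn {S : Set V} {u v : V} (h : JoinedIn G S u v) :
    comp G S u = comp G S v :=
  Set.ext fun _ => ⟨fun hx => h.symm.trans hx, fun hx => h.trans hx⟩

theorem joinedIn_of_comp_eq {S : Set V} {u v : V} (hv : v ∈ S) (h : comp G S u = comp G S v) :
    JoinedIn G S u v := by
  have : v ∈ comp G S v := mem_comp_self hv
  rw [← h] at this
  exact this

theorem comp_connected {S : Set V} {u x y : V} (hx : x ∈ comp G S u) (hy : y ∈ comp G S u) :
    JoinedIn G (comp G S u) x y := by
  have key : ∀ z ∈ comp G S u, JoinedIn G (comp G S u) u z := fun z hz => by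
    have h2 : u ∈ S := JoinedIn.left_mem hz
    exact (JoinedIn.inter hz (T := comp G S u) (mem_comp_self h2)
      fun a b _ ha hab hb => JoinedIn.tail ha hab hb).mono Set.inter_subset_right
  exact (key x hx).symm.trans (key y hy)

end Walks

/-! ### Criteria for fat models, and the content of an ordinary model. -/

section FatModels

variable {V : Type*} {G : SimpleGraph V}

/-- `S` is nonempty and any two of its vertices are joined in it. -/
def IsConn (G : SimpleGraph V) (S : Set V) : Prop :=
  S.Nonempty ∧ ∀ u ∈ S, ∀ v ∈ S, JoinedIn G S u v

theorem IsConn.of_center {S : Set V} (c : V) (hc : c ∈ S) (h : ∀ u ∈ S, JoinedIn G S c u) :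
    IsConn G S :=
  ⟨⟨c, hc⟩, fun u hu v hv => (h u hu).symm.trans (h v hv)⟩

theorem IsConn.comp {S : Set V} {u : V} (hu : u ∈ S) : IsConn G (comp G S u) :=
  ⟨⟨u, mem_comp_self hu⟩, fun _ hx _ hy => comp_connected hx hy⟩

theorem le_edist_of_not_within {K : ℕ} {u v : V} (h : ¬ Within G (K - 1) u v) :
    (K : ℕ∞) ≤ G.edist u v := by
  rcases Nat.eq_zero_or_pos K with rfl | hK
  · simp
  rw [within_iff_edist_le, not_le] at h
  have h2 := Order.add_one_le_of_lt h
  have h3 : ((K - 1 : ℕ) : ℕ∞) + 1 = (K : ℕ∞) := by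
    exact_mod_cast congrArg (fun n : ℕ => (n : ℕ∞)) (Nat.sub_add_cancel hK)
  rwa [h3] at h2

theorem le_setDist {K : ℕ} {A B : Set V}
    (h : ∀ u ∈ A, ∀ v ∈ B, ¬ Within G (K - 1) u v) : (K : ℕ∞) ≤ setDist G A B :=
  le_iInf₂ fun u hu => le_iInf₂ fun v hv => le_edist_of_not_within (h u hu v hv)

theorem exists_ends {t : ℕ} (e : (K2 t).edgeSet) :
    ∃ ik : Fin 2 × Fin t, (e : Sym2 (Fin 2 ⊕ Fin t)) = s(.inl ik.1, .inr ik.2) := by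
  obtain ⟨e, he⟩ := e
  induction e using Sym2.ind with
  | h x y =>
    rw [SimpleGraph.mem_edgeSet, completeBipartiteGraph_adj] at he
    rcases x with i | k <;> rcases y with j | l <;> simp at he
    · exact ⟨(i, l), rfl⟩
    · exact ⟨(j, k), Sym2.eq_swap⟩

/-- A fat model of `K_{2,t}`, given by branch sets and branch paths that are far apart. -/
theorem isFatMinor_of_paths {K t : ℕ} {Q : Fin 2 → Fin t → Set V} (S : Fin 2 ⊕ Fin t → Set V)
    (conn : ∀ x, IsConn G (S x))
    (far : ∀ x y, x ≠ y → ∀ u ∈ S x, ∀ v ∈ S y, ¬ Within G (K - 1) u v)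
    (paths : ∀ i k, ∃ (a b : V) (p : G.Walk a b), p.IsPath ∧
      (∀ x ∈ p.support, x ∈ S (.inl i) ↔ x = a) ∧ (∀ x ∈ p.support, x ∈ S (.inr k) ↔ x = b) ∧
      ∀ x ∈ p.support, x ∈ Q i k)
    (far_paths : ∀ i k i' k', (i, k) ≠ (i', k') → ∀ u ∈ Q i k, ∀ v ∈ Q i' k',
      ¬ Within G (K - 1) u v)
    (far_path_set : ∀ i k x, x ≠ .inl i → x ≠ .inr k → ∀ u ∈ Q i k, ∀ v ∈ S x,
      ¬ Within G (K - 1) u v) : IsFatMinor K (K2 t) G := by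
  choose ik hik using exists_ends (t := t)
  choose a b p hp ha hb hQ using paths
  have inj : ∀ e f, e ≠ f → ((ik e).1, (ik e).2) ≠ ((ik f).1, (ik f).2) := by
    intro e f hef h
    apply hef
    apply Subtype.ext
    rw [hik e, hik f]
    simp only [Prod.mk.injEq] at h
    rw [h.1, h.2]
  let m : Model (K2 t) G :=
    { branchSet := S
      connected_branchSet := fun x => induce_connected_iff.2 (conn x)
      -- The subtraction K - 1 is truncated, so even for K = 0 the hypothesis excludes equal
      -- vertices and yields disjointness.
      disjoint_branchSet := fun x y hxy => Set.disjoint_left.2 fun v hv hv' =>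
        far x y hxy v hv v hv' (Within.refl _ _)
      first := fun e => a (ik e).1 (ik e).2
      last := fun e => b (ik e).1 (ik e).2
      branchPath := fun e => p (ik e).1 (ik e).2
      isSetPath_branchPath := fun e => by
        refine ⟨_, _, hik e, hp _ _, ?_, ?_⟩
        · ext x
          simp only [Set.mem_inter_iff, Set.mem_ofPred_eq, Set.mem_singleton_iff]
          refine ⟨fun h => (ha _ _ x h.1).1 h.2, ?_⟩
          rintro rfl
          exact ⟨SimpleGraph.Walk.start_mem_support _,
            (ha _ _ _ (SimpleGraph.Walk.start_mem_support _)).2 rfl⟩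
        · ext x
          simp only [Set.mem_inter_iff, Set.mem_ofPred_eq, Set.mem_singleton_iff]
          refine ⟨fun h => (hb _ _ x h.1).1 h.2, ?_⟩
          rintro rfl
          exact ⟨SimpleGraph.Walk.end_mem_support _,
            (hb _ _ _ (SimpleGraph.Walk.end_mem_support _)).2 rfl⟩
      internally_disjoint := fun e f hef v hv _ _ hv' =>
        far_paths _ _ _ _ (inj e f hef) v (hQ _ _ v hv) v (hQ _ _ v hv') (Within.refl _ _)
      avoids := fun e z hz v hv hv' => by
        rw [hik e, Sym2.mem_iff, not_or] at hz
        exact far_path_set _ _ z hz.1 hz.2 v (hQ _ _ v hv) v hv' (Within.refl _ _) }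
  refine ⟨m, fun x y hxy => le_setDist (far x y hxy), fun e f hef => ?_, fun e x hx => ?_⟩
  · exact le_setDist fun u hu v hv =>
      far_paths _ _ _ _ (inj e f hef) u (hQ _ _ u hu) v (hQ _ _ v hv)
  · rw [hik e, Sym2.mem_iff, not_or] at hx
    exact le_setDist fun u hu v hv => far_path_set _ _ x hx.1 hx.2 u (hQ _ _ u hu) v hv

/-- A shortest walk between two sets at distance `K`. -/
theorem exists_path_of_far {K : ℕ} {A B : Set V} {a b : V} (haA : a ∈ A) (hbB : b ∈ B)
    (hab : Within G K a b) (far : ∀ u ∈ A, ∀ v ∈ B, ¬ Within G (K - 1) u v) :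
    ∃ p : G.Walk a b, p.IsPath ∧ p.length ≤ K ∧ (∀ x ∈ p.support, x ∈ A ↔ x = a) ∧
      (∀ x ∈ p.support, x ∈ B ↔ x = b) := by
  classical
  obtain ⟨q, hq⟩ := hab
  have hlen : q.bypass.length ≤ K := (q.length_bypass_le_length).trans hq
  have hsum : ∀ x (hx : x ∈ q.bypass.support),
      (q.bypass.takeUntil x hx).length + (q.bypass.dropUntil x hx).length ≤ K := by
    intro x hx
    rw [← SimpleGraph.Walk.length_append, SimpleGraph.Walk.take_spec]
    exact hlen
  refine ⟨q.bypass, q.bypass_isPath, hlen, fun x hx => ⟨fun h => ?_, fun h => h ▸ haA⟩,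
    fun x hx => ⟨fun h => ?_, fun h => h ▸ hbB⟩⟩
  -- From any visit to A at least K edges remain to B, and the whole path has at most K edges, so
  -- the visit occurs at the start.
  · have h1 : ¬ (q.bypass.dropUntil x hx).length ≤ K - 1 := fun h' => far x h b hbB ⟨_, h'⟩
    have h2 : (q.bypass.takeUntil x hx).length = 0 := by have := hsum x hx; omega
    exact (SimpleGraph.Walk.eq_of_length_eq_zero h2).symm
  · have h1 : ¬ (q.bypass.takeUntil x hx).length ≤ K - 1 := fun h' => far a haA x h ⟨_, h'⟩
    have h2 : (q.bypass.dropUntil x hx).length = 0 := by have := hsum x hx; omega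
    exact SimpleGraph.Walk.eq_of_length_eq_zero h2

/-- Two distant hubs, together with `t` pairwise distant connected sets, each at distance exactly
`K` from both hubs, give a `K`-fat model of `K_{2,t}`. -/
theorem isFatMinor_of_arms {K t : ℕ} (hK : 1 ≤ K) (H : Fin 2 → Set V) (P : Fin t → Set V)
    (connH : ∀ i, IsConn G (H i)) (connP : ∀ k, IsConn G (P k))
    (farH : ∀ i j, i ≠ j → ∀ u ∈ H i, ∀ v ∈ H j, ¬ Within G (3 * K - 1) u v)
    (farP : ∀ k l, k ≠ l → ∀ u ∈ P k, ∀ v ∈ P l, ¬ Within G (3 * K - 1) u v)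
    (farHP : ∀ i k, ∀ u ∈ H i, ∀ v ∈ P k, ¬ Within G (K - 1) u v)
    (near : ∀ i k, ∃ u ∈ H i, ∃ v ∈ P k, Within G K u v) : IsFatMinor K (K2 t) G := by
  -- `Q i k` contains every walk of length at most K from hub i to arm k. Two of these sets differ
  -- in the hub or in the arm, whence the constant 3K - 1 = K + (K - 1) + K.
  let Q : Fin 2 → Fin t → Set V := fun i k =>
    {x | (∃ u ∈ H i, Within G K u x) ∧ ∃ v ∈ P k, Within G K x v}
  refine isFatMinor_of_paths (Q := Q) (Sum.elim H P) ?_ ?_ ?_ ?_ ?_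
  · rintro (i | k)
    exacts [connH i, connP k]
  · rintro (i | k) (j | l) hne u hu v hv h
    · exact farH i j (fun h => hne (by rw [h])) u hu v hv (h.mono (by omega))
    · exact farHP i l u hu v hv h
    · exact farHP j k v hv u hu h.symm
    · exact farP k l (fun h => hne (by rw [h])) u hu v hv (h.mono (by omega))
  · intro i k
    obtain ⟨u, hu, v, hv, huv⟩ := near i k
    obtain ⟨p, hp, hl, h1, h2⟩ := exists_path_of_far hu hv huv (farHP i k)
    exact ⟨u, v, p, hp, h1, h2, fun x hx => ⟨⟨u, hu, (within_of_mem_support p hl hx).1⟩,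
      ⟨v, hv, (within_of_mem_support p hl hx).2⟩⟩⟩
  · rintro i k i' k' hne x ⟨⟨u, hu, hux⟩, v, hv, hxv⟩ y ⟨⟨u', hu', huy⟩, v', hv', hyv⟩ h
    by_cases hk : k = k'
    · have hi : i ≠ i' := fun hi => hne (by rw [hi, hk])
      exact farH i i' hi u hu u' hu' (((hux.trans h).trans huy.symm).mono (by omega))
    · exact farP k k' hk v hv v' hv' (((hxv.symm.trans h).trans hyv).mono (by omega))
  · rintro i k (j | l) h1 h2 x ⟨⟨u, hu, hux⟩, v, hv, hxv⟩ y hy h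
    · exact farH i j (fun h => h1 (by rw [h])) u hu y hy ((hux.trans h).mono (by omega))
    · exact farP k l (fun h => h2 (by rw [h])) v hv y hy ((hxv.symm.trans h).mono (by omega))

/-- The branch path of an edge, without its end in the hub. -/
theorem exists_tail {t : ℕ} (m : Model (K2 t) G) (i : Fin 2) (k : Fin t) :
    ∃ T : Set V, IsConn G (T ∪ m.branchSet (.inr k)) ∧
      (∀ j, ∀ v ∈ T, v ∉ m.branchSet (.inl j)) ∧
      (∀ l, l ≠ k → ∀ v ∈ T, v ∉ m.branchSet (.inr l)) ∧
      (∃ u ∈ m.branchSet (.inl i), ∃ v ∈ T, G.Adj u v) ∧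
      ∃ e : (K2 t).edgeSet, (e : Sym2 (Fin 2 ⊕ Fin t)) = s(.inl i, .inr k) ∧
        ∀ v ∈ T, v ∈ (m.branchPath e).support ∧ (v ∈ m.branchSet (.inr k) ∨
          v ≠ m.first e ∧ v ≠ m.last e) := by
  have hadj : (K2 t).Adj (.inl i) (.inr k) := by simp [K2]
  let e : (K2 t).edgeSet := ⟨s(.inl i, .inr k), hadj⟩
  have hkey : ∃ (a b : V) (p : G.Walk a b), p.IsPath ∧
      {w | w ∈ p.support} ∩ m.branchSet (.inl i) = {a} ∧
      {w | w ∈ p.support} ∩ m.branchSet (.inr k) = {b} ∧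
      (∀ v, v ∈ p.support ↔ v ∈ (m.branchPath e).support) ∧
      ∀ v, v ≠ a → v ≠ b → v ≠ m.first e ∧ v ≠ m.last e := by
    obtain ⟨x, y, hxy, hpath⟩ := m.isSetPath_branchPath e
    have hxy' : s(Sum.inl i, Sum.inr k) = s(x, y) := hxy
    rw [Sym2.eq_iff] at hxy'
    -- The model does not prescribe from which end of the edge its branch path starts, so the path
    -- may have to be reversed.
    rcases hxy' with ⟨rfl, rfl⟩ | ⟨rfl, rfl⟩
    · exact ⟨_, _, m.branchPath e, hpath.isPath, hpath.inter_left, hpath.inter_right,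
        fun _ => Iff.rfl, fun v h1 h2 => ⟨h1, h2⟩⟩
    · refine ⟨_, _, (m.branchPath e).reverse, hpath.isPath.reverse, ?_, ?_, fun v => by simp,
        fun v h1 h2 => ⟨h2, h1⟩⟩
      · simpa using hpath.inter_right
      · simpa using hpath.inter_left
  obtain ⟨a, b, p, hp, hA, hB, hsup, hends⟩ := hkey
  have ha : a ∈ m.branchSet (.inl i) := by
    have : a ∈ ({w | w ∈ p.support} ∩ m.branchSet (.inl i)) := by rw [hA]; rfl
    exact this.2
  have hb : b ∈ m.branchSet (.inr k) := by
    have : b ∈ ({w | w ∈ p.support} ∩ m.branchSet (.inr k)) := by rw [hB]; rfl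
    exact this.2
  cases p with
  | nil => exact absurd hb (Set.disjoint_left.1 (m.disjoint_branchSet _ _ (by simp)) ha)
  | @cons _ c _ hac q =>
    rw [SimpleGraph.Walk.cons_isPath_iff] at hp
    have hmem : ∀ v ∈ q.support, v ∈ (m.branchPath e).support :=
      fun v hv => (hsup v).1 (by simp [hv])
    refine ⟨{v | v ∈ q.support}, ?_, ?_, ?_, ⟨a, ha, c, q.start_mem_support, hac⟩, e, rfl, ?_⟩
    · have hconn := (induce_connected_iff.1 (m.connected_branchSet (.inr k))).2
      refine IsConn.of_center b (Or.inr hb) fun v hv => ?_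
      rcases hv with hv | hv
      · have h1 : JoinedIn G {v | v ∈ q.support} c v :=
          joinedIn_of_mem_support q (fun y hy => hy) hv
        have h2 : JoinedIn G {v | v ∈ q.support} c b :=
          joinedIn_of_mem_support q (fun y hy => hy) q.end_mem_support
        exact (h2.symm.trans h1).mono Set.subset_union_left
      · exact (hconn b hb v hv).mono Set.subset_union_right
    · intro j v hv hvj
      by_cases hij : j = i
      · subst hij
        have : v ∈ ({a} : Set V) := by
          rw [← hA]; exact ⟨by simp [show v ∈ q.support from hv], hvj⟩
        rw [Set.mem_singleton_iff] at this
        exact hp.2 (this ▸ hv)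
      · refine m.avoids e (.inl j) ?_ v (hmem v hv) hvj
        simp [e, hij]
    · intro l hl v hv hvl
      refine m.avoids e (.inr l) ?_ v (hmem v hv) hvl
      simp [e, hl]
    · intro v hv
      refine ⟨hmem v hv, ?_⟩
      by_cases hvb : v = b
      · exact Or.inl (hvb ▸ hb)
      · exact Or.inr (hends v (fun h => hp.2 (h ▸ hv)) hvb)

/-- A `K_{2,t}` minor yields disjoint connected sets, one for each vertex of `K_{2,t}`, with edges
between the hubs and the arms. -/
theorem exists_sets_of_isMinor {t : ℕ} (h : IsMinor (K2 t) G) :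
    ∃ S : Fin 2 ⊕ Fin t → Set V, (∀ x, IsConn G (S x)) ∧
      (∀ x y, x ≠ y → Disjoint (S x) (S y)) ∧
      ∀ i k, ∃ u ∈ S (.inl i), ∃ v ∈ S (.inr k), G.Adj u v := by
  obtain ⟨m⟩ := h
  choose T hT1 hT2 hT3 hT4 e he hT5 using exists_tail m
  have hsub : ∀ k i, T i k ⊆ (T 0 k ∪ m.branchSet (.inr k)) ∪ (T 1 k ∪ m.branchSet (.inr k)) := by
    intro k i v hv
    fin_cases i
    · exact Or.inl (Or.inl hv)
    · exact Or.inr (Or.inl hv)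
  have hmem : ∀ k v, v ∈ (T 0 k ∪ m.branchSet (.inr k)) ∪ (T 1 k ∪ m.branchSet (.inr k)) →
      (∃ i, v ∈ T i k) ∨ v ∈ m.branchSet (.inr k) := by
    rintro k v ((h | h) | (h | h))
    exacts [Or.inl ⟨0, h⟩, Or.inr h, Or.inl ⟨1, h⟩, Or.inr h]
  have hA : ∀ j k v, v ∈ (T 0 k ∪ m.branchSet (.inr k)) ∪ (T 1 k ∪ m.branchSet (.inr k)) →
      v ∉ m.branchSet (.inl j) := by
    intro j k v hv
    rcases hmem k v hv with ⟨i, hi⟩ | hb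
    · exact hT2 i k j v hi
    · exact Set.disjoint_left.1 (m.disjoint_branchSet _ _ (by simp)) hb
  -- Each arm absorbs both of its branch paths up to, but excluding, their ends in the hubs.
  refine ⟨Sum.elim (fun i => m.branchSet (.inl i))
    (fun k => (T 0 k ∪ m.branchSet (.inr k)) ∪ (T 1 k ∪ m.branchSet (.inr k))), ?_, ?_, ?_⟩
  · rintro (i | k)
    · exact induce_connected_iff.1 (m.connected_branchSet (.inl i))
    · obtain ⟨⟨c, hc⟩, -⟩ := induce_connected_iff.1 (m.connected_branchSet (.inr k))
      refine IsConn.of_center c (Or.inl (Or.inr hc)) ?_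
      rintro v (hv | hv)
      · exact ((hT1 0 k).2 c (Or.inr hc) v hv).mono Set.subset_union_left
      · exact ((hT1 1 k).2 c (Or.inr hc) v hv).mono Set.subset_union_right
  · rintro (i | k) (j | l) hne
    · exact m.disjoint_branchSet _ _ hne
    · exact Set.disjoint_right.2 fun v hv => hA i l v hv
    · exact Set.disjoint_left.2 fun v hv => hA j k v hv
    · have hkl : k ≠ l := fun h => hne (by rw [h])
      refine Set.disjoint_left.2 fun v hv hv' => ?_
      rcases hmem k v hv with ⟨i, hi⟩ | hb <;> rcases hmem l v hv' with ⟨j, hj⟩ | hb'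
      · rcases (hT5 i k v hi).2 with hb | hb
        · exact hT3 j l k hkl v hj hb
        · refine m.internally_disjoint (e i k) (e j l) ?_ v (hT5 i k v hi).1 hb.1 hb.2
            (hT5 j l v hj).1
          intro hef
          have h1 := he i k
          rw [hef, he j l] at h1
          simp at h1
          exact hkl h1.2.symm
      · exact hT3 i k l hkl.symm v hi hb'
      · exact hT3 j l k hkl v hj hb
      · exact Set.disjoint_left.1 (m.disjoint_branchSet _ _ hne) hb hb'
  · intro i k
    obtain ⟨u, hu, v, hv, huv⟩ := hT4 i k
    exact ⟨u, hu, v, hsub k i hv, huv⟩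

end FatModels

/-! ### Levels, descents, and covers of the bottom of a node. -/

section Levels

variable {V : Type*} {G : SimpleGraph V}

/-- `lam` measures the distance from a root chosen in each component. -/
structure IsLevel (G : SimpleGraph V) (lam : V → ℕ) : Prop where
  adj : ∀ u v, G.Adj u v → lam v ≤ lam u + 1
  pred : ∀ v, 0 < lam v → ∃ u, G.Adj v u ∧ lam u + 1 = lam v
  root : ∀ u v, G.Reachable u v → lam u = 0 → lam v = 0 → u = v

theorem exists_isLevel (G : SimpleGraph V) : ∃ lam : V → ℕ, IsLevel G lam := by
  let root : V → V := fun v => (G.connectedComponentMk v).out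
  have hr : ∀ v, G.Reachable (root v) v := fun v =>
    SimpleGraph.ConnectedComponent.exact (Quot.out_eq (G.connectedComponentMk v))
  have heq : ∀ u v, G.Reachable u v → root u = root v := fun u v h => by
    simp only [root]
    rw [SimpleGraph.ConnectedComponent.sound h]
  refine ⟨fun v => G.dist (root v) v, ⟨fun u v huv => ?_, fun v hv => ?_, fun u v huv hu hv => ?_⟩⟩
  · rw [heq u v huv.reachable]
    have h1 := (show G.Reachable (root v) u from (hr v).trans huv.symm.reachable).dist_triangle_left v
    rw [SimpleGraph.dist_eq_one_iff_adj.2 huv] at h1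
    exact h1
  · obtain ⟨p, hp⟩ := (hr v).symm.exists_walk_length_eq_dist
    rw [SimpleGraph.dist_comm] at hp
    have key : ∀ r, ∀ p : G.Walk v r, p.length = G.dist r v → 0 < G.dist r v →
        ∃ x, G.Adj v x ∧ G.dist r x + 1 = G.dist r v := by
      intro r p hp hpos
      cases p with
      | nil => rw [← hp] at hpos; simp at hpos
      | @cons _ x _ hvx q =>
        refine ⟨x, hvx, ?_⟩
        have h1 : G.dist r x ≤ q.length := by
          rw [SimpleGraph.dist_comm]; exact SimpleGraph.dist_le q
        have h2 := (show G.Reachable r x from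
          (q.reachable.symm)).dist_triangle_left v
        rw [SimpleGraph.dist_eq_one_iff_adj.2 hvx.symm] at h2
        rw [SimpleGraph.Walk.length_cons] at hp
        omega
    obtain ⟨x, hvx, hx⟩ := key _ p hp hv
    exact ⟨x, hvx, by rw [heq x v hvx.symm.reachable]; exact hx⟩
  · rw [← (hr u).dist_eq_zero_iff.1 hu, ← (hr v).dist_eq_zero_iff.1 hv, heq u v huv]

/-- `u` is reached from `v` by a walk along which the level drops in every step. -/
def Desc (G : SimpleGraph V) (lam : V → ℕ) : V → V → Prop :=
  Relation.ReflTransGen fun a b => G.Adj a b ∧ lam b + 1 = lam a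

variable {lam : V → ℕ}

namespace Desc

theorem refl (v : V) : Desc G lam v v := Relation.ReflTransGen.refl

theorem trans {u v x : V} (h : Desc G lam u v) (h' : Desc G lam v x) : Desc G lam u x :=
  Relation.ReflTransGen.trans h h'

theorem le {u v : V} (h : Desc G lam v u) : lam u ≤ lam v := by
  induction h with
  | refl => exact le_rfl
  | tail _ h ih => omega

theorem exists_path {u v : V} (h : Desc G lam v u) : ∃ p : G.Walk v u, p.IsPath ∧
    p.length = lam v - lam u ∧ ∀ x ∈ p.support, Desc G lam v x ∧ Desc G lam x u := by
  induction h using Relation.ReflTransGen.head_induction_on with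
  | refl => exact ⟨.nil, by simp, by simp, by simp [Desc.refl]⟩
  | @head a b hab hbu ih =>
    obtain ⟨p, hp, hl, hs⟩ := ih
    refine ⟨.cons hab.1 p, ?_, ?_, ?_⟩
    · rw [SimpleGraph.Walk.cons_isPath_iff]
      refine ⟨hp, fun ha => ?_⟩
      have := (hs a ha).1.le
      omega
    · have : lam u ≤ lam b := Desc.le hbu
      rw [SimpleGraph.Walk.length_cons, hl]
      omega
    · intro x hx
      rw [SimpleGraph.Walk.support_cons, List.mem_cons] at hx
      rcases hx with rfl | hx
      · exact ⟨refl _, Relation.ReflTransGen.head hab hbu⟩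
      · exact ⟨Relation.ReflTransGen.head hab (hs x hx).1, (hs x hx).2⟩

theorem within {u v : V} (h : Desc G lam v u) : Within G (lam v - lam u) v u := by
  obtain ⟨p, _, hp, _⟩ := h.exists_path
  exact ⟨p, hp.le⟩

theorem joinedIn {S : Set V} {u v : V} (h : Desc G lam v u)
    (hS : ∀ x, Desc G lam v x → Desc G lam x u → x ∈ S) : JoinedIn G S v u := by
  obtain ⟨p, _, _, hp⟩ := h.exists_path
  exact ⟨p, fun x hx => hS x (hp x hx).1 (hp x hx).2⟩

theorem eq_of_le {u v : V} (h : Desc G lam v u) (hle : lam v ≤ lam u) : v = u := by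
  have := h.within
  rw [Nat.sub_eq_zero_of_le hle] at this
  exact this.eq_of_zero

theorem isConn {u v : V} (h : Desc G lam v u) :
    IsConn G {x | Desc G lam v x ∧ Desc G lam x u} :=
  IsConn.of_center v ⟨refl v, h⟩ fun _ hx =>
    hx.1.joinedIn fun _ hy hy' => ⟨hy, hy'.trans hx.2⟩

end Desc

namespace IsLevel

theorem exists_desc (hL : IsLevel G lam) {v : V} {m : ℕ} (hm : m ≤ lam v) :
    ∃ u, lam u = m ∧ Desc G lam v u := by
  obtain ⟨d, hd⟩ := Nat.exists_eq_add_of_le hm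
  induction d generalizing v with
  | zero => exact ⟨v, by omega, Desc.refl v⟩
  | succ d ih =>
    obtain ⟨x, hvx, hx⟩ := hL.pred v (by omega)
    obtain ⟨u, hu, hxu⟩ := ih (v := x) (by omega) (by omega)
    exact ⟨u, hu, Relation.ReflTransGen.head ⟨hvx, hx⟩ hxu⟩

theorem le_of_within (hL : IsLevel G lam) {n : ℕ} {u v : V} (h : Within G n u v) :
    lam v ≤ lam u + n := by
  induction n generalizing v with
  | zero => rw [h.eq_of_zero]; omega
  | succ n ih =>
    rcases h.succ_cases with h | ⟨x, hx, hxv⟩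
    · have := ih h; omega
    · have := ih hx; have := hL.adj x v hxv; omega

/-- Both vertices descend to the common root of their component, and the level only drops on the
way. -/
theorem joinedIn_le (hL : IsLevel G lam) {u v : V} (h : G.Reachable u v) {m : ℕ}
    (hu : lam u ≤ m) (hv : lam v ≤ m) : JoinedIn G {x | lam x ≤ m} u v := by
  obtain ⟨a, ha, hua⟩ := hL.exists_desc (v := u) (Nat.zero_le _)
  obtain ⟨b, hb, hvb⟩ := hL.exists_desc (v := v) (Nat.zero_le _)
  have hab : a = b := hL.root a b
    ((hua.within.reachable.symm.trans h).trans hvb.within.reachable) ha hb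
  subst hab
  exact (hua.joinedIn fun x hx _ => show lam x ≤ m from hx.le.trans hu).trans
    (hvb.joinedIn fun x hx _ => show lam x ≤ m from hx.le.trans hv).symm

end IsLevel

/-- A connected set at levels at least `m`, with `t` pairwise distant vertices at level `m`, is
one of the hubs of a fat model of `K_{2,t}`; the other hub lies below. -/
theorem isFatMinor_of_gates (hL : IsLevel G lam) {K t m : ℕ} (hK : 1 ≤ K) (hm : 3 * K ≤ m)
    {B : Set V} (hB : IsConn G B) (hBm : ∀ b ∈ B, m ≤ lam b) (x : Fin t → V)
    (hxB : ∀ k, x k ∈ B) (hxm : ∀ k, lam (x k) = m)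
    (far : ∀ k l, k ≠ l → ¬ Within G (7 * K - 1) (x k) (x l)) : IsFatMinor K (K2 t) G := by
  obtain ⟨⟨b₀, hb₀⟩, hBc⟩ := hB
  have h1 : ∀ k, ∃ y₁, lam y₁ = m - K ∧ Desc G lam (x k) y₁ :=
    fun k => hL.exists_desc (by rw [hxm k]; omega)
  choose y₁ hy₁ hxy₁ using h1
  have h2 : ∀ k, ∃ y₂, lam y₂ = m - 2 * K ∧ Desc G lam (y₁ k) y₂ :=
    fun k => hL.exists_desc (by rw [hy₁ k]; omega)
  choose y₂ hy₂ hy₁₂ using h2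
  have h3 : ∀ k, ∃ y₃, lam y₃ = m - 3 * K ∧ Desc G lam (y₂ k) y₃ :=
    fun k => hL.exists_desc (by rw [hy₂ k]; omega)
  choose y₃ hy₃ hy₂₃ using h3
  obtain ⟨r, hr, hbr⟩ := hL.exists_desc (v := b₀) (Nat.zero_le _)
  -- The arm below the gate `x k` is the piece of its descent between levels m - K and m - 2K, hence
  -- at distance K from either hub. Its points lie within 2K of the gate, so gates further apart
  -- than 7K - 1 = 2K + (3K - 1) + 2K have distant arms.
  let H : Fin 2 → Set V := ![{v | G.Reachable b₀ v ∧ lam v ≤ m - 3 * K}, B]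
  have hlow : ∀ k, ∀ z ∈ {z | Desc G lam (y₁ k) z ∧ Desc G lam z (y₂ k)},
      lam z ≤ m - K ∧ m - 2 * K ≤ lam z ∧ Within G (2 * K) (x k) z := by
    rintro k z ⟨hz1, hz2⟩
    have e1 := hz1.le
    have e2 := hz2.le
    rw [hy₁] at e1
    rw [hy₂] at e2
    refine ⟨e1, e2, ((hxy₁ k).trans hz1).within.mono ?_⟩
    rw [hxm]; omega
  refine isFatMinor_of_arms hK H (fun k => {z | Desc G lam (y₁ k) z ∧ Desc G lam z (y₂ k)})
    ?_ (fun k => (hy₁₂ k).isConn) ?_ ?_ ?_ ?_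
  · rw [Fin.forall_fin_two]
    refine ⟨IsConn.of_center r ⟨hbr.within.reachable, by rw [hr]; omega⟩ ?_, ⟨⟨b₀, hb₀⟩, hBc⟩⟩
    rintro u ⟨hu1, hu2⟩
    have hru : G.Reachable r u := hbr.within.reachable.symm.trans hu1
    refine ((hL.joinedIn_le hru (m := m - 3 * K) (by rw [hr]; omega) hu2).inter
      (T := {v | G.Reachable b₀ v}) hbr.within.reachable ?_).mono fun v hv => ⟨hv.2, hv.1⟩
    intro a b _ ha hab _
    exact SimpleGraph.Reachable.trans ha hab.reachable
  · have key : ∀ u ∈ H 0, ∀ v ∈ H 1, ¬ Within G (3 * K - 1) u v := by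
      rintro u ⟨_, hu⟩ v hv h
      have := hL.le_of_within h
      have := hBm v hv
      omega
    intro i j hij u hu v hv h
    fin_cases i <;> fin_cases j
    · exact hij rfl
    · exact key u hu v hv h
    · exact key v hv u hu h.symm
    · exact hij rfl
  · intro k l hkl u hu v hv h
    exact far k l hkl ((((hlow k u hu).2.2.trans h).trans (hlow l v hv).2.2.symm).mono (by omega))
  · rw [Fin.forall_fin_two]
    constructor
    · rintro k u ⟨_, hu⟩ v hv h
      have := hL.le_of_within h
      have := (hlow k v hv).2.1
      omega
    · intro k u hu v hv h
      have := hL.le_of_within h.symm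
      have := (hlow k v hv).1
      have := hBm u hu
      omega
  · rw [Fin.forall_fin_two]
    constructor
    · intro k
      refine ⟨y₃ k, ⟨?_, (hy₃ k).le⟩, y₂ k, ⟨hy₁₂ k, Desc.refl _⟩, ?_⟩
      · exact (hBc b₀ hb₀ _ (hxB k)).reachable.trans
          (((hxy₁ k).trans (hy₁₂ k)).trans (hy₂₃ k)).within.reachable
      · refine (hy₂₃ k).within.symm.mono ?_
        rw [hy₂, hy₃]; omega
    · intro k
      refine ⟨x k, hxB k, y₁ k, ⟨Desc.refl _, hy₁₂ k⟩, (hxy₁ k).within.mono ?_⟩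
      rw [hxm, hy₁]; omega

/-- If a set does not contain `t` pairwise unrelated points, then fewer than `t` of its points
dominate it. -/
theorem exists_dominating {α : Type*} {t : ℕ} (R : α → α → Prop) (hsymm : ∀ a b, R a b → R b a)
    (hrefl : ∀ a, R a a) (S : Set α)
    (h : ¬ ∃ x : Fin t → α, (∀ k, x k ∈ S) ∧ ∀ k l, k ≠ l → ¬ R (x k) (x l)) :
    ∃ F : Finset α, F.card < t ∧ (∀ c ∈ F, c ∈ S) ∧ ∀ x ∈ S, ∃ c ∈ F, R c x := by
  classical
  by_contra hcon
  push Not at hcon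
  -- Greedy choice: fewer than t chosen points never dominate, so an unrelated point can be added.
  have key : ∀ n ≤ t, ∃ F : Finset α, F.card = n ∧ (∀ c ∈ F, c ∈ S) ∧
      ∀ a ∈ F, ∀ b ∈ F, a ≠ b → ¬ R a b := by
    intro n hn
    induction n with
    | zero => exact ⟨∅, by simp⟩
    | succ n ih =>
      obtain ⟨F, hF, hFS, hFR⟩ := ih (by omega)
      obtain ⟨x, hxS, hx⟩ := hcon F (by omega) hFS
      have hxF : x ∉ F := fun hxF => hx x hxF (hrefl x)
      refine ⟨insert x F, by rw [Finset.card_insert_of_notMem hxF, hF], ?_, ?_⟩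
      · simp only [Finset.mem_insert, forall_eq_or_imp]
        exact ⟨hxS, hFS⟩
      · intro a ha b hb hab
        rw [Finset.mem_insert] at ha hb
        rcases ha with rfl | ha <;> rcases hb with rfl | hb
        · exact absurd rfl hab
        · exact fun h => hx b hb (hsymm _ _ h)
        · exact hx a ha
        · exact hFR a ha b hb hab
  obtain ⟨F, hF, hFS, hFR⟩ := key t le_rfl
  let e := F.equivFinOfCardEq hF
  refine h ⟨fun k => e.symm k, fun k => hFS _ (e.symm k).2, fun k l hkl => ?_⟩
  exact hFR _ (e.symm k).2 _ (e.symm l).2 fun h => hkl (e.symm.injective (Subtype.ext h))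

/-- The component of `v` in the subgraph of the vertices of level at least `n`. -/
def node (G : SimpleGraph V) (lam : V → ℕ) (n : ℕ) (v : V) : Set V := comp G {x | n ≤ lam x} v

theorem mem_node_self {n : ℕ} {v : V} (h : n ≤ lam v) : v ∈ node G lam n v := mem_comp_self h

theorem le_of_mem_node {n : ℕ} {u v : V} (h : u ∈ node G lam n v) : n ≤ lam u :=
  (show JoinedIn G {x | n ≤ lam x} v u from h).right_mem

theorem le_of_mem_node_left {n : ℕ} {u v : V} (h : u ∈ node G lam n v) : n ≤ lam v :=
  (show JoinedIn G {x | n ≤ lam x} v u from h).left_mem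

theorem node_eq {n : ℕ} {u v : V} (h : u ∈ node G lam n v) : node G lam n u = node G lam n v :=
  (comp_eq_of_joinedIn h).symm

theorem node_subset {m n : ℕ} (h : m ≤ n) (v : V) : node G lam n v ⊆ node G lam m v :=
  fun _ hx => JoinedIn.mono hx fun _ hy => h.trans hy

theorem mem_node_of_adj {n : ℕ} {u v x : V} (hu : u ∈ node G lam n v) (h : G.Adj u x)
    (hx : n ≤ lam x) : x ∈ node G lam n v := JoinedIn.tail hu h hx

theorem mem_node_of_desc {n : ℕ} {u v x : V} (hu : u ∈ node G lam n v) (h : Desc G lam u x)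
    (hx : n ≤ lam x) : x ∈ node G lam n v :=
  JoinedIn.trans hu (h.joinedIn fun _ _ hy => hx.trans hy.le)

/-- Fewer than `t` balls cover the lowest `l` levels of a component. -/
theorem exists_cover (hL : IsLevel G lam) {K t n : ℕ} (hK : 1 ≤ K) (ht : 2 ≤ t)
    (hG : ¬ IsFatMinor K (K2 t) G) (hn : n = 0 ∨ 3 * K ≤ n) (v : V) :
    ∃ F : Finset V, F.card < t ∧
      ∀ l, ∀ x ∈ node G lam n v, lam x ≤ n + l → ∃ c ∈ F, Within G (7 * K + l) c x := by
  have key : ∃ F : Finset V, F.card < t ∧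
      ∀ x ∈ node G lam n v, lam x = n → ∃ c ∈ F, Within G (7 * K - 1) c x := by
    rcases hn with rfl | hn
    · obtain ⟨r, hr, hvr⟩ := hL.exists_desc (v := v) (Nat.zero_le _)
      refine ⟨{r}, by rw [Finset.card_singleton]; omega, fun x hx hx0 => ⟨r, by simp, ?_⟩⟩
      rw [hL.root r x (hvr.within.reachable.symm.trans (JoinedIn.reachable hx)) hr hx0]
      exact Within.refl _ _
    · have hno : ¬ ∃ x : Fin t → V, (∀ k, x k ∈ {x | x ∈ node G lam n v ∧ lam x = n}) ∧
          ∀ k l, k ≠ l → ¬ Within G (7 * K - 1) (x k) (x l) := by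
        rintro ⟨x, hx, hfar⟩
        exact hG (isFatMinor_of_gates hL hK hn (B := node G lam n v)
          ⟨⟨x ⟨0, by omega⟩, (hx _).1⟩, fun a ha b hb => comp_connected ha hb⟩
          (fun b hb => le_of_mem_node hb) x (fun k => (hx k).1) (fun k => (hx k).2) hfar)
      obtain ⟨F, hF, _, hFd⟩ := exists_dominating (fun a b => Within G (7 * K - 1) a b)
        (fun _ _ => Within.symm) (fun _ => Within.refl _ _) _ hno
      exact ⟨F, hF, fun x hx hxn => hFd x ⟨hx, hxn⟩⟩
  obtain ⟨F, hF, hFd⟩ := key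
  refine ⟨F, hF, fun l x hx hxl => ?_⟩
  obtain ⟨y, hy, hxy⟩ := hL.exists_desc (v := x) (le_of_mem_node hx)
  obtain ⟨c, hc, hcy⟩ := hFd y (mem_node_of_desc hx hxy hy.ge) hy
  refine ⟨c, hc, (hcy.trans hxy.within.symm).mono ?_⟩
  omega

end Levels

/-! ### Counting classes. -/

section Counting

variable {α β γ : Type*}

theorem ncard_image_lt {g : α → β} {S : Set α} {t : ℕ}
    (h : ∀ x : Fin t → α, (∀ k, x k ∈ S) → ¬ ∀ k l, k ≠ l → g (x k) ≠ g (x l)) :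
    (g '' S).Finite ∧ (g '' S).ncard < t := by
  obtain ⟨F, hF, -, hFd⟩ := exists_dominating (t := t) (fun a b => g a = g b)
    (fun _ _ => Eq.symm) (fun _ => rfl) S (fun ⟨x, hx, hxx⟩ => h x hx hxx)
  have hsub : g '' S ⊆ g '' (F : Set α) := by
    rintro _ ⟨x, hx, rfl⟩
    obtain ⟨c, hc, hcx⟩ := hFd x hx
    exact ⟨c, hc, hcx⟩
  have hfin : (g '' (F : Set α)).Finite := F.finite_toSet.image g
  refine ⟨hfin.subset hsub, (Set.ncard_le_ncard hsub hfin).trans_lt ?_⟩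
  refine (Set.ncard_image_le F.finite_toSet).trans_lt ?_
  rwa [Set.ncard_coe_finset]

/-- If the `f`-classes of `S` number at most `p`, and no `f`-class contains `t` points in
different `g`-classes, then the `g`-classes number at most `p * (t - 1)`. -/
theorem ncard_image_le_mul {f : α → γ} {g : α → β} {S : Set α} {p t : ℕ}
    (hf : (f '' S).Finite) (hp : (f '' S).ncard ≤ p)
    (h : ∀ x : Fin t → α, (∀ k, x k ∈ S) → (∀ k l, f (x k) = f (x l)) →
      ¬ ∀ k l, k ≠ l → g (x k) ≠ g (x l)) :
    (g '' S).Finite ∧ (g '' S).ncard ≤ p * (t - 1) := by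
  classical
  have hfib : ∀ c, (g '' (S ∩ f ⁻¹' {c})).Finite ∧ (g '' (S ∩ f ⁻¹' {c})).ncard ≤ t - 1 := by
    intro c
    have := ncard_image_lt (g := g) (S := S ∩ f ⁻¹' {c}) (t := t) fun x hx =>
      h x (fun k => (hx k).1) fun k l => (hx k).2.trans (hx l).2.symm
    exact ⟨this.1, Nat.le_sub_one_of_lt this.2⟩
  have hunion : g '' S = ⋃ c ∈ hf.toFinset, g '' (S ∩ f ⁻¹' {c}) := by
    ext y
    simp only [Set.mem_image, Set.mem_iUnion, Set.Finite.mem_toFinset]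
    constructor
    · rintro ⟨x, hx, rfl⟩
      exact ⟨f x, ⟨x, hx, rfl⟩, x, ⟨hx, rfl⟩, rfl⟩
    · rintro ⟨c, _, x, hx, rfl⟩
      exact ⟨x, hx.1, rfl⟩
  have hfin : (g '' S).Finite := by
    rw [hunion]
    exact Set.Finite.biUnion hf.toFinset.finite_toSet fun c _ => (hfib c).1
  refine ⟨hfin, ?_⟩
  have h1 : hfin.toFinset ⊆ hf.toFinset.biUnion fun c => (hfib c).1.toFinset := by
    intro y hy
    rw [Set.Finite.mem_toFinset, hunion] at hy
    simpa using hy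
  rw [Set.ncard_eq_toFinset_card _ hfin]
  refine (Finset.card_le_card h1).trans ((Finset.card_biUnion_le_card_mul _ _ (t - 1) ?_).trans ?_)
  · intro c _
    rw [← Set.ncard_eq_toFinset_card _ (hfib c).1]
    exact (hfib c).2
  · rw [← Set.ncard_eq_toFinset_card _ hf]
    exact Nat.mul_le_mul_right _ hp

/-- A coarser classification has at most as many classes; if it has as many, then it is not
strictly coarser. -/
theorem ncard_image_mono {f : α → β} {g : α → γ} {S : Set α} (hf : (f '' S).Finite)
    (h : ∀ x ∈ S, ∀ y ∈ S, f x = f y → g x = g y) :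
    (g '' S).ncard ≤ (f '' S).ncard ∧
      ((f '' S).ncard ≤ (g '' S).ncard → ∀ x ∈ S, ∀ y ∈ S, g x = g y → f x = f y) := by
  classical
  rcases S.eq_empty_or_nonempty with rfl | ⟨x₀, hx₀⟩
  · simp
  -- On S the map g factors through f via φ, and a surjection between finite sets of equal size is
  -- injective.
  let φ : β → γ := fun b => if hb : b ∈ f '' S then g hb.choose else g x₀
  have hφ : ∀ x ∈ S, φ (f x) = g x := by
    intro x hx
    have hb : f x ∈ f '' S := ⟨x, hx, rfl⟩
    simp only [φ, dif_pos hb]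
    exact h _ hb.choose_spec.1 _ hx hb.choose_spec.2
  have himg : g '' S = φ '' (f '' S) := by
    rw [Set.image_image]
    exact Set.image_congr fun x hx => (hφ x hx).symm
  refine ⟨himg ▸ Set.ncard_image_le hf, fun hle x hx y hy hxy => ?_⟩
  have hinj : Set.InjOn φ (f '' S) := by
    rw [← Set.ncard_image_iff hf, ← himg]
    exact le_antisymm (himg ▸ Set.ncard_image_le hf) hle
  exact hinj ⟨x, hx, rfl⟩ ⟨y, hy, rfl⟩ (by rw [hφ x hx, hφ y hy, hxy])

end Counting

/-! ### Chains of short steps. -/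

section Chains

variable {V : Type*} {G : SimpleGraph V}

theorem Within.split {a b : ℕ} {u v : V} (h : Within G (a + b) u v) :
    ∃ x, Within G a u x ∧ Within G b x v := by
  induction b generalizing v with
  | zero => exact ⟨v, h, Within.refl _ _⟩
  | succ b ih =>
    rcases Within.succ_cases (n := a + b) h with h | ⟨y, hy, hyv⟩
    · obtain ⟨x, hx, hxv⟩ := ih h
      exact ⟨x, hx, hxv.mono (by omega)⟩
    · obtain ⟨x, hx, hxy⟩ := ih hy
      exact ⟨x, hx, hxy.trans (Within.of_adj hyv)⟩

theorem isConn_ball (c : V) (r : ℕ) : IsConn G {x | Within G r c x} :=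
  IsConn.of_center c (Within.refl _ _) fun _ hu => Within.joinedIn hu fun _ hx _ => hx

/-- Finitely many points joined by a chain of short steps are close to each other. -/
theorem within_of_chain {F : Finset V} {m θ : ℕ} (hF : F.card ≤ m + 1) {c c' : V} (hc : c ∈ F)
    (h : Relation.ReflTransGen (fun a b => b ∈ F ∧ Within G θ a b) c c') :
    Within G (m * θ) c c' := by
  classical
  let Γ : SimpleGraph {x // x ∈ F} := SimpleGraph.fromRel fun a b => Within G θ a.1 b.1
  have hΓ : ∀ {a b}, Γ.Adj a b → Within G θ a.1 b.1 := by
    rintro a b hab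
    rw [SimpleGraph.fromRel_adj] at hab
    exact hab.2.elim id Within.symm
  have hreach : ∃ hc' : c' ∈ F, Γ.Reachable ⟨c, hc⟩ ⟨c', hc'⟩ := by
    induction h with
    | refl => exact ⟨hc, SimpleGraph.Reachable.refl _⟩
    | @tail a b _ hab ih =>
      obtain ⟨ha, hr⟩ := ih
      refine ⟨hab.1, ?_⟩
      by_cases hne : a = b
      · subst hne; exact hr
      · refine hr.trans (SimpleGraph.Adj.reachable ?_)
        rw [SimpleGraph.fromRel_adj]
        exact ⟨fun h => hne (congrArg Subtype.val h), Or.inl hab.2⟩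
  obtain ⟨hc', hr⟩ := hreach
  -- A chain without repetitions has at most `m` steps, however long the given one is.
  obtain ⟨p, hp⟩ := hr.exists_isPath
  have hlen : p.length ≤ m := by
    have := hp.length_lt
    rw [Fintype.card_coe] at this
    omega
  have hw : ∀ {a b} (q : Γ.Walk a b), Within G (q.length * θ) a.1 b.1 := by
    intro a b q
    induction q with
    | nil => exact Within.refl _ _
    | cons hab q ih =>
      refine ((hΓ hab).trans ih).mono ?_
      rw [SimpleGraph.Walk.length_cons]
      exact (by ring : θ + q.length * θ = (q.length + 1) * θ).le
  exact (hw p).mono (Nat.mul_le_mul_right _ hlen)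

/-- A chain of steps of length at most `δ` in a set covered by at most `m` balls of radius `r`
joins points at distance at most `m * (2 * r + δ)`. -/
theorem within_of_chain_of_cover {F : Finset V} {m r δ : ℕ} (hF : F.card ≤ m) {Ω : Set V}
    (hcov : ∀ x ∈ Ω, ∃ c ∈ F, Within G r c x) {x y : V} (hx : x ∈ Ω)
    (h : Relation.ReflTransGen (fun a b => b ∈ Ω ∧ Within G δ a b) x y) :
    Within G (m * (2 * r + δ)) x y := by
  obtain ⟨c, hc, hcx⟩ := hcov x hx
  have key : ∃ c', Relation.ReflTransGen (fun a b => b ∈ F ∧ Within G (2 * r + δ) a b) c c' ∧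
      Within G r c' y := by
    induction h with
    | refl => exact ⟨c, .refl, hcx⟩
    | tail _ hab ih =>
      obtain ⟨c', h1, h2⟩ := ih
      obtain ⟨c'', h3, h4⟩ := hcov _ hab.1
      exact ⟨c'', h1.tail ⟨h3, ((h2.trans hab.2).trans h4.symm).mono (by omega)⟩, h4⟩
  obtain ⟨c', h1, h2⟩ := key
  have hpos : 1 ≤ m := (Finset.card_pos.2 ⟨c, hc⟩).trans_le hF
  obtain ⟨m, rfl⟩ := Nat.exists_eq_add_of_le' hpos
  refine (((hcx.symm.trans (within_of_chain hF hc h1))).trans h2).mono ?_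
  calc r + m * (2 * r + δ) + r = m * (2 * r + δ) + 2 * r := by ring
    _ ≤ (m + 1) * (2 * r + δ) := by rw [Nat.add_mul]; omega

end Chains

/-! ### Few wide nodes above a node. -/

section Main

variable {V : Type*} {G : SimpleGraph V} {lam : V → ℕ}

/-- The radius of balls used to detect wide components. -/
def rad (K w : ℕ) : ℕ := 10 * K + w

/-- The diameter beyond which the bottom of a component counts as wide. -/
def thr (K t w : ℕ) : ℕ := 2 * rad K w + t * (2 * rad K w + 3 * K)

/-- In a wide connected set there is a connected piece between two distant centres of a cover
that keeps away from all centres. -/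
theorem exists_arm {K t r : ℕ} (hK : 1 ≤ K) {F : Finset V} (hF : F.card < t) {E : Set V}
    (hE : ∀ u ∈ E, ∀ v ∈ E, JoinedIn G E u v) {x y : V} (hx : x ∈ E) (hy : y ∈ E)
    (hcx : ∃ c ∈ F, Within G r c x) (hcy : ∃ c ∈ F, Within G r c y)
    (hxy : ¬ Within G (2 * r + t * (2 * r + 3 * K)) x y) :
    ∃ a ∈ F, ∃ b ∈ F, ¬ Within G (2 * r + 3 * K) a b ∧ ∃ P ⊆ E, IsConn G P ∧
      (∀ z ∈ P, ∀ c ∈ F, ¬ Within G (r + K - 1) c z) ∧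
      (∃ z ∈ P, Within G (r + K) a z) ∧ ∃ z ∈ P, Within G (r + K) b z := by
  obtain ⟨cx, hcxF, hcx⟩ := hcx
  obtain ⟨cy, hcyF, hcy⟩ := hcy
  -- Centres chained to `cx` by steps of length at most 2r + 3K. A chain without repetitions has at
  -- most t - 1 steps, so `cy` is not among them, as x and y are too far apart.
  let R : V → V → Prop := Relation.ReflTransGen fun a b => b ∈ F ∧ Within G (2 * r + 3 * K) a b
  have hRF : ∀ {c}, R cx c → c ∈ F := by
    intro c h
    rcases Relation.ReflTransGen.cases_tail h with rfl | ⟨_, _, h⟩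
    exacts [hcxF, h.1]
  have hncy : ¬ R cx cy := by
    intro h
    obtain ⟨m, rfl⟩ := Nat.exists_eq_add_of_le' (show 1 ≤ t by omega)
    have h1 := within_of_chain (m := m) (by omega) hcxF h
    refine hxy (((hcx.symm.trans h1).trans hcy).mono ?_)
    rw [Nat.add_mul]; omega
  let NA : Set V := {z | ∃ c ∈ F, R cx c ∧ Within G (r + K) c z}
  let NB : Set V := {z | ∃ c ∈ F, ¬ R cx c ∧ Within G (r + K) c z}
  have hdisj : ∀ z ∈ NA, z ∉ NB := by
    rintro z ⟨c, _, hc1, hc2⟩ ⟨c', hc', hc'1, hc'2⟩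
    exact hc'1 (hc1.tail ⟨hc', (hc2.trans hc'2.symm).mono (by omega)⟩)
  have hxA : x ∈ NA := ⟨cx, hcxF, .refl, hcx.mono (by omega)⟩
  have hyB : y ∈ NB := ⟨cy, hcyF, hncy, hcy.mono (by omega)⟩
  -- On a walk from x to y, b is the first vertex in `NB`; going back from b towards x, b' is the
  -- first vertex in `NA`. The stretch between them avoids both neighbourhoods except at its ends.
  obtain ⟨a, b, hxa, hab, hbE, hbB, -⟩ := (hE x hx y hy).exists_exit (T := NBᶜ) (hdisj x hxA)
    (by simpa using hyB)
  rw [Set.notMem_compl_iff] at hbB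
  have hbA : b ∉ NA := fun h => hdisj b h hbB
  have hbx : JoinedIn G ((E ∩ NBᶜ) ∪ {b}) b x :=
    (JoinedIn.of_adj hab.symm (Or.inr rfl) (Or.inl hxa.right_mem)).trans
      (hxa.symm.mono Set.subset_union_left)
  obtain ⟨a', b', hba', hab', hb'S, hb'A, -⟩ := hbx.exists_exit (T := NAᶜ) hbA (by simpa using hxA)
  rw [Set.notMem_compl_iff] at hb'A
  have ha'A : a' ∉ NA := hba'.right_mem.2
  have haB : a ∉ NB := hxa.right_mem.2
  let T : Set V := {z | z ∈ E ∧ (z = b' ∨ z = b ∨ z ∉ NA ∧ z ∉ NB)}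
  have hbT : b ∈ T := ⟨hbE, Or.inr (Or.inl rfl)⟩
  have hb'E : b' ∈ E := by
    rcases hb'S with h | h
    · exact h.1
    · rw [Set.mem_singleton_iff] at h; exact h ▸ hbE
  have hb'T : b' ∈ T := ⟨hb'E, Or.inl rfl⟩
  have hb'P : b' ∈ comp G T b := by
    refine JoinedIn.tail (hba'.mono ?_) hab' hb'T
    rintro z ⟨hz | hz, hzA⟩
    · exact ⟨hz.1, Or.inr (Or.inr ⟨hzA, hz.2⟩)⟩
    · rw [Set.mem_singleton_iff] at hz; exact hz ▸ hbT
  obtain ⟨ca, hca, hca1, hca2⟩ := id hb'A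
  obtain ⟨cb, hcb, hcb1, hcb2⟩ := id hbB
  refine ⟨ca, hca, cb, hcb, fun h => hcb1 (hca1.tail ⟨hcb, h⟩), comp G T b, ?_, IsConn.comp hbT,
    ?_, ⟨b', hb'P, hca2⟩, b, mem_comp_self hbT, hcb2⟩
  · intro z hz
    exact (show JoinedIn G T b z from hz).right_mem.1
  -- If an end b or b' were within r + K - 1 of a centre, then its neighbour a or a' would be within
  -- r + K of it, and so in a neighbourhood that it avoids.
  · intro z hz c hc hcz
    have hcz' : Within G (r + K) c z := hcz.mono (by omega)
    have hstep : ∀ z', G.Adj z z' → Within G (r + K) c z' := fun z' h =>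
      (hcz.trans (Within.of_adj h)).mono (by omega)
    rcases (show JoinedIn G T b z from hz).right_mem.2 with rfl | rfl | ⟨h1, h2⟩
    · by_cases hR : R cx c
      · exact ha'A ⟨c, hc, hR, hstep _ hab'.symm⟩
      · exact hdisj z hb'A ⟨c, hc, hR, hcz'⟩
    · by_cases hR : R cx c
      · exact hbA ⟨c, hc, hR, hcz'⟩
      · exact haB ⟨c, hc, hR, hstep _ hab.symm⟩
    · by_cases hR : R cx c
      · exact h1 ⟨c, hc, hR, hcz'⟩
      · exact h2 ⟨c, hc, hR, hcz'⟩

/-- The component above level `n` containing `v` has two bottom vertices at distance more than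
`Δ`. -/
def IsMain (G : SimpleGraph V) (lam : V → ℕ) (Δ n : ℕ) (v : V) : Prop :=
  ∃ x ∈ node G lam n v, ∃ y ∈ node G lam n v, lam x = n ∧ lam y = n ∧ ¬ Within G Δ x y

theorem isMain_congr {Δ n : ℕ} {u v : V} (h : u ∈ node G lam n v) :
    IsMain G lam Δ n u ↔ IsMain G lam Δ n v := by
  unfold IsMain
  rw [node_eq h]

theorem IsMain.le {Δ n : ℕ} {v : V} (h : IsMain G lam Δ n v) : n ≤ lam v := by
  obtain ⟨x, hx, _⟩ := h
  exact le_of_mem_node_left hx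

/-- A component has few wide components above it. -/
theorem ncard_main_le (hL : IsLevel G lam) {K t n w : ℕ} (hK : 1 ≤ K) (ht : 2 ≤ t)
    (hG : ¬ IsFatMinor K (K2 t) G) (hn : n = 0 ∨ 3 * K ≤ n) (v : V) :
    (node G lam (n + w) '' {x | x ∈ node G lam n v ∧ IsMain G lam (thr K t w) (n + w) x}).Finite ∧
    (node G lam (n + w) '' {x | x ∈ node G lam n v ∧
      IsMain G lam (thr K t w) (n + w) x}).ncard ≤ (t - 1) ^ 3 := by
  classical
  obtain ⟨F, hF, hcov⟩ := exists_cover hL hK ht hG hn v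
  -- The radius `rad` is 7K plus the height w + 3K to which the cover has to reach.
  have hcov' : ∀ x ∈ node G lam n v, lam x ≤ n + w + 3 * K → ∃ c ∈ F, Within G (rad K w) c x := by
    intro x hx hxl
    obtain ⟨c, hc, h⟩ := hcov (w + 3 * K) x hx (by omega)
    exact ⟨c, hc, h.mono (by rw [rad]; omega)⟩
  have harm : ∀ x, x ∈ node G lam n v ∧ IsMain G lam (thr K t w) (n + w) x →
      ∃ ab : V × V, ab.1 ∈ F ∧ ab.2 ∈ F ∧ ¬ Within G (2 * rad K w + 3 * K) ab.1 ab.2 ∧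
        ∃ P ⊆ node G lam (n + w) x, IsConn G P ∧
        (∀ z ∈ P, ∀ c ∈ F, ¬ Within G (rad K w + K - 1) c z) ∧
        (∃ z ∈ P, Within G (rad K w + K) ab.1 z) ∧ ∃ z ∈ P, Within G (rad K w + K) ab.2 z := by
    rintro x ⟨hx, y, hy, z, hz, hyn, hzn, hyz⟩
    have hsub : node G lam (n + w) x ⊆ node G lam n v := by
      rw [← node_eq hx]
      exact node_subset (Nat.le_add_right n w) x
    obtain ⟨a, ha, b, hb, h⟩ := exists_arm hK hF (E := node G lam (n + w) x)
      (fun _ hu _ hv => comp_connected hu hv) hy hz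
      (hcov' y (hsub hy) (by omega)) (hcov' z (hsub hz) (by omega)) hyz
    exact ⟨(a, b), ha, hb, h⟩
  choose! ab hab1 hab2 hab3 P hPE hPc hPfar hPa hPb using harm
  have hpair : (ab '' {x | x ∈ node G lam n v ∧ IsMain G lam (thr K t w) (n + w) x}) ⊆
      ((F ×ˢ F : Finset (V × V)) : Set (V × V)) := by
    rintro _ ⟨x, hx, rfl⟩
    simp [hab1 x hx, hab2 x hx]
  have hfin := (F ×ˢ F).finite_toSet.subset hpair
  have hcard : (ab '' {x | x ∈ node G lam n v ∧
      IsMain G lam (thr K t w) (n + w) x}).ncard ≤ (t - 1) ^ 2 := by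
    refine (Set.ncard_le_ncard hpair (F ×ˢ F).finite_toSet).trans ?_
    rw [Set.ncard_coe_finset, Finset.card_product, pow_two]
    exact Nat.mul_le_mul (by omega) (by omega)
  rw [pow_succ (t - 1) 2]
  -- Each wide node contains an arm between two distant centres. If t wide nodes used the same pair
  -- of centres, the balls around these two would be the hubs of a fat model.
  refine ncard_image_le_mul hfin hcard fun x hx hxab hne => hG ?_
  -- An arm avoids all balls of the cover, so it lies above level n + w + 3K. A walk of length at
  -- most 3K - 1 between two arms would then stay above n + w and join their nodes.
  have hPlev : ∀ k, ∀ z ∈ P (x k), n + w + 3 * K < lam z := by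
    intro k z hz
    by_contra hle
    have hzD : z ∈ node G lam n v := by
      rw [← node_eq (hx k).1]
      exact node_subset (Nat.le_add_right n w) (x k) (hPE _ (hx k) hz)
    obtain ⟨c, hc, hcz⟩ := hcov' z hzD (by omega)
    exact hPfar _ (hx k) z hz c hc (hcz.mono (by omega))
  obtain ⟨a, b, hab⟩ : ∃ a b, ∀ k, ab (x k) = (a, b) := by
    refine ⟨(ab (x ⟨0, by omega⟩)).1, (ab (x ⟨0, by omega⟩)).2, fun k => ?_⟩
    rw [hxab k ⟨0, by omega⟩]
  have k₀ : Fin t := ⟨0, by omega⟩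
  have haF : a ∈ F := by have := hab1 _ (hx k₀); rwa [hab] at this
  have hbF : b ∈ F := by have := hab2 _ (hx k₀); rwa [hab] at this
  have hfar : ¬ Within G (2 * rad K w + 3 * K) a b := by
    have := hab3 _ (hx k₀); rwa [hab] at this
  refine isFatMinor_of_arms hK ![{z | Within G (rad K w) a z}, {z | Within G (rad K w) b z}]
    (fun k => P (x k)) ?_ (fun k => hPc _ (hx k)) ?_ ?_ ?_ ?_
  · rw [Fin.forall_fin_two]
    exact ⟨isConn_ball a _, isConn_ball b _⟩
  · have key : ∀ u, Within G (rad K w) a u → ∀ v, Within G (rad K w) b v →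
        ¬ Within G (3 * K - 1) u v := fun u hu v hv h =>
      hfar (((hu.trans h).trans hv.symm).mono (by omega))
    intro i j hij u hu v hv h
    fin_cases i <;> fin_cases j
    · exact hij rfl
    · exact key u hu v hv h
    · exact key v hv u hu h.symm
    · exact hij rfl
  · intro k l hkl u hu v hv h
    have h1 : JoinedIn G {x | n + w ≤ lam x} u v := h.joinedIn fun z hz _ => by
      have := hL.le_of_within hz.symm
      have := hPlev k u hu
      show n + w ≤ lam z
      omega
    refine hne k l hkl ?_
    rw [← node_eq (hPE _ (hx k) hu), ← node_eq (hPE _ (hx l) hv)]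
    exact comp_eq_of_joinedIn h1
  · rw [Fin.forall_fin_two]
    exact ⟨fun k u hu v hv h => hPfar _ (hx k) v hv a haF ((Within.trans hu h).mono (by omega)),
      fun k u hu v hv h => hPfar _ (hx k) v hv b hbF ((Within.trans hu h).mono (by omega))⟩
  · rw [Fin.forall_fin_two]
    constructor
    · intro k
      obtain ⟨z, hz, h⟩ := hPa _ (hx k)
      rw [hab] at h
      obtain ⟨u, hu, huz⟩ := h.split
      exact ⟨u, hu, z, hz, huz⟩
    · intro k
      obtain ⟨z, hz, h⟩ := hPb _ (hx k)
      rw [hab] at h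
      obtain ⟨u, hu, huz⟩ := h.split
      exact ⟨u, hu, z, hz, huz⟩

end Main

/-! ### The upper and lower part of a window with respect to a level. -/

section Window

variable {V : Type*} (G : SimpleGraph V) (lam : V → ℕ) (Δ w n : ℕ) (D : Set V)

/-- The wide components above level `n + w` inside `D`. -/
def mains : Set V := {x | x ∈ D ∧ IsMain G lam Δ (n + w) x}

/-- `D` without its wide components above level `n + w`. -/
def body : Set V := {x | x ∈ D ∧ ¬ IsMain G lam Δ (n + w) x}

/-- The part of the body above level `a` that leads to wide components. -/
def upper (a : ℕ) : Set V :=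
  {x | ∃ y z, JoinedIn G (body G lam Δ w n D ∩ {u | a ≤ lam u}) x y ∧
    z ∈ mains G lam Δ w n D ∧ G.Adj y z}

/-- The rest of the body. -/
def lower (a : ℕ) : Set V := body G lam Δ w n D \ upper G lam Δ w n D a

/-- The vertices of the lower part with a neighbour in the upper part. -/
def bdry (a : ℕ) : Set V :=
  {y | y ∈ lower G lam Δ w n D a ∧ ∃ x ∈ upper G lam Δ w n D a, G.Adj y x}

variable {G lam Δ w n D}

theorem upper_subset {a : ℕ} : upper G lam Δ w n D a ⊆ body G lam Δ w n D ∩ {u | a ≤ lam u} :=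
  fun _ ⟨_, _, h, _⟩ => h.left_mem

theorem le_of_mem_upper {a : ℕ} {x : V} (h : x ∈ upper G lam Δ w n D a) : a ≤ lam x :=
  (upper_subset h).2

theorem upper_anti {a b : ℕ} (hab : a ≤ b) :
    upper G lam Δ w n D b ⊆ upper G lam Δ w n D a := by
  rintro x ⟨y, z, h, hz⟩
  exact ⟨y, z, h.mono fun u hu => ⟨hu.1, hab.trans hu.2⟩, hz⟩

theorem lower_mono {a b : ℕ} (hab : a ≤ b) :
    lower G lam Δ w n D a ⊆ lower G lam Δ w n D b :=
  fun _ hx => ⟨hx.1, fun h => hx.2 (upper_anti hab h)⟩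

theorem mem_upper_of_joinedIn {a : ℕ} {x y : V}
    (h : JoinedIn G (body G lam Δ w n D ∩ {u | a ≤ lam u}) x y)
    (hx : x ∈ upper G lam Δ w n D a) : y ∈ upper G lam Δ w n D a := by
  obtain ⟨y', z, h', hz⟩ := hx
  exact ⟨y', z, h.symm.trans h', hz⟩

theorem joinedIn_upper {a : ℕ} {x y : V}
    (h : JoinedIn G (body G lam Δ w n D ∩ {u | a ≤ lam u}) x y)
    (hx : x ∈ upper G lam Δ w n D a) : JoinedIn G (upper G lam Δ w n D a) x y :=
  (h.inter hx fun _ _ ha ha' hab hb =>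
    mem_upper_of_joinedIn (JoinedIn.of_adj hab ha hb) ha').mono Set.inter_subset_right

theorem mem_upper_of_adj {a : ℕ} {x y : V} (hx : x ∈ upper G lam Δ w n D a) (h : G.Adj x y)
    (hy : y ∈ body G lam Δ w n D) (hay : a ≤ lam y) : y ∈ upper G lam Δ w n D a :=
  mem_upper_of_joinedIn (JoinedIn.of_adj h (upper_subset hx) ⟨hy, hay⟩) hx

theorem mem_lower_of_lt {a : ℕ} {x : V} (hx : x ∈ body G lam Δ w n D) (h : lam x < a) :
    x ∈ lower G lam Δ w n D a := ⟨hx, fun h' => by have := le_of_mem_upper h'; omega⟩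

/-- An edge between the two parts of the body joins the two levels next to the cut. -/
theorem level_of_adj_upper (hL : IsLevel G lam) {a : ℕ} {x y : V}
    (hx : x ∈ upper G lam Δ w n D a) (hy : y ∈ lower G lam Δ w n D a) (h : G.Adj x y) :
    lam x = a ∧ lam y + 1 = a := by
  have h1 := le_of_mem_upper hx
  have h2 : lam y < a := by
    by_contra hcon
    exact hy.2 (mem_upper_of_adj hx h hy.1 (by omega))
  have := hL.adj y x h.symm
  omega

theorem level_of_adj_mains (hL : IsLevel G lam) {y z : V} (hy : y ∈ body G lam Δ w n D)
    (hz : z ∈ mains G lam Δ w n D) (h : G.Adj y z) : lam y + 1 = n + w ∧ lam z = n + w := by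
  have h1 := hz.2.le
  have h2 : lam y < n + w := by
    by_contra hcon
    exact hy.2 ((isMain_congr (mem_node_of_adj (mem_node_self h1) h.symm (by omega))).2 hz.2)
  have := hL.adj y z h
  omega

section Node

variable {v : V}

theorem mem_body_of_desc {x u : V} (hx : x ∈ body G lam Δ w n (node G lam n v))
    (h : Desc G lam x u) (hu : n ≤ lam u) : u ∈ body G lam Δ w n (node G lam n v) :=
  ⟨mem_node_of_desc hx.1 h hu, fun hm =>
    hx.2 ((isMain_congr (mem_node_of_desc (mem_node_self (hm.le.trans h.le)) h hm.le)).1 hm)⟩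

theorem mem_body_of_adj {x y : V} (hx : x ∈ body G lam Δ w n (node G lam n v))
    (h : G.Adj x y) (h1 : n ≤ lam y) (h2 : lam y < n + w) :
    y ∈ body G lam Δ w n (node G lam n v) :=
  ⟨mem_node_of_adj hx.1 h h1, fun hm => by have := hm.le; omega⟩

theorem joinedIn_body {x y : V} {S : Set V} (hx : x ∈ body G lam Δ w n (node G lam n v))
    (hS : ∀ z ∈ S, n ≤ lam z ∧ lam z < n + w) (h : JoinedIn G S x y) :
    JoinedIn G (S ∩ body G lam Δ w n (node G lam n v)) x y :=
  h.inter hx fun _ b _ ha hab hb => mem_body_of_adj ha hab (hS b hb).1 (hS b hb).2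

theorem joinedIn_body_of_desc {a : ℕ} {x u : V} (ha : n ≤ a)
    (hx : x ∈ body G lam Δ w n (node G lam n v)) (h : Desc G lam x u) (hu : a ≤ lam u) :
    JoinedIn G (body G lam Δ w n (node G lam n v) ∩ {u | a ≤ lam u}) x u :=
  h.joinedIn fun _ hz hz' => ⟨mem_body_of_desc hx hz (ha.trans (hu.trans hz'.le)), hu.trans hz'.le⟩

/-- Descending from the upper part to the last level below the cut. -/
theorem exists_desc_bdry (hL : IsLevel G lam) {a : ℕ} {x : V} (ha : n + 1 ≤ a)
    (hx : x ∈ upper G lam Δ w n (node G lam n v) a) :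
    ∃ y ∈ bdry G lam Δ w n (node G lam n v) a, Desc G lam x y ∧ lam y + 1 = a := by
  obtain ⟨u, hu, hxu⟩ := hL.exists_desc (le_of_mem_upper hx)
  obtain ⟨y, huy, hy⟩ := hL.pred u (by omega)
  have hxy : Desc G lam x y := Relation.ReflTransGen.tail hxu ⟨huy, hy⟩
  have huU : u ∈ upper G lam Δ w n (node G lam n v) a := mem_upper_of_joinedIn
    (joinedIn_body_of_desc (by omega) (upper_subset hx).1 hxu hu.ge) hx
  exact ⟨y, ⟨mem_lower_of_lt (mem_body_of_desc (upper_subset hx).1 hxy (by omega)) (by omega),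
    u, huU, huy.symm⟩, hxy, by omega⟩

/-- The track from x to a wide node enters it from level n + w - 1, which is at least b. -/
theorem exists_mem_upper (hL : IsLevel G lam) {a b : ℕ} {x : V} (hb : b < n + w)
    (hx : x ∈ upper G lam Δ w n (node G lam n v) a) :
    ∃ y ∈ upper G lam Δ w n (node G lam n v) b,
      JoinedIn G (upper G lam Δ w n (node G lam n v) a) x y := by
  obtain ⟨y, z, h, hz, hyz⟩ := id hx
  have hlev := level_of_adj_mains hL h.right_mem.1 hz hyz
  exact ⟨y, ⟨y, z, JoinedIn.refl ⟨h.right_mem.1, show b ≤ lam y by omega⟩, hz, hyz⟩,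
    joinedIn_upper h hx⟩

/-- Together with `exists_bdry_above` this shows that the boundaries at levels a ≤ b meet the same
components of the lower part for b. The descent from y to level a - 1 stays in that lower part
because its levels are below b. -/
theorem exists_bdry_below (hL : IsLevel G lam) {a b : ℕ} {y : V} (ha : n + 1 ≤ a) (hab : a ≤ b)
    (hy : y ∈ bdry G lam Δ w n (node G lam n v) b) :
    ∃ y' ∈ bdry G lam Δ w n (node G lam n v) a, Desc G lam y y' ∧
      JoinedIn G (lower G lam Δ w n (node G lam n v) b) y y' := by
  rcases hab.eq_or_lt with rfl | hab
  · exact ⟨y, hy, Desc.refl y, JoinedIn.refl hy.1⟩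
  obtain ⟨hyl, x, hx, hyx⟩ := hy
  have hlev := level_of_adj_upper hL hx hyl hyx.symm
  have hyU : y ∈ upper G lam Δ w n (node G lam n v) a :=
    mem_upper_of_adj (upper_anti hab.le hx) hyx.symm hyl.1 (by omega)
  obtain ⟨y', hy', hd, hl⟩ := exists_desc_bdry hL ha hyU
  exact ⟨y', hy', hd, hd.joinedIn fun z hz hz' =>
    mem_lower_of_lt (mem_body_of_desc hyl.1 hz (by have := hz'.le; omega))
      (by have := hz.le; omega)⟩

/-- A track from y reaches the upper part for b; its last vertex before it first leaves the lower
part for b is the required one. -/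
theorem exists_bdry_above (hL : IsLevel G lam) {a b : ℕ} {y : V} (hab : a ≤ b) (hb : b < n + w)
    (hy : y ∈ bdry G lam Δ w n (node G lam n v) a) :
    ∃ y' ∈ bdry G lam Δ w n (node G lam n v) b,
      JoinedIn G (lower G lam Δ w n (node G lam n v) b) y y' := by
  obtain ⟨hyl, x, hx, hyx⟩ := hy
  obtain ⟨x', hx', hxx'⟩ := exists_mem_upper hL hb hx
  have hyx' : JoinedIn G (body G lam Δ w n (node G lam n v)) y x' :=
    (JoinedIn.of_adj hyx hyl.1 (upper_subset hx).1).trans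
      (hxx'.mono fun _ hz => (upper_subset hz).1)
  obtain ⟨p, q, hyp, hpq, hqb, hql, -⟩ := hyx'.exists_exit (T := lower G lam Δ w n (node G lam n v) b)
    (lower_mono hab hyl) (fun h => h.2 hx')
  refine ⟨p, ⟨hyp.right_mem.2, q, ?_, hpq⟩, hyp.mono Set.inter_subset_right⟩
  by_contra hq
  exact hql ⟨hqb, hq⟩

end Node

end Window

/-! ### Good cuts. -/

/-- The standing assumptions of the construction. -/
structure Ctx {V : Type*} (G : SimpleGraph V) (lam : V → ℕ) (K t w : ℕ) : Prop where
  level : IsLevel G lam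
  one_le : 1 ≤ K
  two_le : 2 ≤ t
  width : 28 * K + 3 * K * (t ^ 5 + 1) ≤ w
  not_fat : ¬ IsFatMinor K (K2 t) G

section Cuts

variable {V : Type*} {G : SimpleGraph V} {lam : V → ℕ} {K t w n : ℕ}

/-- Each track leads to one of at most (t-1)^3 wide nodes. If t components of the upper part led to
the same wide node, then descents from it into these components down to level n + w - 7K would end
in gates: a walk of length at most 7K - 1 between two of the ends stays at levels from a to n + w -
1 and would join the components. The margin 14K is two such lengths. -/
theorem ncard_upper_le (hC : Ctx G lam K t w) (hn : n = 0 ∨ 3 * K ≤ n) (v : V) {a : ℕ}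
    (hna : n ≤ a) (ha : a + 14 * K ≤ n + w) :
    (comp G (upper G lam (thr K t w) w n (node G lam n v) a) ''
      upper G lam (thr K t w) w n (node G lam n v) a).Finite ∧
    (comp G (upper G lam (thr K t w) w n (node G lam n v) a) ''
      upper G lam (thr K t w) w n (node G lam n v) a).ncard ≤ (t - 1) ^ 4 := by
  obtain ⟨hL, hK, ht, hw, hG⟩ := hC
  set U := upper G lam (thr K t w) w n (node G lam n v) a with hU
  have hch : ∀ x ∈ U, ∃ z, z ∈ mains G lam (thr K t w) w n (node G lam n v) ∧
      ∃ y, JoinedIn G (body G lam (thr K t w) w n (node G lam n v) ∩ {u | a ≤ lam u}) x y ∧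
        G.Adj y z := by
    rintro x ⟨y, z, h, hz, hyz⟩
    exact ⟨z, hz, y, h, hyz⟩
  choose! z hz y hxy hyz using hch
  obtain ⟨hfin, hcard⟩ := ncard_main_le (w := w) hL hK ht hG hn v
  have hsub : (fun x => node G lam (n + w) (z x)) '' U ⊆ node G lam (n + w) ''
      {x | x ∈ node G lam n v ∧ IsMain G lam (thr K t w) (n + w) x} := by
    rintro _ ⟨x, hx, rfl⟩
    exact ⟨z x, hz x hx, rfl⟩
  rw [pow_succ (t - 1) 3]
  refine ncard_image_le_mul (hfin.subset hsub) ((Set.ncard_le_ncard hsub hfin).trans hcard)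
    fun x hx hsame hne => hG ?_
  have hzlev : ∀ k, lam (y (x k)) + 1 = n + w ∧ lam (z (x k)) = n + w := fun k =>
    level_of_adj_mains hL (hxy _ (hx k)).right_mem.1 (hz _ (hx k)) (hyz _ (hx k))
  have hp : ∀ k, ∃ p, lam p = n + w - 7 * K ∧ Desc G lam (y (x k)) p := fun k =>
    hL.exists_desc (by have := hzlev k; omega)
  choose p hpl hpd using hp
  have k₀ : Fin t := ⟨0, by omega⟩
  have hyb : ∀ k, JoinedIn G (body G lam (thr K t w) w n (node G lam n v) ∩ {u | a ≤ lam u})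
      (x k) (p k) := fun k => (hxy _ (hx k)).trans
    (joinedIn_body_of_desc hna (hxy _ (hx k)).right_mem.1 (hpd k) (by rw [hpl]; omega))
  have hzB : ∀ k, z (x k) ∈ node G lam (n + w - 7 * K) (z (x k₀)) := by
    intro k
    have h1 : z (x k) ∈ node G lam (n + w) (z (x k)) := mem_node_self (hzlev k).2.ge
    rw [show node G lam (n + w) (z (x k)) = node G lam (n + w) (z (x k₀)) from hsame k k₀] at h1
    exact node_subset (Nat.sub_le _ _) _ h1
  refine isFatMinor_of_gates hL hK (m := n + w - 7 * K) (by omega)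
    (B := node G lam (n + w - 7 * K) (z (x k₀)))
    (IsConn.comp (show n + w - 7 * K ≤ lam _ by have := hzlev k₀; omega))
    (fun b hb => le_of_mem_node hb) p (fun k => ?_) hpl fun k l hkl h => ?_
  · refine mem_node_of_desc (hzB k) ?_ (hpl k).ge
    exact Relation.ReflTransGen.head ⟨(hyz _ (hx k)).symm, by have := hzlev k; omega⟩ (hpd k)
  · have h1 : JoinedIn G {u | a ≤ lam u ∧ lam u < n + w} (p k) (p l) := h.joinedIn fun u hu _ => by
      have e1 := hL.le_of_within hu
      have e2 := hL.le_of_within hu.symm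
      rw [hpl] at e1 e2
      show a ≤ lam u ∧ lam u < n + w
      omega
    have h2 := joinedIn_body (hyb k).right_mem.1 (fun u hu => ⟨hna.trans hu.1, hu.2⟩) h1
    have h3 : JoinedIn G (body G lam (thr K t w) w n (node G lam n v) ∩ {u | a ≤ lam u})
        (x k) (x l) :=
      ((hyb k).trans (h2.mono fun u hu => ⟨hu.2, hu.1.1⟩)).trans (hyb l).symm
    exact hne k l hkl (comp_eq_of_joinedIn (joinedIn_upper h3 (hx k)))

/-- The same argument one stage lower: every boundary vertex has a neighbour in one of at most
(t-1)^4 components of the upper part. If t components of the lower part hung below the same one,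
their descents to level a - 7K would end in gates, since short walks between the ends stay below a
and not below n. -/
theorem ncard_bdry_le (hC : Ctx G lam K t w) (hn : n = 0 ∨ 3 * K ≤ n) (v : V) {a : ℕ}
    (hna : n + 14 * K ≤ a) (ha : a + 14 * K ≤ n + w) :
    (comp G (lower G lam (thr K t w) w n (node G lam n v) a) ''
      bdry G lam (thr K t w) w n (node G lam n v) a).Finite ∧
    (comp G (lower G lam (thr K t w) w n (node G lam n v) a) ''
      bdry G lam (thr K t w) w n (node G lam n v) a).ncard ≤ (t - 1) ^ 5 := by
  obtain ⟨hfin, hcard⟩ := ncard_upper_le hC hn v (a := a) (by omega) ha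
  obtain ⟨hL, hK, ht, hw, hG⟩ := hC
  set U := upper G lam (thr K t w) w n (node G lam n v) a with hU
  have hch : ∀ y ∈ bdry G lam (thr K t w) w n (node G lam n v) a, ∃ x ∈ U, G.Adj y x :=
    fun y hy => hy.2
  choose! x hxU hyx using hch
  have hsub : (fun y => comp G U (x y)) '' bdry G lam (thr K t w) w n (node G lam n v) a ⊆
      comp G U '' U := by
    rintro _ ⟨y, hy, rfl⟩
    exact ⟨x y, hxU y hy, rfl⟩
  rw [pow_succ (t - 1) 4]
  refine ncard_image_le_mul (hfin.subset hsub) ((Set.ncard_le_ncard hsub hfin).trans hcard)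
    fun y hy hsame hne => hG ?_
  have hlev : ∀ k, lam (x (y k)) = a ∧ lam (y k) + 1 = a := fun k =>
    level_of_adj_upper hL (hxU _ (hy k)) (hy k).1 (hyx _ (hy k)).symm
  have hp : ∀ k, ∃ p, lam p = a - 7 * K ∧ Desc G lam (y k) p := fun k =>
    hL.exists_desc (by have := hlev k; omega)
  choose p hpl hpd using hp
  have k₀ : Fin t := ⟨0, by omega⟩
  have hxB : ∀ k, x (y k) ∈ node G lam (a - 7 * K) (x (y k₀)) := by
    intro k
    refine (joinedIn_of_comp_eq (hxU _ (hy k)) (hsame k₀ k)).mono fun u hu => ?_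
    have := le_of_mem_upper hu
    show a - 7 * K ≤ lam u
    omega
  have hpb : ∀ k, p k ∈ body G lam (thr K t w) w n (node G lam n v) := fun k =>
    mem_body_of_desc (hy k).1.1 (hpd k) (by rw [hpl]; omega)
  have hyp : ∀ k, JoinedIn G (lower G lam (thr K t w) w n (node G lam n v) a) (y k) (p k) :=
    fun k => (hpd k).joinedIn fun u hu hu' => mem_lower_of_lt
      (mem_body_of_desc (hy k).1.1 hu (by have := hu'.le; rw [hpl] at this; omega))
      (by have := hu.le; have := hlev k; omega)
  refine isFatMinor_of_gates hL hK (m := a - 7 * K) (by omega)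
    (B := node G lam (a - 7 * K) (x (y k₀)))
    (IsConn.comp (show a - 7 * K ≤ lam _ by have := hlev k₀; omega))
    (fun b hb => le_of_mem_node hb) p (fun k => ?_) hpl fun k l hkl h => ?_
  · refine mem_node_of_desc (hxB k) ?_ (hpl k).ge
    exact Relation.ReflTransGen.head ⟨(hyx _ (hy k)).symm, by have := hlev k; omega⟩ (hpd k)
  · have h1 : JoinedIn G {u | n ≤ lam u ∧ lam u < a} (p k) (p l) := h.joinedIn fun u hu _ => by
      have e1 := hL.le_of_within hu
      have e2 := hL.le_of_within hu.symm
      rw [hpl] at e1 e2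
      show n ≤ lam u ∧ lam u < a
      omega
    have h2 := joinedIn_body (hpb k) (fun u hu => ⟨hu.1, by have := hu.2; omega⟩) h1
    have h3 : JoinedIn G (lower G lam (thr K t w) w n (node G lam n v) a) (y k) (y l) :=
      ((hyp k).trans (h2.mono fun u hu => mem_lower_of_lt hu.2 hu.1.2)).trans (hyp l).symm
    exact hne k l hkl (comp_eq_of_joinedIn h3)

/-- Around the level `a` the tracks leading from the bottom of `D` to the wide components above
it neither split nor merge. -/
structure GoodCut (G : SimpleGraph V) (lam : V → ℕ) (K Δ w n : ℕ) (D : Set V) (a : ℕ) :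
    Prop where
  lo : n + 14 * K ≤ a
  hi : a + 17 * K ≤ n + w
  not_split : ∀ x ∈ upper G lam Δ w n D (a + 3 * K), ∀ y ∈ upper G lam Δ w n D (a + 3 * K),
    JoinedIn G (upper G lam Δ w n D a) x y → JoinedIn G (upper G lam Δ w n D (a + 3 * K)) x y
  not_merge : ∀ x ∈ bdry G lam Δ w n D a, ∀ y ∈ bdry G lam Δ w n D a,
    JoinedIn G (lower G lam Δ w n D (a + 3 * K)) x y → JoinedIn G (lower G lam Δ w n D a) x y

/-- With rising level, the number of upper components can only grow and the number of lower
components at the boundary can only drop. A step that leaves both numbers unchanged neither splits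
nor merges tracks. Every other step uses up one of the at most (t-1)^4 + (t-1)^5 ≤ t^5 possible
changes, so one of t^5 + 1 steps is good. -/
theorem exists_goodCut (hC : Ctx G lam K t w) (hn : n = 0 ∨ 3 * K ≤ n) (v : V) :
    ∃ a, GoodCut G lam K (thr K t w) w n (node G lam n v) a := by
  have hL := hC.level
  have hK := hC.one_le
  have hw := hC.width
  have ht := hC.two_le
  set U := upper G lam (thr K t w) w n (node G lam n v)
  set B := bdry G lam (thr K t w) w n (node G lam n v)
  set L := lower G lam (thr K t w) w n (node G lam n v)
  -- The candidates are 3K apart; the assumed width leaves the margin 14K that the counting lemmas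
  -- need at both ends of the window.
  let a : ℕ → ℕ := fun i => n + 14 * K + 3 * K * i
  have ha1 : ∀ i, a (i + 1) = a i + 3 * K := fun i => by simp only [a]; ring
  have ha0 : ∀ i, n + 14 * K ≤ a i := fun i => Nat.le_add_right _ _
  have ha2 : ∀ i ≤ t ^ 5 + 1, a i + 14 * K ≤ n + w := by
    intro i hi
    have : 3 * K * i ≤ 3 * K * (t ^ 5 + 1) := Nat.mul_le_mul_left _ hi
    simp only [a]
    omega
  have hUfin : ∀ i ≤ t ^ 5 + 1, (comp G (U (a i)) '' U (a i)).Finite ∧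
      (comp G (U (a i)) '' U (a i)).ncard ≤ (t - 1) ^ 4 := fun i hi =>
    ncard_upper_le hC hn v (by have := ha0 i; omega) (ha2 i hi)
  have hBfin : ∀ i ≤ t ^ 5 + 1, (comp G (L (a i)) '' B (a i)).Finite ∧
      (comp G (L (a i)) '' B (a i)).ncard ≤ (t - 1) ^ 5 := fun i hi =>
    ncard_bdry_le hC hn v (ha0 i) (ha2 i hi)
  have hUimg : ∀ i < t ^ 5 + 1, comp G (U (a i)) '' U (a i) = comp G (U (a i)) '' U (a (i + 1)) := by
    intro i hi
    apply Set.Subset.antisymm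
    · rintro _ ⟨x, hx, rfl⟩
      obtain ⟨y, hy, hxy⟩ := exists_mem_upper hL
        (b := a (i + 1)) (by have := ha2 (i + 1) hi; omega) hx
      exact ⟨y, hy, (comp_eq_of_joinedIn hxy).symm⟩
    · exact Set.image_mono (upper_anti (by rw [ha1]; omega))
  have hBimg : ∀ i < t ^ 5 + 1,
      comp G (L (a (i + 1))) '' B (a (i + 1)) = comp G (L (a (i + 1))) '' B (a i) := by
    intro i hi
    apply Set.Subset.antisymm
    · rintro _ ⟨x, hx, rfl⟩
      obtain ⟨y, hy, -, hxy⟩ := exists_bdry_below hL (a := a i)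
        (by have := ha0 i; omega) (by rw [ha1]; omega) hx
      exact ⟨y, hy, (comp_eq_of_joinedIn hxy).symm⟩
    · rintro _ ⟨x, hx, rfl⟩
      obtain ⟨y, hy, hxy⟩ := exists_bdry_above hL (b := a (i + 1)) (by rw [ha1]; omega)
        (by have := ha2 (i + 1) hi; omega) hx
      exact ⟨y, hy, (comp_eq_of_joinedIn hxy).symm⟩
  have hUmono : ∀ i < t ^ 5 + 1, _ := fun i hi => ncard_image_mono
    (f := comp G (U (a (i + 1)))) (g := comp G (U (a i))) (S := U (a (i + 1)))
    (hUfin (i + 1) hi).1 fun x _ y hy hxy => comp_eq_of_joinedIn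
      ((joinedIn_of_comp_eq hy hxy).mono (upper_anti (by rw [ha1]; omega)))
  have hBmono : ∀ i < t ^ 5 + 1, _ := fun i hi => ncard_image_mono
    (f := comp G (L (a i))) (g := comp G (L (a (i + 1)))) (S := B (a i))
    (hBfin i hi.le).1 fun x _ y hy hxy => comp_eq_of_joinedIn
      ((joinedIn_of_comp_eq hy.1 hxy).mono (lower_mono (by rw [ha1]; omega)))
  by_cases hex : ∃ i < t ^ 5 + 1,
      (comp G (U (a (i + 1))) '' U (a (i + 1))).ncard ≤ (comp G (U (a i)) '' U (a i)).ncard ∧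
      (comp G (L (a i)) '' B (a i)).ncard ≤ (comp G (L (a (i + 1))) '' B (a (i + 1))).ncard
  · obtain ⟨i, hi, hUi, hBi⟩ := hex
    rw [hUimg i hi] at hUi
    rw [hBimg i hi] at hBi
    refine ⟨a i, ha0 i, by have := ha2 (i + 1) hi; rw [ha1] at this; omega, ?_, ?_⟩
    · rw [← ha1]
      exact fun x hx y hy hxy => joinedIn_of_comp_eq hy
        ((hUmono i hi).2 hUi x hx y hy (comp_eq_of_joinedIn hxy))
    · rw [← ha1]
      exact fun x hx y hy hxy => joinedIn_of_comp_eq hy.1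
        ((hBmono i hi).2 hBi x hx y hy (comp_eq_of_joinedIn hxy))
  · exfalso
    push Not at hex
    have hgrow : ∀ i ≤ t ^ 5 + 1, (comp G (U (a 0)) '' U (a 0)).ncard +
        (comp G (L (a i)) '' B (a i)).ncard + i ≤
        (comp G (U (a i)) '' U (a i)).ncard + (comp G (L (a 0)) '' B (a 0)).ncard := by
      intro i hi
      induction i with
      | zero => omega
      | succ i ih =>
        have h1 := ih (by omega)
        have h2 := (hUmono i hi).1
        have h3 := (hBmono i hi).1
        rw [← hUimg i hi] at h2
        rw [← hBimg i hi] at h3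
        have h4 := hex i hi
        by_cases h5 : (comp G (U (a (i + 1))) '' U (a (i + 1))).ncard ≤
            (comp G (U (a i)) '' U (a i)).ncard
        · have := h4 h5; omega
        · omega
    have h1 := hgrow (t ^ 5 + 1) le_rfl
    have h2 := (hUfin (t ^ 5 + 1) le_rfl).2
    have h3 := (hBfin 0 (Nat.zero_le _)).2
    have h4 : (t - 1) ^ 4 + (t - 1) ^ 5 ≤ t ^ 5 := by
      calc (t - 1) ^ 4 + (t - 1) ^ 5 = (t - 1) ^ 4 * (t - 1 + 1) := by ring
        _ = (t - 1) ^ 4 * t := by rw [Nat.sub_add_cancel (by omega)]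
        _ ≤ t ^ 4 * t := Nat.mul_le_mul_right _ (Nat.pow_le_pow_left (Nat.sub_le _ _) _)
        _ = t ^ 5 := by ring
    omega

namespace GoodCut

variable {Δ a : ℕ} {v : V}

/-- Moving both vertices up to level a + 3K reduces this to `not_split`: between a and a + 3K it
does not matter at which level the tracks are cut. -/
theorem joinedIn_upper (h : GoodCut G lam K Δ w n (node G lam n v) a) (hL : IsLevel G lam)
    (hK : 1 ≤ K) {b b' : ℕ} (hab : a ≤ b) (hb' : b' ≤ a + 3 * K) {x y : V}
    (hx : x ∈ upper G lam Δ w n (node G lam n v) b')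
    (hy : y ∈ upper G lam Δ w n (node G lam n v) b')
    (hxy : JoinedIn G (upper G lam Δ w n (node G lam n v) b) x y) :
    JoinedIn G (upper G lam Δ w n (node G lam n v) b') x y := by
  have hlt : a + 3 * K < n + w := by have := h.hi; omega
  rcases le_total b' b with hbb | hbb
  · exact hxy.mono (upper_anti hbb)
  obtain ⟨x', hx', hxx'⟩ := exists_mem_upper hL hlt hx
  obtain ⟨y', hy', hyy'⟩ := exists_mem_upper hL hlt hy
  have h1 := h.not_split x' hx' y' hy' (((hxx'.symm.mono (upper_anti (by omega))).trans
    (hxy.mono (upper_anti hab))).trans (hyy'.mono (upper_anti (by omega))))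
  exact (hxx'.trans (h1.mono (upper_anti hb'))).trans hyy'.symm

/-- The mirror image: moving both boundary vertices down to level a reduces this to `not_merge`. -/
theorem joinedIn_lower (h : GoodCut G lam K Δ w n (node G lam n v) a) (hL : IsLevel G lam)
    (hK : 1 ≤ K) {b b' : ℕ} (hab : a ≤ b) (hb' : b' ≤ a + 3 * K) {x y : V}
    (hx : x ∈ bdry G lam Δ w n (node G lam n v) b)
    (hy : y ∈ bdry G lam Δ w n (node G lam n v) b)
    (hxy : JoinedIn G (lower G lam Δ w n (node G lam n v) b') x y) :
    JoinedIn G (lower G lam Δ w n (node G lam n v) b) x y := by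
  have hlo := h.lo
  rcases le_total b' b with hbb | hbb
  · exact hxy.mono (lower_mono hbb)
  obtain ⟨x', hx', -, hxx'⟩ := exists_bdry_below hL (a := a) (by omega) hab hx
  obtain ⟨y', hy', -, hyy'⟩ := exists_bdry_below hL (a := a) (by omega) hab hy
  have h1 := h.not_merge x' hx' y' hy' (((hxx'.symm.mono (lower_mono (by omega))).trans
    (hxy.mono (lower_mono hb'))).trans (hyy'.mono (lower_mono (by omega))))
  exact (hxx'.trans (h1.mono (lower_mono hab))).trans hyy'.symm

end GoodCut

end Cuts

/-! ### Zones, parts and links. -/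

/-- A family of windows with disjoint bodies, each with a good cut. -/
structure Parts {V : Type*} (G : SimpleGraph V) (lam : V → ℕ) (K Δ w : ℕ)
    (P : Set (ℕ × Set V)) (cut : ℕ × Set V → ℕ) : Prop where
  level : IsLevel G lam
  one_le : 1 ≤ K
  isNode : ∀ i ∈ P, ∃ v, i.2 = node G lam i.1 v
  good : ∀ i ∈ P, GoodCut G lam K Δ w i.1 i.2 (cut i)
  disj : ∀ i ∈ P, ∀ j ∈ P, ∀ x ∈ body G lam Δ w i.1 i.2, x ∈ body G lam Δ w j.1 j.2 → i = j

section Zones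

variable {V : Type*} (G : SimpleGraph V) (lam : V → ℕ) (K Δ w : ℕ) (P : Set (ℕ × Set V))
  (cut : ℕ × Set V → ℕ)

/-- The vertices between the two levels of a cut that lead to wide components. -/
def zone (i : ℕ × Set V) : Set V :=
  upper G lam Δ w i.1 i.2 (cut i + K) \ upper G lam Δ w i.1 i.2 (cut i + 2 * K)

/-- All vertices in one of the zones of a family of windows. -/
def zones : Set V := {x | ∃ i ∈ P, x ∈ zone G lam K Δ w cut i}

open Classical in
/-- A vertex outside the zones that represents `x`. -/
noncomputable def core (x : V) : V :=
  if h : ∃ z, ∃ i ∈ P, x ∈ zone G lam K Δ w cut i ∧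
    z ∈ upper G lam Δ w i.1 i.2 (cut i + 2 * K) ∧
    JoinedIn G (upper G lam Δ w i.1 i.2 (cut i + K)) x z
  then h.choose else x

/-- The component outside the zones to which `x` is assigned. -/
noncomputable def part (x : V) : Set V :=
  comp G (zones G lam K Δ w P cut)ᶜ (core G lam K Δ w P cut x)

/-- A path that descends through a zone. -/
structure IsLink (i : ℕ × Set V) (z u : V) : Prop where
  mem : z ∈ upper G lam Δ w i.1 i.2 (cut i + 2 * K)
  top : lam z = cut i + 2 * K
  desc : Desc G lam z u
  bot : lam u + 1 = cut i + K

variable {G lam K Δ w P cut}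

namespace Parts

variable (h : Parts G lam K Δ w P cut) {i j : ℕ × Set V} {x y z u : V}
include h

theorem levels (hi : i ∈ P) : i.1 + 14 * K ≤ cut i ∧ cut i + 17 * K ≤ i.1 + w :=
  ⟨(h.good i hi).lo, (h.good i hi).hi⟩

/-- A neighbour in a wide node would put x at level i.1 + w - 1, hence into the upper part above the
zone. -/
theorem mem_body_of_adj_zone (hi : i ∈ P) (hx : x ∈ zone G lam K Δ w cut i) (hxy : G.Adj x y) :
    y ∈ body G lam Δ w i.1 i.2 := by
  have hlev := h.levels hi
  have hK := h.one_le
  obtain ⟨v, hv⟩ := h.isNode i hi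
  have hxb := upper_subset hx.1
  have hxl : cut i + K ≤ lam x := hxb.2
  have hyl := h.level.adj y x hxy.symm
  have hyD : y ∈ i.2 := by
    rw [hv]
    exact mem_node_of_adj (hv ▸ hxb.1.1) hxy (by omega)
  refine ⟨hyD, fun hm => hx.2 ⟨x, y, JoinedIn.refl ⟨hxb.1, ?_⟩, ⟨hyD, hm⟩, hxy⟩⟩
  have := level_of_adj_mains h.level hxb.1 ⟨hyD, hm⟩ hxy
  show cut i + 2 * K ≤ lam x
  omega

theorem mem_zone_of_mem_zones (hi : i ∈ P) (hx : x ∈ body G lam Δ w i.1 i.2)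
    (hz : x ∈ zones G lam K Δ w P cut) : x ∈ zone G lam K Δ w cut i := by
  obtain ⟨j, hj, hxj⟩ := hz
  rwa [h.disj i hi j hj x hx (upper_subset hxj.1).1]

theorem upper_subset_compl (hi : i ∈ P) :
    upper G lam Δ w i.1 i.2 (cut i + 2 * K) ⊆ (zones G lam K Δ w P cut)ᶜ := fun _ hx hz =>
  (h.mem_zone_of_mem_zones hi (upper_subset hx).1 hz).2 hx

theorem lower_subset_compl (hi : i ∈ P) :
    lower G lam Δ w i.1 i.2 (cut i + K) ⊆ (zones G lam K Δ w P cut)ᶜ := fun _ hx hz =>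
  hx.2 (h.mem_zone_of_mem_zones hi hx.1 hz).1

omit h in
theorem mem_upper_or_mem_lower (hi : i ∈ P) (hx : x ∈ body G lam Δ w i.1 i.2)
    (hz : x ∉ zones G lam K Δ w P cut) :
    x ∈ upper G lam Δ w i.1 i.2 (cut i + 2 * K) ∨ x ∈ lower G lam Δ w i.1 i.2 (cut i + K) := by
  by_cases h1 : x ∈ upper G lam Δ w i.1 i.2 (cut i + K)
  · by_cases h2 : x ∈ upper G lam Δ w i.1 i.2 (cut i + 2 * K)
    · exact Or.inl h2
    · exact absurd ⟨i, hi, h1, h2⟩ hz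
  · exact Or.inr ⟨hx, h1⟩

omit h in
theorem core_of_notMem (hx : x ∉ zones G lam K Δ w P cut) : core G lam K Δ w P cut x = x :=
  dif_neg fun ⟨_, i, hi, hxi, _⟩ => hx ⟨i, hi, hxi⟩

omit h in
theorem part_of_notMem (hx : x ∉ zones G lam K Δ w P cut) :
    part G lam K Δ w P cut x = comp G (zones G lam K Δ w P cut)ᶜ x := by
  rw [part, core_of_notMem hx]

omit h in
theorem part_eq_of_joinedIn (hxy : JoinedIn G (zones G lam K Δ w P cut)ᶜ x y) :
    part G lam K Δ w P cut x = part G lam K Δ w P cut y := by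
  rw [part_of_notMem hxy.left_mem, part_of_notMem hxy.right_mem]
  exact comp_eq_of_joinedIn hxy

/-- Disjointness of the bodies ensures that the window chosen in `core` is the one at hand. A zone
vertex thus counts to the part above it. -/
theorem core_spec (hi : i ∈ P) (hx : x ∈ zone G lam K Δ w cut i) :
    core G lam K Δ w P cut x ∈ upper G lam Δ w i.1 i.2 (cut i + 2 * K) ∧
    JoinedIn G (upper G lam Δ w i.1 i.2 (cut i + K)) x (core G lam K Δ w P cut x) := by
  have hex : ∃ z, ∃ i ∈ P, x ∈ zone G lam K Δ w cut i ∧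
      z ∈ upper G lam Δ w i.1 i.2 (cut i + 2 * K) ∧
      JoinedIn G (upper G lam Δ w i.1 i.2 (cut i + K)) x z := by
    obtain ⟨v, hv⟩ := h.isNode i hi
    have hlev := h.levels hi
    have hK := h.one_le
    have hx1 := hx.1
    rw [hv] at hx1
    obtain ⟨z, hz, hxz⟩ := exists_mem_upper h.level (b := cut i + 2 * K) (by omega) hx1
    exact ⟨z, i, hi, hx, by rwa [hv], by rwa [hv]⟩
  rw [core, dif_pos hex]
  obtain ⟨j, hj, hxj, h1, h2⟩ := hex.choose_spec
  rw [h.disj i hi j hj x (upper_subset hx.1).1 (upper_subset hxj.1).1]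
  exact ⟨h1, h2⟩

theorem core_notMem (x : V) : core G lam K Δ w P cut x ∉ zones G lam K Δ w P cut := by
  by_cases hx : x ∈ zones G lam K Δ w P cut
  · obtain ⟨i, hi, hxi⟩ := hx
    exact h.upper_subset_compl hi (h.core_spec hi hxi).1
  · rwa [core_of_notMem hx]

theorem part_core (x : V) :
    part G lam K Δ w P cut (core G lam K Δ w P cut x) = part G lam K Δ w P cut x := by
  rw [part_of_notMem (h.core_notMem x), part]

theorem part_eq_of_joinedIn_upper (hi : i ∈ P) {b : ℕ} (hb : cut i ≤ b)
    (hx : x ∈ upper G lam Δ w i.1 i.2 (cut i + 2 * K))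
    (hy : y ∈ upper G lam Δ w i.1 i.2 (cut i + 2 * K))
    (hxy : JoinedIn G (upper G lam Δ w i.1 i.2 b) x y) :
    part G lam K Δ w P cut x = part G lam K Δ w P cut y := by
  obtain ⟨v, hv⟩ := h.isNode i hi
  have hg := h.good i hi
  refine part_eq_of_joinedIn (JoinedIn.mono ?_ (h.upper_subset_compl hi))
  rw [hv] at hg hx hy hxy ⊢
  exact hg.joinedIn_upper h.level h.one_le hb (by omega) hx hy hxy

/-- The tracks above a cut stay apart. -/
theorem part_eq_of_upper (hi : i ∈ P)
    (hxy : JoinedIn G (upper G lam Δ w i.1 i.2 (cut i + K)) x y) :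
    part G lam K Δ w P cut x = part G lam K Δ w P cut y := by
  have key : ∀ x ∈ upper G lam Δ w i.1 i.2 (cut i + K), ∃ z ∈ upper G lam Δ w i.1 i.2 (cut i + 2 * K),
      JoinedIn G (upper G lam Δ w i.1 i.2 (cut i + K)) x z ∧
      part G lam K Δ w P cut x = part G lam K Δ w P cut z := by
    intro x hx
    by_cases hx2 : x ∈ upper G lam Δ w i.1 i.2 (cut i + 2 * K)
    · exact ⟨x, hx2, JoinedIn.refl hx, rfl⟩
    · obtain ⟨h1, h2⟩ := h.core_spec hi ⟨hx, hx2⟩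
      exact ⟨_, h1, h2, (h.part_core x).symm⟩
  obtain ⟨z, hz, hxz, ez⟩ := key x hxy.left_mem
  obtain ⟨z', hz', hyz', ez'⟩ := key y hxy.right_mem
  rw [ez, ez']
  exact h.part_eq_of_joinedIn_upper hi (by omega) hz hz' ((hxz.symm.trans hxy).trans hyz')

theorem joinedIn_lower (hi : i ∈ P) {b : ℕ} (hb' : b ≤ cut i + 3 * K)
    (hx : x ∈ lower G lam Δ w i.1 i.2 (cut i + K))
    (hy : y ∈ bdry G lam Δ w i.1 i.2 (cut i + K)) (hy' : cut i + K < b)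
    (hxy : JoinedIn G (lower G lam Δ w i.1 i.2 b) x y) :
    JoinedIn G (lower G lam Δ w i.1 i.2 (cut i + K)) x y := by
  obtain ⟨v, hv⟩ := h.isNode i hi
  have hg := h.good i hi
  rw [hv] at hg hx hy hxy ⊢
  obtain ⟨y', hy'U, hyy'⟩ := id hy.2
  have hlev := level_of_adj_upper h.level hy'U hy.1 hyy'.symm
  -- Prolonging the walk beyond y into the upper part forces it to leave the lower part, and it does
  -- so from a boundary vertex p. The good cut then compares p with y.
  obtain ⟨p, q, hxp, hpq, hq, hq', -⟩ := (hxy.tail hyy'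
    (mem_lower_of_lt (upper_subset hy'U).1 (by omega))).exists_exit
    (T := lower G lam Δ w i.1 (node G lam i.1 v) (cut i + K)) hx (fun hcon => hcon.2 hy'U)
  have hp : p ∈ bdry G lam Δ w i.1 (node G lam i.1 v) (cut i + K) := by
    refine ⟨hxp.right_mem.2, q, ?_, hpq⟩
    by_contra hcon
    exact hq' ⟨hq.1, hcon⟩
  exact (hxp.mono Set.inter_subset_right).trans (hg.joinedIn_lower h.level h.one_le
    (Nat.le_add_right _ _) hb' hp hy (((hxp.mono Set.inter_subset_left).symm).trans hxy))

/-- Only the edges across the lower level of a cut lead to another part. -/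
theorem part_eq_of_adj (hxy : G.Adj x y) :
    part G lam K Δ w P cut x = part G lam K Δ w P cut y ∨
    ∃ i ∈ P, (x ∈ upper G lam Δ w i.1 i.2 (cut i + K) ∧ y ∈ lower G lam Δ w i.1 i.2 (cut i + K)) ∨
      (y ∈ upper G lam Δ w i.1 i.2 (cut i + K) ∧ x ∈ lower G lam Δ w i.1 i.2 (cut i + K)) := by
  have key : ∀ x y, G.Adj x y → x ∈ zones G lam K Δ w P cut →
      part G lam K Δ w P cut x = part G lam K Δ w P cut y ∨ ∃ i ∈ P,
      x ∈ upper G lam Δ w i.1 i.2 (cut i + K) ∧ y ∈ lower G lam Δ w i.1 i.2 (cut i + K) := by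
    rintro x y hxy ⟨i, hi, hx⟩
    have hy := h.mem_body_of_adj_zone hi hx hxy
    by_cases hyU : y ∈ upper G lam Δ w i.1 i.2 (cut i + K)
    · exact Or.inl (h.part_eq_of_upper hi (JoinedIn.of_adj hxy hx.1 hyU))
    · exact Or.inr ⟨i, hi, hx.1, hy, hyU⟩
  by_cases hx : x ∈ zones G lam K Δ w P cut
  · rcases key x y hxy hx with e | ⟨i, hi, h'⟩
    exacts [Or.inl e, Or.inr ⟨i, hi, Or.inl h'⟩]
  by_cases hy : y ∈ zones G lam K Δ w P cut
  · rcases key y x hxy.symm hy with e | ⟨i, hi, h'⟩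
    exacts [Or.inl e.symm, Or.inr ⟨i, hi, Or.inr h'⟩]
  exact Or.inl (part_eq_of_joinedIn (JoinedIn.of_adj hxy hx hy))

end Parts

namespace IsLink

variable (h : Parts G lam K Δ w P cut) {i j : ℕ × Set V} {x y z u p q : V}
include h

theorem mem_body (hl : IsLink G lam K Δ w cut i z u) (hi : i ∈ P) (hzp : Desc G lam z p)
    (hpu : Desc G lam p u) : p ∈ body G lam Δ w i.1 i.2 := by
  obtain ⟨v, hv⟩ := h.isNode i hi
  have hlev := h.levels hi
  have hb := hl.bot
  have hK := h.one_le
  have h1 := (upper_subset hl.mem).1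
  rw [hv] at h1 ⊢
  exact mem_body_of_desc h1 hzp (by have := hpu.le; omega)

theorem mem_zone (hl : IsLink G lam K Δ w cut i z u) (hi : i ∈ P) (hzp : Desc G lam z p)
    (hpu : Desc G lam p u) (hpz : p ≠ z) (hpu' : p ≠ u) : p ∈ zone G lam K Δ w cut i := by
  obtain ⟨v, hv⟩ := h.isNode i hi
  have hlev := h.levels hi
  have hb := hl.bot
  have ht := hl.top
  have h1 := hzp.le
  have h2 := hpu.le
  have h3 : lam p ≠ lam z := fun e => hpz (hzp.eq_of_le e.ge).symm
  have h4 : lam p ≠ lam u := fun e => hpu' (hpu.eq_of_le e.le)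
  refine ⟨?_, fun hcon => by have := le_of_mem_upper hcon; omega⟩
  have hm := hl.mem
  rw [hv] at hm ⊢
  exact mem_upper_of_joinedIn (joinedIn_body_of_desc (by omega) (upper_subset hm).1 hzp (by omega))
    (upper_anti (by omega) hm)

theorem mem_bdry (hl : IsLink G lam K Δ w cut i z u) (hi : i ∈ P) :
    u ∈ bdry G lam Δ w i.1 i.2 (cut i + K) := by
  have hub := mem_body h hl hi hl.desc (Desc.refl u)
  have hK := h.one_le
  have hb := hl.bot
  have ht := hl.top
  refine ⟨mem_lower_of_lt hub (by omega), ?_⟩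
  rcases Relation.ReflTransGen.cases_tail hl.desc with e | ⟨p, hzp, hpu⟩
  · rw [e] at hb; omega
  refine ⟨p, ?_, hpu.1.symm⟩
  exact (mem_zone h hl hi hzp (Relation.ReflTransGen.single hpu)
    (fun e => by rw [e] at hpu; omega) (fun e => by rw [e] at hpu; omega)).1

theorem top_notMem (hl : IsLink G lam K Δ w cut i z u) (hi : i ∈ P) :
    z ∉ zones G lam K Δ w P cut := h.upper_subset_compl hi hl.mem

theorem bot_notMem (hl : IsLink G lam K Δ w cut i z u) (hi : i ∈ P) :
    u ∉ zones G lam K Δ w P cut := h.lower_subset_compl hi (mem_bdry h hl hi).1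

/-- The surroundings of a link lie in the same window, between the lowest and the highest level
of the cut. -/
theorem joinedIn_near (hl : IsLink G lam K Δ w cut i z u) (hi : i ∈ P) (hzp : Desc G lam z p)
    (hpu : Desc G lam p u) (hpq : Within G (K - 1) p q) :
    JoinedIn G (upper G lam Δ w i.1 i.2 (cut i)) z q ∧
    JoinedIn G (lower G lam Δ w i.1 i.2 (cut i + 3 * K)) q u := by
  obtain ⟨v, hv⟩ := h.isNode i hi
  have hlev := h.levels hi
  have hK := h.one_le
  have hb := hl.bot
  have ht := hl.top
  have hm := hl.mem
  have hpb := mem_body h hl hi hzp hpu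
  have h1 := hzp.le
  have h2 := hpu.le
  have hS : JoinedIn G {x | cut i ≤ lam x ∧ lam x < cut i + 3 * K} p q :=
    hpq.joinedIn fun x hx _ => by
      have e1 := h.level.le_of_within hx
      have e2 := h.level.le_of_within hx.symm
      show cut i ≤ lam x ∧ lam x < cut i + 3 * K
      omega
  rw [hv] at hpb hm ⊢
  have hS' := joinedIn_body hpb (fun x hx => ⟨hlev.1.trans' (by omega) |>.trans hx.1,
    by have := hx.2; omega⟩) hS
  have hzb := (upper_subset hm).1
  have hzp' := joinedIn_body_of_desc (a := cut i) (by omega) hzb hzp (by omega)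
  refine ⟨joinedIn_upper (hzp'.trans (hS'.mono fun x hx => ⟨hx.2, hx.1.1⟩))
    (upper_anti (by omega) hm), JoinedIn.trans (hS'.mono fun x hx => mem_lower_of_lt hx.2 hx.1.2).symm ?_⟩
  exact hpu.joinedIn fun x hx hx' => mem_lower_of_lt
    (mem_body_of_desc hpb hx (by have := hx'.le; omega)) (by have := hx.le; omega)

/-- A link occupies the levels from cut + K - 1 to cut + 2K, so its (K-1)-neighbourhood lies within
the levels from cut to cut + 3K. There tracks neither split nor merge, hence close links have the
same part above and the same part below. -/
theorem eq_of_near (hl : IsLink G lam K Δ w cut i z u) (hi : i ∈ P) (hzp : Desc G lam z p)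
    (hpu : Desc G lam p u) {z' u' : V} (hl' : IsLink G lam K Δ w cut j z' u') (hj : j ∈ P)
    (hzq : Desc G lam z' q) (hqu : Desc G lam q u') (hpq : Within G (K - 1) p q) :
    part G lam K Δ w P cut z = part G lam K Δ w P cut z' ∧
    part G lam K Δ w P cut u = part G lam K Δ w P cut u' := by
  obtain ⟨h1, h2⟩ := joinedIn_near h hl hi hzp hpu hpq
  obtain rfl := h.disj i hi j hj q (upper_subset h1.right_mem).1 (mem_body h hl' hj hzq hqu)
  obtain ⟨h3, h4⟩ := joinedIn_near h hl' hi hzq hqu (Within.refl _ _)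
  have hK := h.one_le
  refine ⟨h.part_eq_of_joinedIn_upper hi le_rfl hl.mem hl'.mem (h1.trans h3.symm), ?_⟩
  exact Parts.part_eq_of_joinedIn ((h.joinedIn_lower hi (b := cut i + 3 * K) le_rfl
    (mem_bdry h hl hi).1 (mem_bdry h hl' hi) (by omega) (h2.symm.trans h4)).mono
    (h.lower_subset_compl hi))

theorem part_eq_of_near (hl : IsLink G lam K Δ w cut i z u) (hi : i ∈ P) (hzp : Desc G lam z p)
    (hpu : Desc G lam p u) (hq : q ∉ zones G lam K Δ w P cut) (hpq : Within G (K - 1) p q) :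
    part G lam K Δ w P cut q = part G lam K Δ w P cut z ∨
    part G lam K Δ w P cut q = part G lam K Δ w P cut u := by
  obtain ⟨h1, h2⟩ := joinedIn_near h hl hi hzp hpu hpq
  have hK := h.one_le
  rcases Parts.mem_upper_or_mem_lower hi (upper_subset h1.right_mem).1 hq with hq' | hq'
  · exact Or.inl (h.part_eq_of_joinedIn_upper hi le_rfl hl.mem hq' h1).symm
  · exact Or.inr (Parts.part_eq_of_joinedIn ((h.joinedIn_lower hi (b := cut i + 3 * K)
      le_rfl hq' (mem_bdry h hl hi) (by omega) h2).mono (h.lower_subset_compl hi)))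

end IsLink

namespace Parts

variable (h : Parts G lam K Δ w P cut) {i : ℕ × Set V} {x y : V}
include h

/-- The edge xy need not lie on a full descent. But x can be followed up to a first vertex z above
the zone, and the descent from there reaches a boundary vertex u. Since tracks do not merge, u is in
the part of y. -/
theorem exists_link (hi : i ∈ P) (hx : x ∈ upper G lam Δ w i.1 i.2 (cut i + K))
    (hy : y ∈ lower G lam Δ w i.1 i.2 (cut i + K)) (hxy : G.Adj x y) :
    ∃ z u, IsLink G lam K Δ w cut i z u ∧ part G lam K Δ w P cut z = part G lam K Δ w P cut x ∧
      part G lam K Δ w P cut u = part G lam K Δ w P cut y := by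
  obtain ⟨v, hv⟩ := h.isNode i hi
  have hlev := h.levels hi
  have hK := h.one_le
  have hlx := level_of_adj_upper h.level hx hy hxy
  have hyb : y ∈ bdry G lam Δ w i.1 i.2 (cut i + K) := ⟨hy, x, hx, hxy.symm⟩
  have hex : ∃ z₀ ∈ upper G lam Δ w i.1 i.2 (cut i + 2 * K),
      JoinedIn G (upper G lam Δ w i.1 i.2 (cut i + K)) x z₀ := by
    rw [hv] at hx ⊢
    exact exists_mem_upper h.level (by omega) hx
  obtain ⟨z₀, hz₀, hxz₀⟩ := hex
  obtain ⟨p, z, hxp, hpz, hz, hz2, -⟩ := hxz₀.exists_exit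
    (T := (upper G lam Δ w i.1 i.2 (cut i + 2 * K))ᶜ)
    (fun hcon => by have := le_of_mem_upper hcon; omega) (fun hcon => hcon hz₀)
  rw [Set.notMem_compl_iff] at hz2
  have hxp2 : JoinedIn G (lower G lam Δ w i.1 i.2 (cut i + 2 * K)) x p :=
    hxp.mono fun a ha => ⟨(upper_subset ha.1).1, ha.2⟩
  have hpb : p ∈ bdry G lam Δ w i.1 i.2 (cut i + 2 * K) := ⟨hxp2.right_mem, z, hz2, hpz⟩
  have hlz := level_of_adj_upper h.level hz2 hpb.1 hpz.symm
  have hex : ∃ u ∈ bdry G lam Δ w i.1 i.2 (cut i + K), Desc G lam p u ∧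
      JoinedIn G (lower G lam Δ w i.1 i.2 (cut i + 2 * K)) p u := by
    rw [hv] at hpb ⊢
    exact exists_bdry_below h.level (by omega) (by omega) hpb
  obtain ⟨u, hu, hpu, hpu'⟩ := hex
  obtain ⟨u', hu', huu'⟩ := id hu.2
  have hlu := level_of_adj_upper h.level hu' hu.1 huu'.symm
  refine ⟨z, u, ⟨hz2, hlz.1, Relation.ReflTransGen.head ⟨hpz.symm, by omega⟩ hpu, hlu.2⟩, ?_, ?_⟩
  · exact (h.part_eq_of_upper hi ((hxp.mono Set.inter_subset_left).tail hpz hz)).symm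
  · refine part_eq_of_joinedIn ((h.joinedIn_lower hi (b := cut i + 2 * K) (by omega)
      hu.1 hyb (by omega) ?_).mono (h.lower_subset_compl hi))
    exact (hpu'.symm.trans hxp2.symm).trans (JoinedIn.of_adj hxy hxp2.left_mem
      (lower_mono (by omega) hy))

/-- Distinct components outside the zones are far apart. -/
theorem part_eq_of_within (hx : x ∉ zones G lam K Δ w P cut) (hy : y ∉ zones G lam K Δ w P cut)
    (hxy : Within G (K - 1) x y) :
    part G lam K Δ w P cut x = part G lam K Δ w P cut y := by
  by_contra hne
  have hK := h.one_le
  obtain ⟨p, hp⟩ := hxy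
  -- The walk changes its part along some edge, so it has a vertex c just below a zone. All points
  -- within K - 1 of c lie below level cut + 2K; since tracks do not merge there, both ends of the
  -- walk are in the part of c.
  obtain ⟨d, hd, h1, h2⟩ := p.exists_boundary_dart
    {a | part G lam K Δ w P cut x = part G lam K Δ w P cut a} rfl hne
  have hcd : ∃ c ∈ p.support, ∃ i ∈ P, c ∈ bdry G lam Δ w i.1 i.2 (cut i + K) := by
    have hne' : part G lam K Δ w P cut d.fst ≠ part G lam K Δ w P cut d.snd := fun e =>
      h2 (Eq.trans h1 e)
    obtain ⟨i, hi, h' | h'⟩ := (h.part_eq_of_adj d.adj).resolve_left hne'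
    · exact ⟨d.snd, p.dart_snd_mem_support_of_mem_darts hd, i, hi, h'.2, _, h'.1, d.adj.symm⟩
    · exact ⟨d.fst, p.dart_fst_mem_support_of_mem_darts hd, i, hi, h'.2, _, h'.1, d.adj⟩
  obtain ⟨c, hc, i, hi, hcb⟩ := hcd
  obtain ⟨v, hv⟩ := h.isNode i hi
  have hlev := h.levels hi
  have hlc : lam c + 1 = cut i + K := by
    obtain ⟨hcl, c', hc', hcc'⟩ := hcb
    exact (level_of_adj_upper h.level hc' hcl hcc'.symm).2
  have key : ∀ q, q ∉ zones G lam K Δ w P cut → Within G (K - 1) c q →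
      part G lam K Δ w P cut q = part G lam K Δ w P cut c := by
    intro q hq hcq
    have hS : JoinedIn G {x | i.1 ≤ lam x ∧ lam x < cut i + 2 * K} c q :=
      hcq.joinedIn fun x hx _ => by
        have e1 := h.level.le_of_within hx
        have e2 := h.level.le_of_within hx.symm
        show i.1 ≤ lam x ∧ lam x < cut i + 2 * K
        omega
    have hS' : JoinedIn G (lower G lam Δ w i.1 i.2 (cut i + 2 * K)) c q := by
      have hcb' := hcb.1.1
      rw [hv] at hcb' ⊢
      exact (joinedIn_body hcb' (fun x hx => ⟨hx.1, by have := hx.2; omega⟩) hS).mono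
        fun x hx => mem_lower_of_lt hx.2 hx.1.2
    have hql := (mem_upper_or_mem_lower hi hS'.right_mem.1 hq).resolve_left hS'.right_mem.2
    exact part_eq_of_joinedIn ((h.joinedIn_lower hi (b := cut i + 2 * K) (by omega)
      hql hcb (by omega) hS'.symm).mono (h.lower_subset_compl hi))
  have := within_of_mem_support p hp hc
  exact hne ((key x hx this.1.symm).trans (key y hy this.2).symm)

end Parts

end Zones

/-! ### From models in the quotient by the parts to fat models. -/

section FatModel

variable {V : Type*} {G : SimpleGraph V} {lam : V → ℕ} {K Δ w : ℕ} {P : Set (ℕ × Set V)}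
  {cut : ℕ × Set V → ℕ}

/-- The union of the components outside the zones that `Q` meets and of all links between them. -/
def hull (G : SimpleGraph V) (lam : V → ℕ) (K Δ w : ℕ) (P : Set (ℕ × Set V))
    (cut : ℕ × Set V → ℕ) (Q : Set V) : Set V :=
  {x | (x ∉ zones G lam K Δ w P cut ∧ ∃ q ∈ Q, part G lam K Δ w P cut q = part G lam K Δ w P cut x) ∨
    ∃ i ∈ P, ∃ z u, IsLink G lam K Δ w cut i z u ∧ Desc G lam z x ∧ Desc G lam x u ∧
      (∃ q ∈ Q, part G lam K Δ w P cut q = part G lam K Δ w P cut z) ∧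
      ∃ q ∈ Q, part G lam K Δ w P cut q = part G lam K Δ w P cut u}

/-- Steps inside `Q` that do not leave its components. -/
def PartStep (G : SimpleGraph V) (lam : V → ℕ) (K Δ w : ℕ) (P : Set (ℕ × Set V))
    (cut : ℕ × Set V → ℕ) (Q : Set V) (a b : V) : Prop :=
  b ∈ Q ∧ (G.Adj a b ∨ part G lam K Δ w P cut a = part G lam K Δ w P cut b)

namespace Parts

variable (h : Parts G lam K Δ w P cut)
include h

omit h in
theorem joinedIn_hull {Q : Set V} {x y q : V} (hq : q ∈ Q)
    (hx : x ∉ zones G lam K Δ w P cut) (hy : y ∉ zones G lam K Δ w P cut)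
    (hqx : part G lam K Δ w P cut q = part G lam K Δ w P cut x)
    (hqy : part G lam K Δ w P cut q = part G lam K Δ w P cut y) :
    JoinedIn G (hull G lam K Δ w P cut Q) x y := by
  rw [hqx, part_of_notMem hx, part_of_notMem hy] at hqy
  rw [part_of_notMem hx] at hqx
  have hy' : y ∈ comp G (zones G lam K Δ w P cut)ᶜ x := by rw [hqy]; exact mem_comp_self hy
  refine (comp_connected (mem_comp_self hx) hy').mono fun a ha => Or.inl ⟨?_, q, hq, ?_⟩
  · exact (show JoinedIn G _ x a from ha).right_mem
  · rw [hqx, ← part_of_notMem hx]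
    exact part_eq_of_joinedIn ha

/-- The core of q stands for q: steps inside a part join cores outside the zones, and an edge
between two parts is replaced by a link between them. -/
theorem isConn_hull {Q : Set V} {q₀ : V} (hq₀ : q₀ ∈ Q)
    (hQ : ∀ q ∈ Q, Relation.ReflTransGen (PartStep G lam K Δ w P cut Q) q₀ q) :
    IsConn G (hull G lam K Δ w P cut Q) := by
  have hlink : ∀ i ∈ P, ∀ z u, IsLink G lam K Δ w cut i z u →
      (∃ q ∈ Q, part G lam K Δ w P cut q = part G lam K Δ w P cut z) →
      (∃ q ∈ Q, part G lam K Δ w P cut q = part G lam K Δ w P cut u) → ∀ x, Desc G lam z x →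
      Desc G lam x u → JoinedIn G (hull G lam K Δ w P cut Q) z x :=
    fun i hi z u hl hz hu x hzx hxu => hzx.joinedIn fun a ha ha' =>
      Or.inr ⟨i, hi, z, u, hl, ha, ha'.trans hxu, hz, hu⟩
  have hself : ∀ q ∈ Q, JoinedIn G (hull G lam K Δ w P cut Q) (core G lam K Δ w P cut q)
      (core G lam K Δ w P cut q) := fun q hq =>
    joinedIn_hull hq (h.core_notMem q) (h.core_notMem q) (h.part_core q).symm (h.part_core q).symm
  have hsame : ∀ q ∈ Q, ∀ q' ∈ Q, part G lam K Δ w P cut q = part G lam K Δ w P cut q' →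
      JoinedIn G (hull G lam K Δ w P cut Q) (core G lam K Δ w P cut q) (core G lam K Δ w P cut q') :=
    fun q hq q' _ e => joinedIn_hull hq (h.core_notMem q) (h.core_notMem q') (h.part_core q).symm
      (e.trans (h.part_core q').symm)
  have hcross : ∀ q ∈ Q, ∀ q' ∈ Q, ∀ i ∈ P, q ∈ upper G lam Δ w i.1 i.2 (cut i + K) →
      q' ∈ lower G lam Δ w i.1 i.2 (cut i + K) → G.Adj q q' →
      JoinedIn G (hull G lam K Δ w P cut Q) (core G lam K Δ w P cut q)
        (core G lam K Δ w P cut q') := by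
    intro q hq q' hq' i hi hqU hqL hadj
    obtain ⟨z, u, hl, ez, eu⟩ := h.exists_link hi hqU hqL hadj
    exact ((joinedIn_hull hq (h.core_notMem q) (hl.top_notMem h hi) (h.part_core q).symm
      ez.symm).trans (hlink i hi z u hl ⟨q, hq, ez.symm⟩ ⟨q', hq', eu.symm⟩ u hl.desc
      (Desc.refl u))).trans (joinedIn_hull hq' (hl.bot_notMem h hi) (h.core_notMem q') eu.symm
      (h.part_core q').symm)
  have hchain : ∀ q, Relation.ReflTransGen (PartStep G lam K Δ w P cut Q) q₀ q → q ∈ Q ∧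
      JoinedIn G (hull G lam K Δ w P cut Q) (core G lam K Δ w P cut q₀)
        (core G lam K Δ w P cut q) := by
    intro q hq
    induction hq with
    | refl => exact ⟨hq₀, hself q₀ hq₀⟩
    | @tail a b _ hab ih =>
      obtain ⟨ha, hja⟩ := ih
      refine ⟨hab.1, hja.trans ?_⟩
      rcases hab.2 with hadj | e
      · rcases h.part_eq_of_adj hadj with e | ⟨i, hi, ⟨h1, h2⟩ | ⟨h1, h2⟩⟩
        · exact hsame a ha b hab.1 e
        · exact hcross a ha b hab.1 i hi h1 h2 hadj
        · exact (hcross b hab.1 a ha i hi h1 h2 hadj.symm).symm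
      · exact hsame a ha b hab.1 e
  refine IsConn.of_center (core G lam K Δ w P cut q₀) (hself q₀ hq₀).left_mem ?_
  rintro x (⟨hx, q, hq, e⟩ | ⟨i, hi, z, u, hl, hzx, hxu, ⟨q, hq, e⟩, hu⟩)
  · exact (hchain q (hQ q hq)).2.trans (joinedIn_hull hq (h.core_notMem q) hx (h.part_core q).symm e)
  · exact ((hchain q (hQ q hq)).2.trans (joinedIn_hull hq (h.core_notMem q) (hl.top_notMem h hi)
      (h.part_core q).symm e)).trans (hlink i hi z u hl ⟨q, hq, e⟩ hu x hzx hxu)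

/-- Both ends of a link in a hull are in parts of that hull. Hence in each case of components and
links, closeness exhibits a part common to both hulls. -/
theorem hull_far {Q Q' : Set V}
    (hd : ∀ q ∈ Q, ∀ q' ∈ Q', part G lam K Δ w P cut q ≠ part G lam K Δ w P cut q') :
    ∀ x ∈ hull G lam K Δ w P cut Q, ∀ y ∈ hull G lam K Δ w P cut Q', ¬ Within G (K - 1) x y := by
  rintro x (⟨hx, q, hq, e⟩ | ⟨i, hi, z, u, hl, hzx, hxu, ⟨q₁, hq₁, e₁⟩, q₂, hq₂, e₂⟩) y
    (⟨hy, q', hq', e'⟩ | ⟨j, hj, z', u', hl', hzy, hyu, ⟨q₁', hq₁', e₁'⟩, q₂', hq₂', e₂'⟩) hxy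
  · exact hd q hq q' hq' (e.trans ((h.part_eq_of_within hx hy hxy).trans e'.symm))
  · rcases hl'.part_eq_of_near h hj hzy hyu hx hxy.symm with e'' | e''
    · exact hd q hq q₁' hq₁' (e.trans (e''.trans e₁'.symm))
    · exact hd q hq q₂' hq₂' (e.trans (e''.trans e₂'.symm))
  · rcases hl.part_eq_of_near h hi hzx hxu hy hxy with e'' | e''
    · exact hd q₁ hq₁ q' hq' (e₁.trans (e''.symm.trans e'.symm))
    · exact hd q₂ hq₂ q' hq' (e₂.trans (e''.symm.trans e'.symm))
  · exact hd q₁ hq₁ q₁' hq₁' (e₁.trans (((hl.eq_of_near h hi hzx hxu hl' hj hzy hyu hxy).1).trans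
      e₁'.symm))

/-- A point of a link near the hull of `Q`. -/
theorem link_far_hull {Q : Set V} {i : ℕ × Set V} (hi : i ∈ P) {z u x y : V}
    (hl : IsLink G lam K Δ w cut i z u) (hzx : Desc G lam z x) (hxu : Desc G lam x u)
    (hz : ∀ q ∈ Q, part G lam K Δ w P cut q ≠ part G lam K Δ w P cut z)
    (hu : ∀ q ∈ Q, part G lam K Δ w P cut q ≠ part G lam K Δ w P cut u)
    (hy : y ∈ hull G lam K Δ w P cut Q) : ¬ Within G (K - 1) x y := by
  intro hxy
  rcases hy with ⟨hy, q, hq, e⟩ | ⟨j, hj, z', u', hl', hzy, hyu, ⟨q₁, hq₁, e₁⟩, -⟩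
  · rcases hl.part_eq_of_near h hi hzx hxu hy hxy with e' | e'
    · exact hz q hq (e.trans e')
    · exact hu q hq (e.trans e')
  · exact hz q₁ hq₁ (e₁.trans (hl.eq_of_near h hi hzx hxu hl' hj hzy hyu hxy).1.symm)

/-- A link whose top, but not whose bottom, is assigned to `Q` meets the hull of `Q` in its
top only. -/
theorem mem_hull_iff_top {Q : Set V} {i : ℕ × Set V} (hi : i ∈ P) {z u x : V}
    (hl : IsLink G lam K Δ w cut i z u) (hzx : Desc G lam z x) (hxu : Desc G lam x u)
    (hz : ∃ q ∈ Q, part G lam K Δ w P cut q = part G lam K Δ w P cut z)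
    (hu : ∀ q ∈ Q, part G lam K Δ w P cut q ≠ part G lam K Δ w P cut u) :
    x ∈ hull G lam K Δ w P cut Q ↔ x = z := by
  constructor
  · rintro (⟨hx, q, hq, e⟩ | ⟨j, hj, z', u', hl', hzy, hyu, -, q₂, hq₂, e₂⟩)
    · by_contra hxz
      by_cases hxu' : x = u
      · exact hu q hq (hxu' ▸ e)
      · exact hx ⟨i, hi, hl.mem_zone h hi hzx hxu hxz hxu'⟩
    · exact absurd (e₂.trans (hl.eq_of_near h hi hzx hxu hl' hj hzy hyu (Within.refl _ _)).2.symm)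
        (hu q₂ hq₂)
  · rintro rfl
    exact Or.inl ⟨hl.top_notMem h hi, hz⟩

theorem mem_hull_iff_bot {Q : Set V} {i : ℕ × Set V} (hi : i ∈ P) {z u x : V}
    (hl : IsLink G lam K Δ w cut i z u) (hzx : Desc G lam z x) (hxu : Desc G lam x u)
    (hz : ∀ q ∈ Q, part G lam K Δ w P cut q ≠ part G lam K Δ w P cut z)
    (hu : ∃ q ∈ Q, part G lam K Δ w P cut q = part G lam K Δ w P cut u) :
    x ∈ hull G lam K Δ w P cut Q ↔ x = u := by
  constructor
  · rintro (⟨hx, q, hq, e⟩ | ⟨j, hj, z', u', hl', hzy, hyu, ⟨q₂, hq₂, e₂⟩, -⟩)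
    · by_contra hxu'
      by_cases hxz : x = z
      · exact hz q hq (hxz ▸ e)
      · exact hx ⟨i, hi, hl.mem_zone h hi hzx hxu hxz hxu'⟩
    · exact absurd (e₂.trans (hl.eq_of_near h hi hzx hxu hl' hj hzy hyu (Within.refl _ _)).1.symm)
        (hz q₂ hq₂)
  · rintro rfl
    exact Or.inl ⟨hl.bot_notMem h hi, hu⟩

/-- A model of `K2 t` in the quotient by the parts yields a fat model. -/
theorem isFatMinor {t : ℕ} (Q : Fin 2 ⊕ Fin t → Set V)
    (hne : ∀ a, ∃ q₀ ∈ Q a, ∀ q ∈ Q a, Relation.ReflTransGen (PartStep G lam K Δ w P cut (Q a)) q₀ q)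
    (hd : ∀ a b, a ≠ b → ∀ q ∈ Q a, ∀ q' ∈ Q b,
      part G lam K Δ w P cut q ≠ part G lam K Δ w P cut q')
    (hadj : ∀ i k, ∃ q ∈ Q (.inl i), ∃ q' ∈ Q (.inr k), G.Adj q q') : IsFatMinor K (K2 t) G := by
  have hlink : ∀ i k, ∃ j ∈ P, ∃ z u, IsLink G lam K Δ w cut j z u ∧
      (((∃ q ∈ Q (.inl i), part G lam K Δ w P cut q = part G lam K Δ w P cut z) ∧
        ∃ q ∈ Q (.inr k), part G lam K Δ w P cut q = part G lam K Δ w P cut u) ∨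
       ((∃ q ∈ Q (.inr k), part G lam K Δ w P cut q = part G lam K Δ w P cut z) ∧
        ∃ q ∈ Q (.inl i), part G lam K Δ w P cut q = part G lam K Δ w P cut u)) := by
    intro i k
    obtain ⟨q, hq, q', hq', hqq⟩ := hadj i k
    obtain ⟨j, hj, ⟨h1, h2⟩ | ⟨h1, h2⟩⟩ := (h.part_eq_of_adj hqq).resolve_left
      (hd _ _ Sum.inl_ne_inr q hq q' hq')
    · obtain ⟨z, u, hl, ez, eu⟩ := h.exists_link hj h1 h2 hqq
      exact ⟨j, hj, z, u, hl, Or.inl ⟨⟨q, hq, ez.symm⟩, q', hq', eu.symm⟩⟩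
    · obtain ⟨z, u, hl, ez, eu⟩ := h.exists_link hj h1 h2 hqq.symm
      exact ⟨j, hj, z, u, hl, Or.inr ⟨⟨q', hq', ez.symm⟩, q, hq, eu.symm⟩⟩
  choose j hj z u hl hends using hlink
  have hdis : ∀ a b v, (∃ q ∈ Q a, part G lam K Δ w P cut q = part G lam K Δ w P cut v) →
      (∃ q ∈ Q b, part G lam K Δ w P cut q = part G lam K Δ w P cut v) → a = b := by
    rintro a b v ⟨q, hq, e⟩ ⟨q', hq', e'⟩
    by_contra hab
    exact hd a b hab q hq q' hq' (e.trans e'.symm)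
  have hnot : ∀ a b v, (∃ q ∈ Q a, part G lam K Δ w P cut q = part G lam K Δ w P cut v) → b ≠ a →
      ∀ q ∈ Q b, part G lam K Δ w P cut q ≠ part G lam K Δ w P cut v :=
    fun a b v hv hba q hq e => hba (hdis b a v ⟨q, hq, e⟩ hv)
  refine isFatMinor_of_paths (Q := fun i k => {x | Desc G lam (z i k) x ∧ Desc G lam x (u i k)})
    (fun a => hull G lam K Δ w P cut (Q a)) ?_ ?_ ?_ ?_ ?_
  · intro a
    obtain ⟨q₀, hq₀, hQ⟩ := hne a
    exact h.isConn_hull hq₀ hQ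
  · exact fun a b hab => h.hull_far (hd a b hab)
  · intro i k
    obtain ⟨p, hp, -, hs⟩ := (hl i k).desc.exists_path
    rcases hends i k with ⟨h1, h2⟩ | ⟨h1, h2⟩
    · refine ⟨_, _, p, hp, fun x hx => ?_, fun x hx => ?_, hs⟩
      · exact h.mem_hull_iff_top (hj i k) (hl i k) (hs x hx).1 (hs x hx).2 h1
          (hnot _ _ _ h2 Sum.inl_ne_inr)
      · exact h.mem_hull_iff_bot (hj i k) (hl i k) (hs x hx).1 (hs x hx).2
          (hnot _ _ _ h1 Sum.inr_ne_inl) h2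
    · refine ⟨_, _, p.reverse, hp.reverse, fun x hx => ?_, fun x hx => ?_, fun x hx => ?_⟩ <;>
        rw [SimpleGraph.Walk.support_reverse, List.mem_reverse] at hx
      · exact h.mem_hull_iff_bot (hj i k) (hl i k) (hs x hx).1 (hs x hx).2
          (hnot _ _ _ h1 Sum.inl_ne_inr) h2
      · exact h.mem_hull_iff_top (hj i k) (hl i k) (hs x hx).1 (hs x hx).2 h1
          (hnot _ _ _ h2 Sum.inr_ne_inl)
      · exact hs x hx
  · rintro i k i' k' hne x hx y hy hxy
    obtain ⟨ez, eu⟩ := (hl i k).eq_of_near h (hj i k) hx.1 hx.2 (hl i' k') (hj i' k') hy.1 hy.2 hxy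
    -- Close branch paths have the same two end parts, and these determine the hub and the arm.
    apply hne
    rcases hends i k with ⟨h1, h2⟩ | ⟨h1, h2⟩ <;> rcases hends i' k' with ⟨h3, h4⟩ | ⟨h3, h4⟩ <;>
      
      rw [← ez] at h3 <;> rw [← eu] at h4 <;> have e1 := hdis _ _ _ h1 h3 <;>
      have e2 := hdis _ _ _ h2 h4
    · exact Prod.ext (Sum.inl_injective e1) (Sum.inr_injective e2)
    · exact absurd e1 Sum.inl_ne_inr
    · exact absurd e1 Sum.inr_ne_inl
    · exact Prod.ext (Sum.inl_injective e2) (Sum.inr_injective e1)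
  · rintro i k a hai hak x hx y hy
    rcases hends i k with ⟨h1, h2⟩ | ⟨h1, h2⟩
    · exact h.link_far_hull (hj i k) (hl i k) hx.1 hx.2 (hnot _ _ _ h1 hai) (hnot _ _ _ h2 hak) hy
    · exact h.link_far_hull (hj i k) (hl i k) hx.1 hx.2 (hnot _ _ _ h1 hak) (hnot _ _ _ h2 hai) hy

end Parts

end FatModel

/-! ### Blocks, and the narrow nodes that separate them. -/

/-- All windows at multiples of `w` have good cuts. -/
structure Cuttable {V : Type*} (G : SimpleGraph V) (lam : V → ℕ) (K Δ w : ℕ) : Prop where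
  level : IsLevel G lam
  one_le : 1 ≤ K
  width : 3 * K ≤ w
  exists_cut : ∀ k v, ∃ a, GoodCut G lam K Δ w (k * w) (node G lam (k * w) v) a

theorem Ctx.cuttable {V : Type*} {G : SimpleGraph V} {lam : V → ℕ} {K t w : ℕ}
    (hC : Ctx G lam K t w) : Cuttable G lam K (thr K t w) w := by
  have hw := hC.width
  have hw' : 3 * K ≤ w := by
    have : 0 ≤ 3 * K * (t ^ 5 + 1) := Nat.zero_le _
    omega
  refine ⟨hC.level, hC.one_le, hw', fun k v => exists_goodCut hC ?_ v⟩
  rcases Nat.eq_zero_or_pos k with rfl | hk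
  · exact Or.inl (Nat.zero_mul _)
  · exact Or.inr (hw'.trans (Nat.le_mul_of_pos_left _ hk))

section Blocks

variable {V : Type*} (G : SimpleGraph V) (lam : V → ℕ) (K Δ w : ℕ)

open Classical in
/-- A chosen good cut of each window that has one. -/
noncomputable def cutOf (i : ℕ × Set V) : ℕ :=
  if h : ∃ a, GoodCut G lam K Δ w i.1 i.2 a then h.choose else 0

open Classical in
/-- The highest multiple of `w` below `x` at which the component of `x` is narrow. -/
noncomputable def base (x : V) : ℕ :=
  Nat.findGreatest (fun k => k = 0 ∨ (k * w ≤ lam x ∧ ¬ IsMain G lam Δ (k * w) x)) (lam x)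

/-- The block of `x`: the component above its base. -/
noncomputable def blk (x : V) : ℕ × Set V :=
  (base G lam Δ w x, node G lam (base G lam Δ w x * w) x)

/-- The windows of a block. -/
def windows (b : ℕ × Set V) : Set (ℕ × Set V) :=
  {i | ∃ k v, b.1 ≤ k ∧ v ∈ b.2 ∧ k * w ≤ lam v ∧
    (∀ l, b.1 < l → l ≤ k → IsMain G lam Δ (l * w) v) ∧ i = (k * w, node G lam (k * w) v)}

/-- The part of `x` with respect to a block. -/
noncomputable def label (b : ℕ × Set V) (x : V) : Set V :=
  part G lam K Δ w (windows G lam Δ w b) (cutOf G lam K Δ w) x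

/-- The block of `x` and the part of `x` in it. -/
noncomputable def proj (x : V) : (ℕ × Set V) × Set V :=
  (blk G lam Δ w x, label G lam K Δ w (blk G lam Δ w x) x)

variable {G lam K Δ w}

theorem base_mul_le (x : V) : base G lam Δ w x * w ≤ lam x := by
  classical
  rcases Nat.findGreatest_spec (P := fun k => k = 0 ∨ (k * w ≤ lam x ∧ ¬ IsMain G lam Δ (k * w) x))
    (Nat.zero_le (lam x)) (Or.inl rfl) with h | h
  · rw [base, h]; simp
  · exact h.1

theorem base_spec (x : V) :
    base G lam Δ w x = 0 ∨ ¬ IsMain G lam Δ (base G lam Δ w x * w) x := by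
  classical
  exact (Nat.findGreatest_spec (P := fun k => k = 0 ∨ (k * w ≤ lam x ∧ ¬ IsMain G lam Δ (k * w) x))
    (Nat.zero_le (lam x)) (Or.inl rfl)).imp id And.right

theorem le_base {x : V} {k : ℕ} (hw : 0 < w) (hk : k * w ≤ lam x)
    (h : ¬ IsMain G lam Δ (k * w) x) : k ≤ base G lam Δ w x := by
  classical
  exact Nat.le_findGreatest ((Nat.le_mul_of_pos_right _ hw).trans hk) (Or.inr ⟨hk, h⟩)

theorem base_eq {x : V} {k : ℕ} (hw : 0 < w) (hk : k * w ≤ lam x)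
    (h : k = 0 ∨ ¬ IsMain G lam Δ (k * w) x)
    (h' : ∀ l, k < l → l * w ≤ lam x → IsMain G lam Δ (l * w) x) : base G lam Δ w x = k := by
  apply le_antisymm
  · by_contra hcon
    rcases base_spec (G := G) (lam := lam) (Δ := Δ) (w := w) x with h0 | h0
    · omega
    · exact h0 (h' _ (by omega) (base_mul_le x))
  · rcases h with rfl | h
    · exact Nat.zero_le _
    · exact le_base hw hk h

theorem mem_blk (x : V) : x ∈ (blk G lam Δ w x).2 := mem_node_self (base_mul_le x)

theorem isMain_of_base_lt {x : V} {k : ℕ} (hw : 0 < w) (hk : k * w ≤ lam x)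
    (h : base G lam Δ w x < k) : IsMain G lam Δ (k * w) x := by
  by_contra hcon
  have := le_base hw hk hcon
  omega

/-- The vertex `q` lies above a narrow component, at height `k * w`, in the block `b`. -/
structure Hang (G : SimpleGraph V) (lam : V → ℕ) (Δ w : ℕ) (b : ℕ × Set V) (k : ℕ) (q : V) :
    Prop where
  mem : q ∈ b.2
  lt : b.1 < k
  le : k * w ≤ lam q
  not_isMain : ¬ IsMain G lam Δ (k * w) q
  isMain : ∀ l, b.1 < l → l < k → IsMain G lam Δ (l * w) q

/-- A connected piece of the body above the lower level of the zone lies either inside the upper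
part or outside it. In the latter case it meets no zone. -/
theorem Parts.part_eq_of_joinedIn_body {P : Set (ℕ × Set V)} {cut : ℕ × Set V → ℕ}
    (h : Parts G lam K Δ w P cut) {i : ℕ × Set V} (hi : i ∈ P) {x y : V}
    (hxy : JoinedIn G (body G lam Δ w i.1 i.2 ∩ {u | cut i + K ≤ lam u}) x y) :
    part G lam K Δ w P cut x = part G lam K Δ w P cut y := by
  by_cases hx : x ∈ upper G lam Δ w i.1 i.2 (cut i + K)
  · exact h.part_eq_of_upper hi (joinedIn_upper hxy hx)
  · refine Parts.part_eq_of_joinedIn (JoinedIn.mono (hxy.inter (T := (upper G lam Δ w i.1 i.2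
      (cut i + K))ᶜ) hx fun a b ha ha' hab hb hb' => ha' ?_)
      fun z hz => h.lower_subset_compl hi ⟨hz.1.1, hz.2⟩)
    exact mem_upper_of_joinedIn (JoinedIn.of_adj hab.symm hb ha) hb'

namespace Cuttable

variable (h : Cuttable G lam K Δ w)
include h

theorem w_pos : 0 < w := by have := h.one_le; have := h.width; omega

/-- For heights k < l in one block, the node of a window at height l lies in wide nodes at height k
+ 1 whenever it meets the window at height k, and the body there omits these. So bodies at different
heights are disjoint. -/
theorem parts (v : V) :
    Parts G lam K Δ w (windows G lam Δ w (blk G lam Δ w v)) (cutOf G lam K Δ w) := by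
  refine ⟨h.level, h.one_le, ?_, ?_, ?_⟩
  · rintro _ ⟨k, v, -, -, -, -, rfl⟩
    exact ⟨v, rfl⟩
  · rintro _ ⟨k, v, -, -, -, -, rfl⟩
    have hex := h.exists_cut k v
    rw [cutOf, dif_pos hex]
    exact hex.choose_spec
  · have key : ∀ k l u v x, k < l → IsMain G lam Δ ((k + 1) * w) u →
        x ∈ body G lam Δ w (k * w) (node G lam (k * w) v) → x ∉ node G lam (l * w) u := by
      intro k l u v x hkl hm hx hxu
      refine hx.2 ?_
      rw [show k * w + w = (k + 1) * w by ring]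
      exact (isMain_congr (node_subset (Nat.mul_le_mul_right w hkl) u hxu)).2 hm
    rintro _ ⟨k, u, hk, -, -, hu, rfl⟩ _ ⟨l, u', hl, -, -, hu', rfl⟩ x hx hx'
    rcases lt_trichotomy k l with hkl | rfl | hkl
    · exact absurd hx'.1 (key k l u' u x hkl (hu' _ (by omega) hkl) hx)
    · exact Prod.ext rfl ((node_eq hx.1).symm.trans (node_eq hx'.1))
    · exact absurd hx.1 (key l k u u' x hkl (hu _ (by omega) hkl) hx')

omit h in
theorem blk_snd_eq {v x : V} (hx : x ∈ (blk G lam Δ w v).2) :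
    (blk G lam Δ w v).2 = node G lam ((blk G lam Δ w v).1 * w) x := (node_eq hx).symm

omit h in
theorem blk_spec {v x : V} (hx : x ∈ (blk G lam Δ w v).2) :
    (blk G lam Δ w v).1 = 0 ∨ ¬ IsMain G lam Δ ((blk G lam Δ w v).1 * w) x :=
  (base_spec v).imp id fun hv hx' => hv ((isMain_congr hx).1 hx')

omit h in
theorem le_of_mem_blk {v x : V} (hx : x ∈ (blk G lam Δ w v).2) :
    (blk G lam Δ w v).1 * w ≤ lam x := le_of_mem_node hx

theorem le_base_of_mem {x e : V} {k : ℕ} (he : k = 0 ∨ ¬ IsMain G lam Δ (k * w) e)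
    (hx : x ∈ node G lam (k * w) e) : k ≤ base G lam Δ w x := by
  rcases he with rfl | he
  · exact Nat.zero_le _
  · exact le_base h.w_pos (le_of_mem_node hx) fun hm => he ((isMain_congr hx).1 hm)

theorem le_base_of_mem_blk {v x : V} (hx : x ∈ (blk G lam Δ w v).2) :
    (blk G lam Δ w v).1 ≤ base G lam Δ w x := h.le_base_of_mem (base_spec v) hx

omit h in
theorem blk_eq_of_base_eq {v x : V} (hx : x ∈ (blk G lam Δ w v).2)
    (hb : base G lam Δ w x = (blk G lam Δ w v).1) : blk G lam Δ w x = blk G lam Δ w v := by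
  refine Prod.ext hb ?_
  rw [blk_snd_eq hx, ← hb]
  rfl

omit h in
theorem mem_node_of_blk_eq {x y : V} (hxy : blk G lam Δ w x = blk G lam Δ w y) :
    y ∈ node G lam (base G lam Δ w x * w) x := by
  have := mem_blk (G := G) (lam := lam) (Δ := Δ) (w := w) y
  rwa [← hxy] at this

/-- A narrow node is a union of fibres of `blk`, so walks in the quotient can enter and leave it
only along edges of G. -/
theorem mem_of_blk_eq {x y e : V} {k : ℕ} (he : k = 0 ∨ ¬ IsMain G lam Δ (k * w) e)
    (hxy : blk G lam Δ w x = blk G lam Δ w y) (hx : x ∈ node G lam (k * w) e) :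
    y ∈ node G lam (k * w) e := by
  rw [← node_eq hx]
  exact node_subset (Nat.mul_le_mul_right w (h.le_base_of_mem he hx)) x (mem_node_of_blk_eq hxy)

theorem of_mem_zones {v x : V}
    (hx : x ∈ zones G lam K Δ w (windows G lam Δ w (blk G lam Δ w v)) (cutOf G lam K Δ w)) :
    x ∈ (blk G lam Δ w v).2 ∧ (blk G lam Δ w v).1 * w < lam x := by
  obtain ⟨i, hi, hxi⟩ := hx
  have hlev := (h.parts v).levels hi
  have hK := h.one_le
  have hxl := le_of_mem_upper hxi.1
  obtain ⟨k, u, hk, hu, -, -, rfl⟩ := hi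
  have hk' := Nat.mul_le_mul_right w hk
  refine ⟨?_, by simp only at hlev; omega⟩
  rw [blk_snd_eq hu]
  exact node_subset hk' u (upper_subset hxi.1).1.1

/-- Outside a block all vertices of a component are in the same part. -/
theorem label_eq_of_notMem {v x y : V} (hxy : G.Reachable x y)
    (hx : x ∉ (blk G lam Δ w v).2 ∨ lam x ≤ (blk G lam Δ w v).1 * w)
    (hy : y ∉ (blk G lam Δ w v).2 ∨ lam y ≤ (blk G lam Δ w v).1 * w) :
    label G lam K Δ w (blk G lam Δ w v) x = label G lam K Δ w (blk G lam Δ w v) y := by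
  have key : ∀ x, (x ∉ (blk G lam Δ w v).2 ∨ lam x ≤ (blk G lam Δ w v).1 * w) →
      ∃ r, lam r = 0 ∧ JoinedIn G
        (zones G lam K Δ w (windows G lam Δ w (blk G lam Δ w v)) (cutOf G lam K Δ w))ᶜ x r := by
    intro x hx
    obtain ⟨r, hr, hxr⟩ := h.level.exists_desc (Nat.zero_le (lam x))
    refine ⟨r, hr, hxr.joinedIn fun z hxz _ hz => ?_⟩
    obtain ⟨hzb, hzl⟩ := h.of_mem_zones hz
    rcases hx with hx | hx
    · refine hx ?_
      rw [blk_snd_eq hzb]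
      exact JoinedIn.symm (hxz.joinedIn fun y _ hy => hzl.le.trans hy.le)
    · have := hxz.le
      omega
  obtain ⟨r, hr, hxr⟩ := key x hx
  obtain ⟨r', hr', hyr⟩ := key y hy
  have : r = r' := h.level.root r r'
    ((hxr.reachable.symm.trans hxy).trans hyr.reachable) hr hr'
  subst this
  exact Parts.part_eq_of_joinedIn (hxr.trans hyr.symm)

section Hanging

variable {v q : V} {k : ℕ} (hq : Hang G lam Δ w (blk G lam Δ w v) k q)
include hq

omit h in
theorem hang_window :
    ((k - 1) * w, node G lam ((k - 1) * w) q) ∈ windows G lam Δ w (blk G lam Δ w v) ∧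
    (k - 1) * w + w = k * w := by
  have hk := hq.lt
  have e : (k - 1) * w + w = k * w := by
    conv_rhs => rw [← Nat.sub_add_cancel (show 1 ≤ k by omega)]
    ring
  have := hq.le
  exact ⟨⟨k - 1, q, by omega, hq.mem, by omega, fun l hl hl' => hq.isMain l hl (by omega), rfl⟩, e⟩

/-- This is why hanging nodes do no harm: such a node lies in the body of the window below it and
above the cut there, where connected sets stay in one part. -/
theorem hang_mem {x : V} (hx : x ∈ node G lam (k * w) q) :
    x ∈ body G lam Δ w ((k - 1) * w) (node G lam ((k - 1) * w) q) ∩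
      {u | cutOf G lam K Δ w ((k - 1) * w, node G lam ((k - 1) * w) q) + K ≤ lam u} := by
  obtain ⟨hi, e⟩ := hang_window hq
  have hlev := ((h.parts v).levels hi).2
  have hxl := le_of_mem_node hx
  refine ⟨⟨node_subset (by omega) q hx, fun hm => hq.not_isMain ?_⟩, ?_⟩
  · rw [e] at hm
    exact (isMain_congr hx).1 hm
  · have hK := h.one_le
    simp only [Set.mem_ofPred_eq] at hlev ⊢
    omega

theorem label_eq_of_mem_hang {x : V} (hx : x ∈ node G lam (k * w) q) :
    label G lam K Δ w (blk G lam Δ w v) x = label G lam K Δ w (blk G lam Δ w v) q := by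
  refine (h.parts v).part_eq_of_joinedIn_body (hang_window hq).1 (JoinedIn.mono
    (S := node G lam (k * w) q) ?_ fun z hz => h.hang_mem hq hz)
  exact (comp_connected (mem_node_self hq.le) hx).symm

theorem blk_ne_of_mem_hang {x : V} (hx : x ∈ node G lam (k * w) q) :
    blk G lam Δ w x ≠ blk G lam Δ w v := by
  intro e
  have h1 := h.le_base_of_mem (Or.inr hq.not_isMain) hx
  have h2 : base G lam Δ w x = (blk G lam Δ w v).1 := congrArg Prod.fst e
  have := hq.lt
  omega

/-- A hanging node is thus attached to a single class of the block: its neighbours below it are in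
the block itself and carry the label of the node. -/
theorem label_eq_of_adj_hang {a c : V} (ha : a ∈ node G lam (k * w) q)
    (hc : c ∉ node G lam (k * w) q) (hac : G.Adj a c) :
    blk G lam Δ w c = blk G lam Δ w v ∧
    label G lam K Δ w (blk G lam Δ w v) c = label G lam K Δ w (blk G lam Δ w v) q := by
  obtain ⟨hi, e⟩ := hang_window hq
  have hlev := ((h.parts v).levels hi).2
  have hK := h.one_le
  have hal := le_of_mem_node ha
  have hcl : lam c < k * w := by
    by_contra hcon
    exact hc (mem_node_of_adj ha hac (by omega))
  have hacl := h.level.adj c a hac.symm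
  have hnode : ∀ l, l < k → l * w ≤ lam c ∧ c ∈ node G lam (l * w) q := by
    intro l hl
    have h1 : l * w ≤ (k - 1) * w := Nat.mul_le_mul_right w (by omega)
    have h2 := h.w_pos
    have h3 : l * w ≤ lam c := by omega
    exact ⟨h3, mem_node_of_adj (node_subset (Nat.mul_le_mul_right w hl.le) q ha) hac h3⟩
  have hcb : c ∈ (blk G lam Δ w v).2 := by
    rw [blk_snd_eq hq.mem]
    exact (hnode _ hq.lt).2
  refine ⟨blk_eq_of_base_eq hcb (base_eq h.w_pos (hnode _ hq.lt).1 (blk_spec hcb) ?_), ?_⟩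
  · intro l hl hlc
    have hlk : l < k := Nat.lt_of_mul_lt_mul_right (hlc.trans_lt hcl)
    exact (isMain_congr (hnode l hlk).2).2 (hq.isMain l hl hlk)
  · rw [← h.label_eq_of_mem_hang hq ha]
    refine (h.parts v).part_eq_of_joinedIn_body hi (JoinedIn.of_adj hac.symm ⟨⟨?_, ?_⟩, ?_⟩
      (h.hang_mem hq ha))
    · exact (hnode (k - 1) (by have := hq.lt; omega)).2
    · intro hm
      have := hm.le
      simp only at this
      omega
    · simp only [Set.mem_ofPred_eq] at hlev ⊢
      omega

end Hanging

/-- The node sought is the lowest narrow one above the bottom of the block that contains q. -/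
theorem exists_hang {v q : V} (hq : q ∈ (blk G lam Δ w v).2)
    (hne : blk G lam Δ w q ≠ blk G lam Δ w v) : ∃ k, Hang G lam Δ w (blk G lam Δ w v) k q := by
  classical
  have h1 := h.le_base_of_mem_blk hq
  have h2 : (blk G lam Δ w v).1 < base G lam Δ w q :=
    lt_of_le_of_ne h1 fun e => hne (blk_eq_of_base_eq hq e.symm)
  have hex : ∃ k, (blk G lam Δ w v).1 < k ∧ k * w ≤ lam q ∧ ¬ IsMain G lam Δ (k * w) q :=
    ⟨_, h2, base_mul_le q, (base_spec q).resolve_left (by omega)⟩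
  refine ⟨Nat.find hex, hq, (Nat.find_spec hex).1, (Nat.find_spec hex).2.1,
    (Nat.find_spec hex).2.2, fun l hl hl' => ?_⟩
  by_contra hcon
  exact Nat.find_min hex hl' ⟨hl, (Nat.mul_le_mul_right w hl'.le).trans (Nat.find_spec hex).2.1, hcon⟩

/-- The partition by `proj` refines the parts of every block. -/
theorem label_eq_of_proj_eq (v : V) {x y : V} (hxy : proj G lam K Δ w x = proj G lam K Δ w y) :
    label G lam K Δ w (blk G lam Δ w v) x = label G lam K Δ w (blk G lam Δ w v) y := by
  have hb : blk G lam Δ w x = blk G lam Δ w y := congrArg Prod.fst hxy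
  have hyx := mem_node_of_blk_eq hb
  by_cases hx : x ∈ (blk G lam Δ w v).2
  · by_cases hbx : blk G lam Δ w x = blk G lam Δ w v
    · have := congrArg Prod.snd hxy
      simp only [proj, ← hb] at this
      rwa [hbx] at this
    · obtain ⟨k, hk⟩ := h.exists_hang hx hbx
      exact (h.label_eq_of_mem_hang hk (h.mem_of_blk_eq (Or.inr hk.not_isMain) hb
        (mem_node_self hk.le))).symm
  · have hy : y ∉ (blk G lam Δ w v).2 := fun hy => hx (h.mem_of_blk_eq (base_spec v) hb.symm hy)
    exact h.label_eq_of_notMem (JoinedIn.reachable hyx) (Or.inl hx) (Or.inl hy)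

section Crossing

variable {v c d c' d' : V} (hc : c ∈ (blk G lam Δ w v).2) (hd : d ∉ (blk G lam Δ w v).2)
  (hcd : G.Adj c d) (hc' : c' ∈ (blk G lam Δ w v).2) (hd' : d' ∉ (blk G lam Δ w v).2)
  (hcd' : G.Adj c' d')
include hc hd hcd

omit h in
theorem lt_of_crossing : lam d < (blk G lam Δ w v).1 * w := by
  by_contra hcon
  exact hd (mem_node_of_adj hc hcd (not_lt.1 hcon))

theorem top_of_crossing :
    lam c = (blk G lam Δ w v).1 * w ∧ blk G lam Δ w c = blk G lam Δ w v := by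
  have h1 := lt_of_crossing hc hd hcd
  have h2 := h.level.adj d c hcd.symm
  have h3 := le_of_mem_blk hc
  have e : lam c = (blk G lam Δ w v).1 * w := by omega
  refine ⟨e, blk_eq_of_base_eq hc (le_antisymm ?_ (h.le_base_of_mem_blk hc))⟩
  have h4 := base_mul_le (G := G) (lam := lam) (Δ := Δ) (w := w) c
  rw [e] at h4
  exact Nat.le_of_mul_le_mul_right h4 h.w_pos

/-- Seen from the block of d, the whole node of the block above is a hanging narrow node. -/
theorem hang_of_crossing : Hang G lam Δ w (blk G lam Δ w d) (blk G lam Δ w v).1 c := by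
  have h1 := lt_of_crossing hc hd hcd
  have h2 := base_mul_le (G := G) (lam := lam) (Δ := Δ) (w := w) d
  have h3 := le_of_mem_blk hc
  have h4 := h.level.adj d c hcd.symm
  have hlt : base G lam Δ w d < (blk G lam Δ w v).1 :=
    Nat.lt_of_mul_lt_mul_right (h2.trans_lt h1)
  refine ⟨mem_node_of_adj (mem_blk d) hcd.symm (h2.trans (h1.le.trans h3)), hlt, h3,
    (blk_spec hc).resolve_left (by omega), fun l hl hlk => ?_⟩
  have h5 : l * w + w ≤ (blk G lam Δ w v).1 * w := by
    rw [← Nat.succ_mul]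
    exact Nat.mul_le_mul_right w hlk
  have h6 := h.w_pos
  have h7 : l * w ≤ lam d := by omega
  exact (isMain_congr (mem_node_of_adj (mem_node_self h7) hcd.symm (by omega))).2
    (isMain_of_base_lt h.w_pos h7 hl)

include hc' hd' hcd'

/-- The vertices at the bottom of a block with neighbours below it are in the same part, and so
are these neighbours. -/
theorem proj_eq_of_crossing :
    proj G lam K Δ w c = proj G lam K Δ w c' ∧ proj G lam K Δ w d = proj G lam K Δ w d' := by
  obtain ⟨h1, h2⟩ := h.top_of_crossing hc hd hcd
  obtain ⟨h1', h2'⟩ := h.top_of_crossing hc' hd' hcd'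
  constructor
  · refine Prod.ext (h2.trans h2'.symm) ?_
    simp only [proj, h2, h2']
    refine h.label_eq_of_notMem ?_ (Or.inr h1.le) (Or.inr h1'.le)
    rw [blk_snd_eq hc] at hc'
    exact JoinedIn.reachable hc'
  · have hh := h.hang_of_crossing hc hd hcd
    rw [blk_snd_eq hc] at hc' hd hd'
    obtain ⟨e1, e2⟩ := h.label_eq_of_adj_hang hh (mem_node_self hh.le) hd hcd
    obtain ⟨e3, e4⟩ := h.label_eq_of_adj_hang hh hc' hd' hcd'
    refine Prod.ext e3.symm ?_
    simp only [proj, e3]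
    exact e2.trans e4.symm

end Crossing

end Cuttable

end Blocks

/-! ### Quotients by fibres, and the absence of bridges in K_{2,t}. -/

section Quotients

variable {V β : Type*} (G : SimpleGraph V) (p : V → β)

/-- The quotient of a graph by the fibres of a map. -/
def quot : SimpleGraph (Set.range p) where
  Adj X Y := X ≠ Y ∧ ∃ x y, p x = X ∧ p y = Y ∧ G.Adj x y
  symm := ⟨fun _ _ ⟨hne, x, y, hx, hy, h⟩ => ⟨hne.symm, y, x, hy, hx, h.symm⟩⟩
  loopless := ⟨fun _ h => h.1 rfl⟩

/-- Steps inside `Q` along edges or inside a fibre. -/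
def QuotStep (Q : Set V) (a b : V) : Prop := b ∈ Q ∧ (G.Adj a b ∨ p a = p b)

variable {G p}

theorem exists_of_isMinor_quot {t : ℕ} (h : IsMinor (K2 t) (quot G p)) :
    ∃ Q : Fin 2 ⊕ Fin t → Set V, (∀ a, (Q a).Nonempty) ∧
      (∀ a x y, p x = p y → x ∈ Q a → y ∈ Q a) ∧
      (∀ a, ∀ x ∈ Q a, ∀ y ∈ Q a, Relation.ReflTransGen (QuotStep G p (Q a)) x y) ∧
      (∀ a b x, x ∈ Q a → x ∈ Q b → a = b) ∧
      ∀ i k, ∃ x ∈ Q (.inl i), ∃ y ∈ Q (.inr k), G.Adj x y := by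
  obtain ⟨S, hS, hd, hadj⟩ := exists_sets_of_isMinor h
  refine ⟨fun a => {x | (⟨p x, x, rfl⟩ : Set.range p) ∈ S a}, ?_, ?_, ?_, ?_, ?_⟩
  · intro a
    obtain ⟨⟨⟨_, x, rfl⟩, hx⟩, -⟩ := hS a
    exact ⟨x, hx⟩
  · intro a x y hxy hx
    simp only [Set.mem_ofPred_eq, hxy] at hx ⊢
    exact hx
  · intro a x hx y hy
    have key : ∀ Y, JoinedIn (quot G p) (S a) ⟨p x, x, rfl⟩ Y → ∀ y, p y = Y →
        Relation.ReflTransGen (QuotStep G p {x | (⟨p x, x, rfl⟩ : Set.range p) ∈ S a}) x y := by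
      intro Y hY
      refine hY.induction (P := fun Y : Set.range p => ∀ y, p y = Y →
        Relation.ReflTransGen (QuotStep G p {x | (⟨p x, x, rfl⟩ : Set.range p) ∈ S a}) x y) ?_ ?_
      · intro y hy
        refine .single ⟨?_, Or.inr hy.symm⟩
        simp only [Set.mem_ofPred_eq, hy]
        exact hx
      · rintro A B hA ⟨-, c, d, hc, hd, hcd⟩ hB ih y hy
        refine ((ih c hc).tail (b := c) (c := d) ⟨?_, Or.inl hcd⟩).tail ⟨?_, Or.inr (hd.trans hy.symm)⟩
        · simp only [Set.mem_ofPred_eq, hd]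
          exact hB
        · simp only [Set.mem_ofPred_eq, hy]
          exact hB
    exact key _ ((hS a).2 _ hx _ hy) y rfl
  · intro a b x hxa hxb
    by_contra hab
    exact Set.disjoint_left.1 (hd a b hab) hxa hxb
  · intro i k
    obtain ⟨X, hX, Y, hY, -, x, y, hx, hy, hxy⟩ := hadj i k
    refine ⟨x, ?_, y, ?_, hxy⟩
    · simp only [Set.mem_ofPred_eq, hx]
      exact hX
    · simp only [Set.mem_ofPred_eq, hy]
      exact hY

/-- E is a union of fibres, so only an edge of G can lead out of it. -/
theorem QuotStep.exists_exit {Q E : Set V} (hE : ∀ x y, p x = p y → x ∈ E → y ∈ E) {x y : V}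
    (h : Relation.ReflTransGen (QuotStep G p Q) x y) (hx : x ∈ Q) (hxE : x ∈ E) (hyE : y ∉ E) :
    ∃ c ∈ Q, ∃ d ∈ Q, c ∈ E ∧ d ∉ E ∧ G.Adj c d := by
  have key : ∀ y, Relation.ReflTransGen (QuotStep G p Q) x y →
      y ∈ Q ∧ (y ∉ E → ∃ c ∈ Q, ∃ d ∈ Q, c ∈ E ∧ d ∉ E ∧ G.Adj c d) := by
    intro y h
    induction h with
    | refl => exact ⟨hx, fun h => absurd hxE h⟩
    | @tail a b _ hab ih =>
      refine ⟨hab.1, fun hb => ?_⟩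
      by_cases ha : a ∈ E
      · rcases hab.2 with hadj | e
        · exact ⟨a, ih.1, b, hab.1, ha, hb, hadj⟩
        · exact absurd (hE a b e ha) hb
      · exact ih.2 ha
  exact (key y h).2 hyE

end Quotients

/-- In a two-sided labelling of the vertices of `K2 t`, not all changes of label can be confined
to one pair. -/
theorem not_in_out {t : ℕ} (ht : 2 ≤ t) {A B : Fin 2 ⊕ Fin t → Prop}
    {C : Fin 2 ⊕ Fin t → Fin 2 ⊕ Fin t → Prop} (hAB : ∀ x, A x ∨ B x)
    (hself : ∀ x, A x → B x → C x x)
    (hadj : ∀ x y, (K2 t).Adj x y → A x → B y → ¬ B x → ¬ A y → C x y)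
    (huniq : ∀ x y x' y', C x y → C x' y' → x = x' ∧ y = y')
    {x y : Fin 2 ⊕ Fin t} (hx : ¬ B x) (hy : ¬ A y) : False := by
  have hxy : x ≠ y := by
    rintro rfl
    exact (hAB x).elim hy hx
  have hA := (hAB x).resolve_right hx
  have hB := (hAB y).resolve_left hy
  -- a common neighbour yields a pair in `C` containing it
  have common : ∀ z, (K2 t).Adj x z → (K2 t).Adj z y → C x z ∨ C z z ∨ C z y := by
    intro z h1 h2
    by_cases hzA : A z
    · by_cases hzB : B z
      · exact Or.inr (Or.inl (hself z hzA hzB))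
      · exact Or.inr (Or.inr (hadj z y h2 hzA hB hzB hy))
    · exact Or.inl (hadj x z h1 hA ((hAB z).resolve_left hzA) hx hzA)
  have two : ∀ z z', z ≠ z' → (K2 t).Adj x z → (K2 t).Adj z y → (K2 t).Adj x z' →
      (K2 t).Adj z' y → False := by
    intro z z' hne h1 h2 h3 h4
    have n1 := h1.ne
    have n3 := h3.ne
    rcases common z h1 h2 with c | c | c <;> rcases common z' h3 h4 with c' | c' | c' <;>
      obtain ⟨e1, e2⟩ := huniq _ _ _ _ c c' <;>
      (first | exact hne e1 | exact hne e2 | exact n3 e1 | exact n1 e1.symm)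
  have opp : ∀ z z', (K2 t).Adj x y → (K2 t).Adj x z → (K2 t).Adj z z' → (K2 t).Adj z' y →
      z ≠ y → z' ≠ x → False := by
    intro z z' h0 h1 h2 h3 hzy hzx
    have c := hadj x y h0 hA hB hx hy
    have hz : ¬ B z := fun hzB => by
      by_cases hzA : A z
      · exact hzy (huniq _ _ _ _ (hself z hzA hzB) c).2
      · exact hzy (huniq _ _ _ _ (hadj x z h1 hA hzB hx hzA) c).2
    have hzA := (hAB z).resolve_right hz
    have hz' : ¬ B z' := fun hzB => by
      by_cases hzA' : A z'
      · exact hzx (huniq _ _ _ _ (hself z' hzA' hzB) c).1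
      · exact h1.ne (huniq _ _ _ _ (hadj z z' h2 hzA hzB hz hzA') c).1.symm
    exact hzx (huniq _ _ _ _ (hadj z' y h3 ((hAB z').resolve_right hz') hB hz' hy) c).1
  have harm : ∀ k : Fin t, ∃ l, l ≠ k := fun k => by
    have : Nontrivial (Fin t) := Fin.nontrivial_iff_two_le.2 ht
    exact exists_ne k
  have hhub : ∀ i : Fin 2, ∃ j, j ≠ i := fun i => exists_ne i
  have n01 : (0 : Fin 2) ≠ 1 := by decide
  -- Any two vertices lie on a common 4-cycle, as t ≥ 2. Both arcs between x and y change the label,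
  -- which needs two different pairs.
  rcases x with i | k <;> rcases y with j | l
  · obtain ⟨k', hk'⟩ := harm ⟨0, by omega⟩
    exact two (.inr ⟨0, by omega⟩) (.inr k') (fun e => hk' (Sum.inr_injective e).symm)
      (by simp) (by simp) (by simp) (by simp)
  · obtain ⟨k', hk'⟩ := harm l
    obtain ⟨j', hj'⟩ := hhub i
    exact opp (.inr k') (.inl j') (by simp) (by simp) (by simp) (by simp)
      (fun e => hk' (Sum.inr_injective e)) (fun e => hj' (Sum.inl_injective e))
  · obtain ⟨k', hk'⟩ := harm k
    obtain ⟨j', hj'⟩ := hhub j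
    exact opp (.inl j') (.inr k') (by simp) (by simp) (by simp) (by simp)
      (fun e => hj' (Sum.inl_injective e)) (fun e => hk' (Sum.inr_injective e))
  · exact two (.inl 0) (.inl 1) (fun e => n01 (Sum.inl_injective e))
      (by simp) (by simp) (by simp) (by simp)

/-! ### Confining a model to one block. -/

section Blocks

variable {V : Type*} {G : SimpleGraph V} {lam : V → ℕ} {K Δ w : ℕ}

/-- A model of `K2 t` in the quotient by `proj` yields a fat model. -/
theorem Cuttable.isFatMinor (h : Cuttable G lam K Δ w) {t : ℕ} (ht : 2 ≤ t)
    (hm : IsMinor (K2 t) (quot G (proj G lam K Δ w))) : IsFatMinor K (K2 t) G := by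
  obtain ⟨Q, hne, hsat, hconn, hdis, hadj⟩ := exists_of_isMinor_quot hm
  have hreach : ∀ a, ∀ x ∈ Q a, ∀ y ∈ Q a, G.Reachable x y := by
    intro a x hx y hy
    have hxy := hconn a x hx y hy
    clear hy
    induction hxy with
    | refl => rfl
    | tail _ hab ih =>
      refine ih.trans ?_
      rcases hab.2 with hadj | e
      · exact hadj.reachable
      · exact JoinedIn.reachable (mem_node_of_blk_eq (congrArg Prod.fst e))
  have hreach₂ : ∀ i k, ∀ x ∈ Q (.inl i), ∀ y ∈ Q (.inr k), G.Reachable x y := by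
    intro i k x hx y hy
    obtain ⟨x', hx', y', hy', hxy⟩ := hadj i k
    exact ((hreach _ x hx x' hx').trans hxy.reachable).trans (hreach _ y' hy' y hy)
  have hreach' : ∀ a b, ∀ x ∈ Q a, ∀ y ∈ Q b, G.Reachable x y := by
    rintro (i | k) (j | l) x hx y hy
    · obtain ⟨z, hz⟩ := hne (.inr ⟨0, by omega⟩)
      exact (hreach₂ i _ x hx z hz).trans (hreach₂ j _ y hy z hz).symm
    · exact hreach₂ i l x hx y hy
    · exact (hreach₂ j k y hy x hx).symm
    · obtain ⟨z, hz⟩ := hne (.inl 0)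
      exact (hreach₂ 0 k z hz x hx).symm.trans (hreach₂ 0 l z hz y hy)
  -- the vertices of lowest base
  have hmin : ∀ a, ∃ x ∈ Q a, ∀ y ∈ Q a, base G lam Δ w x ≤ base G lam Δ w y := by
    intro a
    obtain ⟨x, hx, hmin⟩ := exists_minimalFor_of_wellFoundedLT (· ∈ Q a) (base G lam Δ w) (hne a)
    exact ⟨x, hx, fun y hy => (le_total _ _).elim id (hmin hy)⟩
  choose m hmQ hm using hmin
  -- Take the branch set whose lowest base is highest. It lies in the node of its block v, since
  -- crossing out of this node would lower the base. As the crossing edges form a single edge of the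
  -- quotient, no branch set can avoid the node, and by maximality each contains a vertex of the
  -- block itself.
  obtain ⟨s, hs⟩ := Finite.exists_max fun a => base G lam Δ w (m a)
  set v := m s with hv
  have hEsat : ∀ x y, proj G lam K Δ w x = proj G lam K Δ w y → x ∈ (blk G lam Δ w v).2 →
      y ∈ (blk G lam Δ w v).2 := fun x y e => h.mem_of_blk_eq (base_spec v) (congrArg Prod.fst e)
  let A : Fin 2 ⊕ Fin t → Prop := fun a => ∃ x ∈ Q a, x ∈ (blk G lam Δ w v).2
  let B : Fin 2 ⊕ Fin t → Prop := fun a => ∃ x ∈ Q a, x ∉ (blk G lam Δ w v).2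
  let C : Fin 2 ⊕ Fin t → Fin 2 ⊕ Fin t → Prop := fun a b => ∃ c ∈ Q a, ∃ d ∈ Q b,
    c ∈ (blk G lam Δ w v).2 ∧ d ∉ (blk G lam Δ w v).2 ∧ G.Adj c d
  have hself : ∀ a, A a → B a → C a a := by
    rintro a ⟨x, hx, hxb⟩ ⟨y, hy, hyb⟩
    exact QuotStep.exists_exit hEsat (hconn a x hx y hy) hx hxb hyb
  have hsB : ¬ B s := by
    intro hB
    obtain ⟨c, -, d, hd, hcb, hdb, hcd⟩ := hself s ⟨v, hmQ s, mem_blk v⟩ hB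
    have h1 := Cuttable.lt_of_crossing hcb hdb hcd
    have h2 := (Nat.mul_le_mul_right w (hm s d hd)).trans (base_mul_le d)
    exact absurd h1 (not_lt.2 h2)
  have hA : ∀ a, A a := by
    intro a
    by_contra ha
    refine not_in_out ht (A := A) (B := B) (C := C) ?_ hself ?_ ?_ hsB ha
    · intro a
      obtain ⟨x, hx⟩ := hne a
      by_cases hxb : x ∈ (blk G lam Δ w v).2
      exacts [Or.inl ⟨x, hx, hxb⟩, Or.inr ⟨x, hx, hxb⟩]
    · intro a b hab _ _ haB hbA
      have hex : ∃ x ∈ Q a, ∃ y ∈ Q b, G.Adj x y := by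
        rcases a with i | k <;> rcases b with j | l
        · simp at hab
        · exact hadj i l
        · obtain ⟨x, hx, y, hy, hxy⟩ := hadj j k
          exact ⟨y, hy, x, hx, hxy.symm⟩
        · simp at hab
      obtain ⟨x, hx, y, hy, hxy⟩ := hex
      exact ⟨x, hx, y, hy, by_contra fun hcon => haB ⟨x, hx, hcon⟩,
        fun hcon => hbA ⟨y, hy, hcon⟩, hxy⟩
    · rintro a b a' b' ⟨c, hc, d, hd, h1, h2, h3⟩ ⟨c', hc', d', hd', h1', h2', h3'⟩
      obtain ⟨e1, e2⟩ := h.proj_eq_of_crossing h1 h2 h3 h1' h2' h3'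
      exact ⟨hdis a a' c' (hsat a c c' e1 hc) hc', hdis b b' d' (hsat b d d' e2 hd) hd'⟩
  have hblk : ∀ a, ∃ x ∈ Q a, blk G lam Δ w x = blk G lam Δ w v := by
    intro a
    by_cases hB : B a
    · obtain ⟨c, hc, d, -, hcb, hdb, hcd⟩ := hself a (hA a) hB
      exact ⟨c, hc, (h.top_of_crossing hcb hdb hcd).2⟩
    · have hma : m a ∈ (blk G lam Δ w v).2 := by_contra fun hcon => hB ⟨m a, hmQ a, hcon⟩
      exact ⟨m a, hmQ a, Cuttable.blk_eq_of_base_eq hma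
        (le_antisymm (hs a) (h.le_base_of_mem_blk hma))⟩
  -- A vertex outside the block can be moved within its branch set, without changing its label, to
  -- the place where its surroundings are attached to the block. Hence equal labels in two branch
  -- sets would give a common class.
  have hrep : ∀ a, ∀ q ∈ Q a, ∃ q' ∈ Q a, blk G lam Δ w q' = blk G lam Δ w v ∧
      label G lam K Δ w (blk G lam Δ w v) q' = label G lam K Δ w (blk G lam Δ w v) q := by
    intro a q hq
    by_cases hqb : q ∈ (blk G lam Δ w v).2
    · by_cases hqv : blk G lam Δ w q = blk G lam Δ w v
      · exact ⟨q, hq, hqv, rfl⟩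
      · obtain ⟨k, hk⟩ := h.exists_hang hqb hqv
        obtain ⟨x, hx, hxv⟩ := hblk a
        obtain ⟨c, -, d, hd, hcE, hdE, hcd⟩ := QuotStep.exists_exit (E := node G lam (k * w) q)
          (fun x y e => h.mem_of_blk_eq (Or.inr hk.not_isMain) (congrArg Prod.fst e))
          (hconn a q hq x hx) hq (mem_node_self hk.le) (fun hcon => h.blk_ne_of_mem_hang hk hcon hxv)
        obtain ⟨e1, e2⟩ := h.label_eq_of_adj_hang hk hcE hdE hcd
        exact ⟨d, hd, e1, e2⟩
    · obtain ⟨c, hc, d, -, hcb, hdb, hcd⟩ := hself a (hA a) ⟨q, hq, hqb⟩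
      obtain ⟨e1, e2⟩ := h.top_of_crossing hcb hdb hcd
      exact ⟨c, hc, e2, h.label_eq_of_notMem (hreach a c hc q hq) (Or.inr e1.le) (Or.inl hqb)⟩
  refine (h.parts v).isFatMinor Q (fun a => ?_) (fun a b hab q hq q' hq' e => hab ?_) hadj
  · obtain ⟨q₀, hq₀⟩ := hne a
    refine ⟨q₀, hq₀, fun q hq => Relation.ReflTransGen.mono (fun x y hxy => ⟨hxy.1, ?_⟩) _ _
      (hconn a q₀ hq₀ q hq)⟩
    exact hxy.2.imp id fun e => h.label_eq_of_proj_eq v e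
  · obtain ⟨x, hx, hxv, hxq⟩ := hrep a q hq
    obtain ⟨y, hy, hyv, hyq⟩ := hrep b q' hq'
    have e' : proj G lam K Δ w x = proj G lam K Δ w y := by
      refine Prod.ext (hxv.trans hyv.symm) ?_
      simp only [proj, hxv, hyv]
      exact hxq.trans (Eq.trans e hyq.symm)
    exact hdis a b y (hsat a x y e' hx) hy

end Blocks

/-! ### Shortcuts past narrow nodes. -/

section Chains

variable {V : Type*} {G : SimpleGraph V} {lam : V → ℕ} {Δ : ℕ}

/-- A walk in `S` that leaves `Ω` only for narrow components is replaced by a chain of short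
steps in `Ω`. -/
theorem chain_of_joinedIn {S Ω : Set V} (f : V → ℕ)
    (hf : ∀ a ∈ S, a ∉ Ω → f a ≤ lam a ∧ ¬ IsMain G lam Δ (f a) a)
    (hexit : ∀ a ∈ S, ∀ b ∈ S, G.Adj a b → a ∉ Ω → b ∈ Ω → lam a = f a)
    (hstay : ∀ a ∈ S, ∀ b ∈ S, G.Adj a b → a ∉ Ω → b ∉ Ω → f a = f b) {x y : V}
    (hx : x ∈ Ω) (hy : y ∈ Ω) (h : JoinedIn G S x y) :
    Relation.ReflTransGen (fun a b => b ∈ Ω ∧ Within G (Δ + 2) a b) x y := by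
  have key : (y ∈ Ω → Relation.ReflTransGen (fun a b => b ∈ Ω ∧ Within G (Δ + 2) a b) x y) ∧
      (y ∉ Ω → ∃ z z', Relation.ReflTransGen (fun a b => b ∈ Ω ∧ Within G (Δ + 2) a b) x z ∧
        G.Adj z z' ∧ lam z' = f y ∧ y ∈ node G lam (f y) z') := by
    refine h.induction (P := fun y => (y ∈ Ω →
      Relation.ReflTransGen (fun a b => b ∈ Ω ∧ Within G (Δ + 2) a b) x y) ∧
      (y ∉ Ω → ∃ z z', Relation.ReflTransGen (fun a b => b ∈ Ω ∧ Within G (Δ + 2) a b) x z ∧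
        G.Adj z z' ∧ lam z' = f y ∧ y ∈ node G lam (f y) z')) ⟨fun _ => .refl, fun h => absurd hx h⟩ ?_
    rintro a b ha hab hb ⟨ih, ih'⟩
    by_cases haΩ : a ∈ Ω
    · refine ⟨fun hbΩ => (ih haΩ).tail ⟨hbΩ, (Within.of_adj hab).mono (by omega)⟩, fun hbΩ => ?_⟩
      exact ⟨a, b, ih haΩ, hab, hexit b hb a ha.right_mem hab.symm hbΩ haΩ,
        mem_node_self (hf b hb hbΩ).1⟩
    · obtain ⟨z, z', hz, hzz', hl, hn⟩ := ih' haΩ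
      refine ⟨fun hbΩ => hz.tail ⟨hbΩ, ?_⟩, fun hbΩ => ?_⟩
      · have hla := hexit a ha.right_mem b hb hab haΩ hbΩ
        have hnm := (hf a ha.right_mem haΩ).2
        -- The excursion enters and leaves the narrow node at its bottom level, whose diameter is at
        -- most Δ; the two outer edges account for Δ + 2.
        have hd : Within G Δ z' a := by
          by_contra hcon
          refine hnm ((isMain_congr hn).2 ⟨z', mem_node_self hl.ge, a, hn, hl, hla, hcon⟩)
        exact (((Within.of_adj hzz').trans hd).trans (Within.of_adj hab)).mono (by omega)
      · have e := hstay a ha.right_mem b hb hab haΩ hbΩ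
        rw [e] at hl hn
        exact ⟨z, z', hz, hzz', hl, mem_node_of_adj hn hab (hf b hb hbΩ).1⟩
  exact key.1 hy

end Chains

/-! ### The diameters of the classes. -/

section Regions

variable {V : Type*} (G : SimpleGraph V) (lam : V → ℕ) (K Δ w : ℕ) (cut : ℕ × Set V → ℕ)

/-- The vertices of a window above level `a`, together with the vertices of the windows above it
that lie below the cut. -/
def region (j : ℕ × Set V) (a : ℕ) : Set V :=
  upper G lam Δ w j.1 j.2 a ∪ {x | x ∈ mains G lam Δ w j.1 j.2 ∧
    x ∈ lower G lam Δ w (j.1 + w) (node G lam (j.1 + w) x)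
      (cut (j.1 + w, node G lam (j.1 + w) x) + K)}

variable {G lam K Δ w cut}

theorem region_anti {j : ℕ × Set V} {a b : ℕ} (h : a ≤ b) :
    region G lam K Δ w cut j b ⊆ region G lam K Δ w cut j a :=
  Set.union_subset_union_left _ (upper_anti h)

theorem region_subset {j : ℕ × Set V} {a : ℕ} : region G lam K Δ w cut j a ⊆ j.2 := by
  rintro x (hx | hx)
  exacts [(upper_subset hx).1.1, hx.1.1]

namespace Cuttable

variable (h : Cuttable G lam K Δ w) {v x y : V} {j : ℕ × Set V}
  (hj : j ∈ windows G lam Δ w (blk G lam Δ w v))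

include hj in
theorem windows_succ (hx : x ∈ mains G lam Δ w j.1 j.2) :
    (j.1 + w, node G lam (j.1 + w) x) ∈ windows G lam Δ w (blk G lam Δ w v) := by
  obtain ⟨k, u, hk, hu, -, hm, rfl⟩ := hj
  have e : k * w + w = (k + 1) * w := by ring
  simp only [e]
  refine ⟨k + 1, x, by omega, ?_, ?_, fun l hl hlk => ?_, rfl⟩
  · rw [blk_snd_eq hu]
    exact node_subset (Nat.mul_le_mul_right w hk) u hx.1
  · rw [← e]
    exact hx.2.le
  · rcases hlk.eq_or_lt with rfl | hlk
    · rw [← e]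
      exact hx.2
    · exact (isMain_congr (node_subset (Nat.mul_le_mul_right w (by omega)) u hx.1)).2
        (hm l hl (by omega))

include h hj

/-- Zones fence the region off: its own zone from below, and those of the windows directly above
from above. Hence a part whose core is in the region reaches over two consecutive windows only,
apart from narrow nodes. -/
theorem mem_region_of_adj (hx : x ∈ region G lam K Δ w (cutOf G lam K Δ w) j
      (cutOf G lam K Δ w j + 2 * K)) (hxy : G.Adj x y)
    (hy : y ∉ zones G lam K Δ w (windows G lam Δ w (blk G lam Δ w v)) (cutOf G lam K Δ w)) :
    y ∈ region G lam K Δ w (cutOf G lam K Δ w) j (cutOf G lam K Δ w j + 2 * K) := by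
  have hp := h.parts v
  have hK := h.one_le
  have hlev := hp.levels hj
  obtain ⟨u, hu⟩ := hp.isNode j hj
  have hl1 := h.level.adj y x hxy.symm
  rcases hx with hx | ⟨hxm, hxl⟩
  · have hxa := le_of_mem_upper hx
    by_cases hyb : y ∈ body G lam Δ w j.1 j.2
    · rcases Parts.mem_upper_or_mem_lower hj hyb hy with hy' | hy'
      · exact Or.inl hy'
      · have := level_of_adj_upper h.level (upper_anti (by omega) hx) hy' hxy
        omega
    · have hyD : y ∈ j.2 := by
        rw [hu]
        exact mem_node_of_adj (hu ▸ (upper_subset hx).1.1) hxy (by omega)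
      have hym : y ∈ mains G lam Δ w j.1 j.2 := ⟨hyD, by_contra fun hcon => hyb ⟨hyD, hcon⟩⟩
      have hyl := (level_of_adj_mains h.level (upper_subset hx).1 hym hxy).2
      have hlev' := hp.levels (windows_succ hj hym)
      refine Or.inr ⟨hym, mem_lower_of_lt ⟨mem_node_self hyl.ge, fun hm => ?_⟩
        (by simp only at hlev'; omega)⟩
      have := hm.le
      have := h.w_pos
      omega
  · have hE := windows_succ hj hxm
    have hlev' := hp.levels hE
    have hxn := hxm.2.le
    simp only at hlev'
    by_cases hyE : y ∈ node G lam (j.1 + w) x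
    · have hyb : y ∈ body G lam Δ w (j.1 + w) (node G lam (j.1 + w) x) := by
        refine ⟨hyE, fun hm => hxl.2 ⟨x, y, JoinedIn.refl ⟨hxl.1, ?_⟩, ⟨hyE, hm⟩, hxy⟩⟩
        have := level_of_adj_mains h.level hxl.1 ⟨hyE, hm⟩ hxy
        show _ ≤ lam x
        omega
      refine Or.inr ⟨⟨?_, (isMain_congr hyE).2 hxm.2⟩, ?_⟩
      · have hxj := hxm.1
        rw [hu] at hxj ⊢
        rw [← node_eq hxj]
        exact node_subset (Nat.le_add_right _ _) x hyE
      · rw [node_eq hyE]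
        refine (Parts.mem_upper_or_mem_lower hE hyb hy).resolve_left fun hy' => ?_
        have h1 := le_of_mem_upper hy'
        have h2 := level_of_adj_upper h.level (upper_anti (by omega) hy') hxl hxy.symm
        omega
    · have hyl : lam y < j.1 + w := by
        by_contra hcon
        exact hyE (mem_node_of_adj (mem_node_self hxn) hxy (by omega))
      have hyD : y ∈ j.2 := by
        rw [hu]
        exact mem_node_of_adj (hu ▸ hxm.1) hxy (by omega)
      refine Or.inl ⟨y, x, JoinedIn.refl ⟨⟨hyD, fun hm => ?_⟩, ?_⟩, hxm, hxy.symm⟩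
      · have := hm.le
        omega
      · show _ ≤ lam y
        omega

theorem joinedIn_region_core
    (hx : core G lam K Δ w (windows G lam Δ w (blk G lam Δ w v)) (cutOf G lam K Δ w) x ∈
      region G lam K Δ w (cutOf G lam K Δ w) j (cutOf G lam K Δ w j + 2 * K)) :
    JoinedIn G (region G lam K Δ w (cutOf G lam K Δ w) j (cutOf G lam K Δ w j + K)) x
      (core G lam K Δ w (windows G lam Δ w (blk G lam Δ w v)) (cutOf G lam K Δ w) x) := by
  have hp := h.parts v
  by_cases hz : x ∈ zones G lam K Δ w (windows G lam Δ w (blk G lam Δ w v)) (cutOf G lam K Δ w)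
  · obtain ⟨i, hi, hxi⟩ := hz
    obtain ⟨h1, h2⟩ := hp.core_spec hi hxi
    rcases hx with hx | ⟨hxm, hxl⟩
    · obtain rfl := hp.disj i hi j hj _ (upper_subset h1).1 (upper_subset hx).1
      exact h2.mono Set.subset_union_left
    · obtain rfl := hp.disj i hi _ (windows_succ hj hxm) _ (upper_subset h1).1 hxl.1
      exact absurd h2.right_mem hxl.2
  · rw [Parts.core_of_notMem hz] at hx ⊢
    exact JoinedIn.refl (region_anti (by omega) hx)

theorem joinedIn_region
    (hx : core G lam K Δ w (windows G lam Δ w (blk G lam Δ w v)) (cutOf G lam K Δ w) x ∈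
      region G lam K Δ w (cutOf G lam K Δ w) j (cutOf G lam K Δ w j + 2 * K))
    (hxy : label G lam K Δ w (blk G lam Δ w v) x = label G lam K Δ w (blk G lam Δ w v) y) :
    JoinedIn G (region G lam K Δ w (cutOf G lam K Δ w) j (cutOf G lam K Δ w j + K)) x y := by
  have hp := h.parts v
  have h1 : JoinedIn G
      (zones G lam K Δ w (windows G lam Δ w (blk G lam Δ w v)) (cutOf G lam K Δ w))ᶜ
      (core G lam K Δ w (windows G lam Δ w (blk G lam Δ w v)) (cutOf G lam K Δ w) x)
      (core G lam K Δ w (windows G lam Δ w (blk G lam Δ w v)) (cutOf G lam K Δ w) y) :=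
    joinedIn_of_comp_eq (hp.core_notMem y) hxy
  have h2 := h1.inter hx fun a b _ ha hab hb => h.mem_region_of_adj hj ha hab hb
  exact ((h.joinedIn_region_core hj hx).trans (h2.mono (Set.inter_subset_right.trans
    (region_anti (by omega))))).trans (h.joinedIn_region_core hj h2.right_mem.2).symm

/-- The node at height j.1 + w, or else the one at j.1 + 2w, is narrow. Vertices reaching up into it
would have a higher base and so belong to another block. -/
theorem lt_of_mem_region {a : ℕ} (hx : x ∈ region G lam K Δ w (cutOf G lam K Δ w) j a)
    (hxv : blk G lam Δ w x = blk G lam Δ w v) :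
    lam x < j.1 + 2 * w ∧ (¬ IsMain G lam Δ (j.1 + w) x → lam x < j.1 + w) := by
  have hb : base G lam Δ w x = (blk G lam Δ w v).1 := congrArg Prod.fst hxv
  obtain ⟨k, u, hk, -, -, -, rfl⟩ := hj
  have e : k * w + w = (k + 1) * w := by ring
  have e' : k * w + w + w = (k + 2) * w := by ring
  have hw := h.w_pos
  have key : ¬ IsMain G lam Δ (k * w + w) x → lam x < k * w + w := fun hm => by
    by_contra hcon
    rw [e] at hm hcon
    have := le_base hw (not_lt.1 hcon) hm
    omega
  refine ⟨?_, key⟩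
  rcases hx with hx | ⟨hxm, hxl⟩
  · have := key (upper_subset hx).1.2
    simp only
    omega
  · by_contra hcon
    have hm := hxl.1.2
    simp only [e'] at hm hcon
    have := le_base hw (by linarith [not_lt.1 hcon]) hm
    omega

end Cuttable

variable {t : ℕ}

/-- The bound for the diameters of the classes of `proj`. -/
def bound (K t w : ℕ) : ℕ := t * (2 * (7 * K + 2 * w) + (thr K t w + 2))

/-- A walk from x to y inside the region can exceed the heights j.1 + w and j.1 + 2w, as given by f,
only in narrow nodes. `chain_of_joinedIn` shortcuts these excursions. The remaining points lie in
the lowest 2w levels above the bottom of window j, so fewer than t balls of radius 7K + 2w cover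
them. -/
theorem Ctx.within_of_label_eq (hC : Ctx G lam K t w) {v x y : V} {j : ℕ × Set V}
    (hj : j ∈ windows G lam (thr K t w) w (blk G lam (thr K t w) w v))
    (hx : core G lam K (thr K t w) w (windows G lam (thr K t w) w (blk G lam (thr K t w) w v))
      (cutOf G lam K (thr K t w) w) x ∈
      region G lam K (thr K t w) w (cutOf G lam K (thr K t w) w) j
        (cutOf G lam K (thr K t w) w j + 2 * K))
    (hxv : blk G lam (thr K t w) w x = blk G lam (thr K t w) w v)
    (hyv : blk G lam (thr K t w) w y = blk G lam (thr K t w) w v)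
    (hxy : label G lam K (thr K t w) w (blk G lam (thr K t w) w v) x =
      label G lam K (thr K t w) w (blk G lam (thr K t w) w v) y) :
    Within G (bound K t w) x y := by
  classical
  have h := hC.cuttable
  have hw := h.w_pos
  have hxy' := h.joinedIn_region hj hx hxy
  set Δ := thr K t w with hΔ
  set S := region G lam K Δ w (cutOf G lam K Δ w) j (cutOf G lam K Δ w j + K) with hS
  let f : V → ℕ := fun a => if IsMain G lam Δ (j.1 + w) a then j.1 + w + w else j.1 + w
  have hf1 : ∀ a, IsMain G lam Δ (j.1 + w) a → f a = j.1 + w + w := fun a ha => if_pos ha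
  have hf2 : ∀ a, ¬ IsMain G lam Δ (j.1 + w) a → f a = j.1 + w := fun a ha => if_neg ha
  have hmix : ∀ a ∈ S, ∀ b ∈ S, G.Adj a b → ¬ IsMain G lam Δ (j.1 + w) a →
      IsMain G lam Δ (j.1 + w) b → lam a + 1 = j.1 + w ∧ lam b = j.1 + w := fun a ha b hb hab h1 h2 =>
    level_of_adj_mains h.level ⟨region_subset ha, h1⟩ ⟨region_subset hb, h2⟩ hab
  have hΩ : ∀ z ∈ S, blk G lam Δ w z = blk G lam Δ w v → lam z < f z := by
    intro z hz hzv
    have := h.lt_of_mem_region hj hz hzv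
    by_cases hm : IsMain G lam Δ (j.1 + w) z
    · rw [hf1 z hm]; omega
    · rw [hf2 z hm]; exact this.2 hm
  have hchain := chain_of_joinedIn (Ω := {z | z ∈ S ∧ lam z < f z}) (Δ := Δ) (lam := lam) f
    (fun a ha ha' => ?_) (fun a ha b hb hab ha' hb' => ?_) (fun a ha b hb hab ha' hb' => ?_)
    ⟨hxy'.left_mem, hΩ x hxy'.left_mem hxv⟩ ⟨hxy'.right_mem, hΩ y hxy'.right_mem hyv⟩ hxy'
  · obtain ⟨n, D⟩ := j
    obtain ⟨k, u, -, -, -, -, e⟩ := id hj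
    obtain ⟨rfl, rfl⟩ := Prod.mk.inj e
    have hkw : k * w = 0 ∨ 3 * K ≤ k * w := by
      rcases Nat.eq_zero_or_pos k with rfl | hk
      · exact Or.inl (Nat.zero_mul _)
      · exact Or.inr (h.width.trans (Nat.le_mul_of_pos_left _ hk))
    obtain ⟨F, hF, hcov⟩ := exists_cover h.level h.one_le hC.two_le hC.not_fat hkw u
    refine within_of_chain_of_cover (F := F) hF.le (Ω := {z | z ∈ S ∧ lam z < f z})
      (fun z hz => hcov (2 * w) z (region_subset hz.1) ?_)
      ⟨hxy'.left_mem, hΩ x hxy'.left_mem hxv⟩ hchain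
    have h1 := hz.2
    by_cases hm : IsMain G lam Δ (k * w + w) z
    · rw [hf1 z hm] at h1; omega
    · rw [hf2 z hm] at h1; omega
  · refine ⟨not_lt.1 fun hcon => ha' ⟨ha, hcon⟩, ?_⟩
    by_cases hm : IsMain G lam Δ (j.1 + w) a
    · rw [hf1 a hm]
      rcases ha with ha | ha
      · exact absurd hm (upper_subset ha).1.2
      · exact ha.2.1.2
    · rwa [hf2 a hm]
  · have h1 : f a ≤ lam a := not_lt.1 fun hcon => ha' ⟨ha, hcon⟩
    have h2 := hb'.2
    have h3 := h.level.adj b a hab.symm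
    by_cases hma : IsMain G lam Δ (j.1 + w) a <;> by_cases hmb : IsMain G lam Δ (j.1 + w) b
    · rw [hf1 a hma] at h1 ⊢; rw [hf1 b hmb] at h2; omega
    · have := hmix b hb a ha hab.symm hmb hma
      rw [hf1 a hma] at h1; omega
    · have := hmix a ha b hb hab hma hmb
      rw [hf2 a hma] at h1; omega
    · rw [hf2 a hma] at h1 ⊢; rw [hf2 b hmb] at h2; omega
  · have h1 : f a ≤ lam a := not_lt.1 fun hcon => ha' ⟨ha, hcon⟩
    have h2 : f b ≤ lam b := not_lt.1 fun hcon => hb' ⟨hb, hcon⟩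
    by_cases hma : IsMain G lam Δ (j.1 + w) a <;> by_cases hmb : IsMain G lam Δ (j.1 + w) b
    · rw [hf1 a hma, hf1 b hmb]
    · have := hmix b hb a ha hab.symm hmb hma
      rw [hf2 b hmb] at h2; omega
    · have := hmix a ha b hb hab hma hmb
      rw [hf2 a hma] at h1; omega
    · rw [hf2 a hma, hf2 b hmb]

/-- A vertex that belongs to no region lies near the bottom of its block. -/
theorem Cuttable.exists_region (h : Cuttable G lam K Δ w) {v x : V}
    (hxv : blk G lam Δ w x = blk G lam Δ w v) :
    (∃ j ∈ windows G lam Δ w (blk G lam Δ w v),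
      core G lam K Δ w (windows G lam Δ w (blk G lam Δ w v)) (cutOf G lam K Δ w) x ∈
      region G lam K Δ w (cutOf G lam K Δ w) j (cutOf G lam K Δ w j + 2 * K)) ∨
    lam x < (blk G lam Δ w v).1 * w + w := by
  have hp := h.parts v
  have hw := h.w_pos
  have hxb : x ∈ (blk G lam Δ w v).2 := hxv ▸ mem_blk x
  have hb : base G lam Δ w x = (blk G lam Δ w v).1 := congrArg Prod.fst hxv
  by_cases hlt : lam x < (blk G lam Δ w v).1 * w + w
  · exact Or.inr hlt
  left
  obtain ⟨k, hk⟩ : ∃ k, k = lam x / w := ⟨_, rfl⟩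
  have h1 : k * w ≤ lam x := by rw [hk]; exact Nat.div_mul_le_self _ _
  have h2 : lam x < k * w + w := by rw [hk]; exact Nat.lt_div_mul_add hw
  have hk0 : (blk G lam Δ w v).1 < k := by
    by_contra hcon
    have := Nat.mul_le_mul_right w (not_lt.1 hcon)
    omega
  have hmain : ∀ l, (blk G lam Δ w v).1 < l → l ≤ k → IsMain G lam Δ (l * w) x := fun l hl hlk =>
    isMain_of_base_lt hw ((Nat.mul_le_mul_right w hlk).trans h1) (by omega)
  have hi : (k * w, node G lam (k * w) x) ∈ windows G lam Δ w (blk G lam Δ w v) :=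
    ⟨k, x, hk0.le, hxb, h1, hmain, rfl⟩
  have hbody : x ∈ body G lam Δ w (k * w) (node G lam (k * w) x) :=
    ⟨mem_node_self h1, fun hm => by have := hm.le; omega⟩
  by_cases hxU : x ∈ upper G lam Δ w (k * w) (node G lam (k * w) x)
      (cutOf G lam K Δ w (k * w, node G lam (k * w) x) + K)
  · refine ⟨_, hi, Or.inl ?_⟩
    by_cases hxU2 : x ∈ upper G lam Δ w (k * w) (node G lam (k * w) x)
        (cutOf G lam K Δ w (k * w, node G lam (k * w) x) + 2 * K)
    · rwa [Parts.core_of_notMem (hp.upper_subset_compl hi hxU2)]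
    · exact (hp.core_spec hi ⟨hxU, hxU2⟩).1
  · rw [Parts.core_of_notMem (hp.lower_subset_compl hi ⟨hbody, hxU⟩)]
    have e : (k - 1) * w + w = k * w := by
      conv_rhs => rw [← Nat.sub_add_cancel (show 1 ≤ k by omega)]
      ring
    refine ⟨((k - 1) * w, node G lam ((k - 1) * w) x), ⟨k - 1, x, by omega, hxb, by omega,
      fun l hl hlk => hmain l hl (by omega), rfl⟩, Or.inr ⟨⟨mem_node_self (by omega), ?_⟩, ?_⟩⟩
    · simp only [e]
      exact hmain k hk0 le_rfl
    · simp only [e]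
      exact ⟨hbody, hxU⟩

/-- If neither vertex is assigned to a region, both are less than w above the bottom of their block.
That bottom is narrow or the root alone, so descending to it connects them by a short walk. -/
theorem Ctx.within_of_proj_eq (hC : Ctx G lam K t w) {x y : V}
    (hxy : proj G lam K (thr K t w) w x = proj G lam K (thr K t w) w y) :
    Within G (bound K t w) x y := by
  have h := hC.cuttable
  have ht := hC.two_le
  have hb : blk G lam (thr K t w) w x = blk G lam (thr K t w) w y := congrArg Prod.fst hxy
  have hl := h.label_eq_of_proj_eq x hxy
  rcases h.exists_region (v := x) (x := x) rfl with ⟨j, hj, hjx⟩ | hx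
  · exact hC.within_of_label_eq hj hjx rfl hb.symm hl
  rcases h.exists_region (v := x) (x := y) hb.symm with ⟨j, hj, hjy⟩ | hy
  · exact (hC.within_of_label_eq hj hjy hb.symm rfl hl.symm).symm
  set Δ := thr K t w with hΔ
  have hyn := Cuttable.mem_node_of_blk_eq hb
  obtain ⟨x', hx', hxx'⟩ := h.level.exists_desc (base_mul_le (G := G) (Δ := Δ) (w := w) x)
  obtain ⟨y', hy', hyy'⟩ := h.level.exists_desc (le_of_mem_node hyn)
  have hxn' := mem_node_of_desc (mem_blk (G := G) (Δ := Δ) (w := w) x) hxx' hx'.ge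
  have hyn' := mem_node_of_desc hyn hyy' hy'.ge
  have hd : Within G Δ x' y' := by
    rcases base_spec (G := G) (lam := lam) (Δ := Δ) (w := w) x with h0 | h0
    · rw [h0, Nat.zero_mul] at hx' hy'
      have := h.level.root x' y' ((JoinedIn.reachable hxn').symm.trans (JoinedIn.reachable hyn')) hx' hy'
      rw [this]
      exact Within.refl _ _
    · by_contra hcon
      exact h0 ⟨x', hxn', y', hyn', hx', hy', hcon⟩
  have e : (blk G lam Δ w x).1 = base G lam Δ w x := rfl
  rw [e] at hx hy
  refine ((hxx'.within.trans hd).trans hyy'.within.symm).mono ?_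
  have h1 : 1 * (2 * (7 * K + 2 * w) + (Δ + 2)) ≤ bound K t w := Nat.mul_le_mul_right _ (by omega)
  omega

end Regions

/-! ### Contractions as quasi-isometries. -/

section QuasiIsometries

variable {V β : Type*} {G : SimpleGraph V} {p : V → β}

theorem Within.quot {n : ℕ} {x y : V} (h : Within G n x y) :
    Within (quot G p) n ⟨p x, x, rfl⟩ ⟨p y, y, rfl⟩ := by
  induction n generalizing y with
  | zero => rw [h.eq_of_zero]; exact Within.refl _ _
  | succ n ih =>
    rcases h.succ_cases with h | ⟨z, hz, hzy⟩
    · exact (ih h).mono (Nat.le_succ n)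
    · by_cases e : p z = p y
      · have := ih hz
        simp only [e] at this
        exact this.mono (Nat.le_succ n)
      · exact (ih hz).trans (Within.of_adj ⟨fun e' => e (congrArg Subtype.val e'), z, y, rfl, rfl, hzy⟩)

theorem Within.of_quot {B n : ℕ} (hB : ∀ x y, p x = p y → Within G B x y) {X Y : Set.range p}
    (h : Within (FatMinor.quot G p) n X Y) :
    ∀ x y, p x = X → p y = Y → Within G (B + (B + 1) * n) x y := by
  induction n generalizing Y with
  | zero =>
    intro x y hx hy
    rw [h.eq_of_zero] at hx
    exact (hB x y (hx.trans hy.symm)).mono (by omega)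
  | succ n ih =>
    intro x y hx hy
    rcases h.succ_cases with h | ⟨Z, hZ, -, z, y', hz, hy', hzy⟩
    · exact (ih h x y hx hy).mono (by rw [Nat.mul_succ]; omega)
    · exact (((ih hZ x z hx hz).trans (Within.of_adj hzy)).trans
        (hB y' y (hy'.trans hy.symm))).mono (by rw [Nat.mul_succ]; omega)

theorem edist_quot_le (x y : V) :
    (quot G p).edist ⟨p x, x, rfl⟩ ⟨p y, y, rfl⟩ ≤ G.edist x y := by
  rcases eq_or_ne (G.edist x y) ⊤ with h | h
  · rw [h]; exact le_top
  · obtain ⟨n, hn⟩ := ENat.ne_top_iff_exists.1 h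
    rw [← hn]
    exact within_iff_edist_le.1 (Within.quot (within_iff_edist_le.2 hn.ge))

/-- Writing B + (B+1)n ≤ (B+1)(n+1) moves the whole loss into the factor, which leaves 1 as additive
constant. -/
theorem edist_le_of_quot {B : ℕ} (hB : ∀ x y, p x = p y → Within G B x y) (x y : V) :
    (G.edist x y : ℝ≥0∞) ≤
      ((B + 1 : ℕ) : ℝ≥0∞) * (((quot G p).edist ⟨p x, x, rfl⟩ ⟨p y, y, rfl⟩ : ℕ∞) + 1) := by
  rcases eq_or_ne ((quot G p).edist ⟨p x, x, rfl⟩ ⟨p y, y, rfl⟩) ⊤ with h | h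
  · rw [h]
    simp
  · obtain ⟨n, hn⟩ := ENat.ne_top_iff_exists.1 h
    rw [← hn]
    have h1 : Within G ((B + 1) * (n + 1)) x y :=
      (Within.of_quot hB (within_iff_edist_le.2 hn.ge) x y rfl rfl).mono (by ring_nf; omega)
    have h2 : (G.edist x y : ℝ≥0∞) ≤ (((B + 1) * (n + 1) : ℕ) : ℕ∞) :=
      ENat.toENNReal_le.2 (within_iff_edist_le.1 h1)
    refine h2.trans (le_of_eq ?_)
    push_cast
    rfl

theorem quasiIsometric_quot {B M : ℕ} (hB : ∀ x y, p x = p y → Within G B x y) (hM : B + 1 ≤ M) :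
    QuasiIsometric G (quot G p) (M : ℝ≥0) 1 := by
  have hM0 : (M : ℝ≥0) ≠ 0 := by
    have : M ≠ 0 := by omega
    exact_mod_cast this
  refine ⟨fun x => ⟨p x, x, rfl⟩, ⟨?_, fun x y => ?_, fun x y => ?_, ?_⟩⟩
  · have : 1 ≤ M := by omega
    exact_mod_cast this
  · rw [tsub_le_iff_right, ENNReal.coe_inv hM0, ← ENNReal.div_eq_inv_mul]
    refine ENNReal.div_le_of_le_mul' ((edist_le_of_quot hB x y).trans ?_)
    rw [ENNReal.coe_natCast]
    gcongr
    simp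
  · have h1 : ((quot G p).edist ⟨p x, x, rfl⟩ ⟨p y, y, rfl⟩ : ℝ≥0∞) ≤ (G.edist x y : ℝ≥0∞) :=
      ENat.toENNReal_le.2 (edist_quot_le x y)
    refine h1.trans (le_add_right (le_mul_of_one_le_left zero_le ?_))
    have : 1 ≤ M := by omega
    exact_mod_cast this
  · rintro ⟨_, x, rfl⟩
    exact ⟨x, by simp⟩

theorem quasiIsometric_refl (G : SimpleGraph V) : QuasiIsometric G G 1 0 :=
  ⟨id, ⟨le_rfl, fun x y => by simp, fun x y => by simp, fun x => ⟨x, by simp⟩⟩⟩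

/-- A graph of bounded diameter is quasi-isometric to a point. -/
theorem quasiIsometric_quot_unit {K : ℕ} (h : ∀ x y, Within G K x y) :
    QuasiIsometric G (quot G fun _ => PUnit.unit.{u + 1}) 1 (K : ℝ≥0) := by
  have hs : ∀ X Y : Set.range fun _ : V => PUnit.unit.{u + 1}, X = Y := fun X Y =>
    Subtype.ext rfl
  refine ⟨fun x => ⟨_, x, rfl⟩, ⟨le_rfl, fun x y => ?_, fun x y => ?_, ?_⟩⟩
  · have h1 : (G.edist x y : ℝ≥0∞) ≤ ((K : ℕ∞) : ℝ≥0∞) :=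
      ENat.toENNReal_le.2 (within_iff_edist_le.1 (h x y))
    simp only [inv_one, ENNReal.coe_one, one_mul, ENNReal.coe_natCast]
    rw [tsub_eq_zero_of_le (h1.trans (by simp))]
    exact zero_le
  · simp
  · rintro ⟨_, x, rfl⟩
    exact ⟨x, by simp⟩

end QuasiIsometries

/-! ### The cases K = 0 and t ≤ 1. -/

section SmallCases

variable {V : Type*} {G : SimpleGraph V}

theorem isFatMinor_zero {t : ℕ} (h : IsMinor (K2 t) G) : IsFatMinor 0 (K2 t) G :=
  h.elim fun m => ⟨m, ⟨fun _ _ _ => by simp, fun _ _ _ => by simp, fun _ _ _ => by simp⟩⟩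

theorem isConn_singleton (v : V) : IsConn G {v} :=
  IsConn.of_center v rfl fun u hu => by rw [Set.mem_singleton_iff.1 hu]; exact JoinedIn.refl rfl

/-- K_{2,0} has no edges, so any two distant vertices form a fat model of it. -/
theorem within_of_not_isFatMinor_zero {K : ℕ} (h : ¬ IsFatMinor K (K2 0) G) (u v : V) :
    Within G K u v := by
  by_contra hcon
  refine h (isFatMinor_of_paths (Q := fun _ _ => ∅)
    (Sum.elim (fun i : Fin 2 => if i = 0 then {u} else {v}) (fun k => k.elim0)) ?_ ?_
    (fun _ k => k.elim0) (fun _ k => k.elim0) (fun _ k => k.elim0))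
  · rintro (i | k)
    · simp only [Sum.elim_inl]
      split_ifs
      exacts [isConn_singleton u, isConn_singleton v]
    · exact k.elim0
  · have hfar : ¬ Within G (K - 1) u v := fun h' => hcon (h'.mono (Nat.sub_le _ _))
    rintro (i | k) (j | l) hne x hx y hy
    · have hij : i ≠ j := fun e => hne (congrArg _ e)
      fin_cases i <;> fin_cases j <;> simp_all
      exact fun h' => hfar h'.symm
    · exact l.elim0
    · exact k.elim0
    · exact k.elim0

theorem not_isMinor_quot_unit : ¬ IsMinor (K2 0) (quot G fun _ => PUnit.unit.{u + 1}) := by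
  intro h
  obtain ⟨S, hS, hd, -⟩ := exists_sets_of_isMinor h
  obtain ⟨⟨X, hX⟩, -⟩ := hS (.inl 0)
  obtain ⟨⟨Y, hY⟩, -⟩ := hS (.inl 1)
  have hXY : X = Y := Subtype.ext rfl
  exact Set.disjoint_left.1 (hd (.inl 0) (.inl 1) (by simp)) hX (hXY ▸ hY)

/-- For t = 1 a single vertex at level 3K is a hub with a gate, so all levels are below 3K. -/
theorem within_of_not_isFatMinor_one {K : ℕ} (hK : 1 ≤ K) (h : ¬ IsFatMinor K (K2 1) G) {u v : V}
    (huv : G.Reachable u v) : Within G (6 * K) u v := by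
  obtain ⟨lam, hL⟩ := exists_isLevel G
  have hlt : ∀ v, lam v < 3 * K := by
    intro v
    by_contra hcon
    obtain ⟨x, hx, -⟩ := hL.exists_desc (not_lt.1 hcon)
    exact h (isFatMinor_of_gates hL hK (m := 3 * K) le_rfl (isConn_singleton x)
      (fun b hb => by rw [Set.mem_singleton_iff.1 hb, hx]) (fun _ => x) (fun _ => rfl) (fun _ => hx)
      fun k l hkl => absurd (Subsingleton.elim k l) hkl)
  obtain ⟨a, ha, hua⟩ := hL.exists_desc (Nat.zero_le (lam u))
  obtain ⟨b, hb, hvb⟩ := hL.exists_desc (Nat.zero_le (lam v))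
  obtain rfl := hL.root a b ((hua.within.reachable.symm.trans huv).trans hvb.within.reachable) ha hb
  exact (hua.within.trans hvb.within.symm).mono (by have := hlt u; have := hlt v; omega)

/-- Contracting every component leaves no edge. -/
theorem not_isMinor_quot_components {t : ℕ} (ht : 1 ≤ t) :
    ¬ IsMinor (K2 t) (quot G G.connectedComponentMk) := by
  intro h
  obtain ⟨S, -, -, hadj⟩ := exists_sets_of_isMinor h
  obtain ⟨X, -, Y, -, hne, x, y, hx, hy, hxy⟩ := hadj 0 ⟨0, ht⟩
  exact hne (Subtype.ext ((hx.symm.trans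
    (SimpleGraph.ConnectedComponent.sound hxy.reachable)).trans hy))

end SmallCases

/-- For this w the bound is a polynomial of degree 7 in t, up to the factor K. The summand 204 t^9 K
alone exceeds it, since t ≥ 2 lets t^9 absorb the lower powers. -/
theorem bound_add_one_le {K t : ℕ} (hK : 1 ≤ K) (ht : 2 ≤ t) :
    bound K t (28 * K + 3 * K * (t ^ 5 + 1)) + 1 ≤ 9 * t ^ 12 * K + 204 * t ^ 9 * K := by
  have hp : ∀ j k, 2 ^ k * t ^ j ≤ t ^ (k + j) := fun j k => by
    rw [pow_add]
    exact Nat.mul_le_mul_right _ (Nat.pow_le_pow_left ht k)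
  have h1 := hp 1 8
  have h2 := hp 2 7
  have h6 := hp 6 3
  have h7 := hp 7 2
  have h0 : 1 ≤ t ^ 9 := Nat.one_le_pow _ _ (by omega)
  norm_num at h1 h2 h6 h7
  have hsum : 222 * t + 85 * t ^ 2 + 18 * t ^ 6 + 6 * t ^ 7 + 1 ≤ 204 * t ^ 9 := by omega
  calc bound K t (28 * K + 3 * K * (t ^ 5 + 1)) + 1
      = (220 * t + 85 * t ^ 2 + 18 * t ^ 6 + 6 * t ^ 7) * K + (2 * t + 1) * 1 := by
        simp only [bound, thr, rad]
        ring
    _ ≤ (220 * t + 85 * t ^ 2 + 18 * t ^ 6 + 6 * t ^ 7) * K + (2 * t + 1) * K := by gcongr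
    _ = (222 * t + 85 * t ^ 2 + 18 * t ^ 6 + 6 * t ^ 7 + 1) * K := by ring
    _ ≤ 204 * t ^ 9 * K := Nat.mul_le_mul_right _ hsum
    _ ≤ _ := Nat.le_add_left _ _

end FatMinor

/-! ### Assembly of the cases. -/

theorem theorem1p2 (t : ℕ) :
    ∃ f : ℕ → ℕ × ℕ,
      (∀ (K : ℕ) (V : Type u) (G : SimpleGraph V),
        ¬ FatMinor.IsFatMinor K (FatMinor.K2 t) G →
          ∃ (W : Type u) (H : SimpleGraph W),
            ¬ FatMinor.IsMinor (FatMinor.K2 t) H ∧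
            FatMinor.QuasiIsometric G H ((f K).1 : NNReal) ((f K).2 : NNReal)) ∧
      (1 ≤ t → ∀ K : ℕ, 1 ≤ K → f K = (9 * t ^ 12 * K + 204 * t ^ 9 * K, 1)) := by
  rcases Nat.eq_zero_or_pos t with rfl | ht
  · refine ⟨fun K => (1, K), fun K V G hG => ?_, fun h => absurd h (by omega)⟩
    refine ⟨_, _, FatMinor.not_isMinor_quot_unit.{u} (G := G), ?_⟩
    simpa using FatMinor.quasiIsometric_quot_unit (FatMinor.within_of_not_isFatMinor_zero hG)
  refine ⟨fun K => if K = 0 then (1, 0) else (9 * t ^ 12 * K + 204 * t ^ 9 * K, 1),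
    fun K V G hG => ?_, fun _ K hK => if_neg (by omega)⟩
  rcases Nat.eq_zero_or_pos K with rfl | hK
  -- Being 0-fat is no restriction on a model, so G itself serves.
  · refine ⟨V, G, fun h => hG (FatMinor.isFatMinor_zero h), ?_⟩
    simpa using FatMinor.quasiIsometric_refl G
  simp only [if_neg (show K ≠ 0 by omega), Nat.cast_one]
  rcases Nat.eq_or_lt_of_le ht with rfl | ht'
  · exact ⟨_, _, FatMinor.not_isMinor_quot_components le_rfl,
      FatMinor.quasiIsometric_quot (B := 6 * K) (fun x y hxy =>
        FatMinor.within_of_not_isFatMinor_one hK hG (SimpleGraph.ConnectedComponent.exact hxy))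
        (by norm_num; omega)⟩
  · obtain ⟨lam, hL⟩ := FatMinor.exists_isLevel G
    -- The height w of the windows is the least that `Ctx` admits.
    have hC : FatMinor.Ctx G lam K t (28 * K + 3 * K * (t ^ 5 + 1)) := ⟨hL, hK, ht', le_rfl, hG⟩
    exact ⟨_, _, fun h => hG (hC.cuttable.isFatMinor ht' h),
      FatMinor.quasiIsometric_quot (fun _ _ => hC.within_of_proj_eq)
        (FatMinor.bound_add_one_le hK ht')⟩
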